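/- All vector spaces are over $\mathbb C$ and all modules over (Lie) superalgebras are $\mathbb Z_2$-graded; a module is simple if it is nonzero and its only graded submodules are $0$ and itself; isomorphisms preserve parity. Let $q,n\in\mathbb Z_{\ge 0}$ with $(q,n)\neq(0,0)$, let $A_{q,n}=\mathbb C[t_1,\dots,t_q]\otimes\Lambda(\xi_1,\dots,\xi_n)$, write $t_{q+j}:=\xi_j$, $\partial_i:=\partial/\partial t_i$, and $|t_i|\in\mathbb Z_2$ for the parity of $t_i$. Let $W_{q,n}$ be the Lie superalgebra of superderivations of $A_{q,n}$, let $\mathcal K_{q,n}$ be the Weyl superalgebra generated by $A_{q,n}$ and $\partial_1,\dots,\partial_{q+n}$, and let $\mathfrak{gl}_{q,n}=\mathfrak{gl}(\mathbb C^{q|n})$ with matrix units $E_{s,i}$. Let $\mathfrak k$ be a Levi subalgebra of $\mathfrak{gl}_p$ for some $p\ge 0$ (after a change of basis, the block diagonal matrices for some partition of $\{1,\dots,p\}$), and let $\mathfrak h'\subseteq\mathfrak k$ be its Cartan subalgebra (the diagonal matrices in such a basis). Put $$\hat{\mathfrak k}=W_{q,n}\ltimes(\mathfrak k\otimes A_{q,n}),\qquad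 \hat{\mathfrak h}=\operatorname{span}\{t_i\partial_i: 1\le i\le q\}\oplus(\mathfrak h'\otimes 1).$$ An $A_{q,n}\hat{\mathfrak k}$-module is a module over the Lie superalgebra $W_{q,n}\ltimes(\mathfrak k\otimes A_{q,n}\oplus A_{q,n})$ on which $A_{q,n}$ acts associatively and unitally; here $[X,x\otimes f]=x\otimes X(f)$, $[X,f]=X(f)$, $[x\otimes f,y\otimes g]=[x,y]\otimes fg$ and $[x\otimes f,g]=[f,g]=0$ for $X\in W_{q,n}$, $x,y\in\mathfrak k$, $f,g\in A_{q,n}$. An $A_{q,n}\hat{\mathfrak k}$-module (respectively a $\mathfrak k$-module) is bounded if $\hat{\mathfrak h}$ (respectively $\mathfrak h'$) acts diagonalizably and the dimensions of the weight spaces are finite and uniformly bounded. A $\mathcal K_{q,n}$-module is a weight module if all $t_i\partial_i$, $1\le i\le q+n$, act diagonalizably. For a $\mathcal K_{q,n}$-module $P$, a $\mathfrak{gl}_{q,n}$-module $M$ and a $\mathfrak k$-module $S$, let $\mathcal F(F(P,M),S)$ be the $A_{q,n}\hat{\mathfrak k}$-module with underlying superspace $P\otimes M\otimes S$ and with the action,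 for homogeneous $u\in P$ and $f\in A_{q,n}$, $$f\cdot(u\otimes v\otimes s)=fu\otimes v\otimes s,\qquad (x\otimes f)\cdot(u\otimes v\otimes s)=fu\otimes v\otimes xs,$$ $$(f\partial_i)\cdot(u\otimes v\otimes s)=f\partial_iu\otimes v\otimes s+\sum_{k=1}^{q+n}(-1)^{|t_k|(|f|-1)}(-1)^{(|t_k|+|t_i|)|u|}\,\partial_k(f)u\otimes E_{k,i}v\otimes s .$$ **Theorem.** Every simple bounded $A_{q,n}\hat{\mathfrak k}$-module is isomorphic to $\mathcal F(F(P,M),S)$ for some simple weight $\mathcal K_{q,n}$-module $P$, some finite-dimensional simple $\mathfrak{gl}_{q,n}$-module $M$ and some simple bounded $\mathfrak k$-module $S$. -/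

import Mathlib

universe u

open scoped TensorProduct

attribute [local instance 100] LieRing.ofAssociativeRing

noncomputable section

namespace SuperVF

/-! ### Signs, supercommutators and superspaces -/

/-- The Koszul sign `(-1)^(d e)`. -/
def ksign (d e : ZMod 2) : ℂ := (-1) ^ (d.val * e.val)

/-- The supercommutator `x y - (-1)^(d e) y x` of elements `x`, `y` of parities `d`, `e`. -/
def scomm {R : Type*} [Ring R] [Algebra ℂ R] (d e : ZMod 2) (x y : R) : R :=
  x * y - ksign d e • (y * x)

section Generic

variable {V : Type*} [AddCommGroup V] [Module ℂ V]

/-- A linear operator is homogeneous of parity `d` for the grading `V = part 0 ⊕ part 1`. -/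
def IsHomogeneous (part : ZMod 2 → Submodule ℂ V) (d : ZMod 2) (T : Module.End ℂ V) : Prop :=
  ∀ e, ∀ v ∈ part e, T v ∈ part (d + e)

/-- A subspace is graded if it is the sum of its homogeneous parts. -/
def IsGraded (part : ZMod 2 → Submodule ℂ V) (N : Submodule ℂ V) : Prop :=
  N ≤ (N ⊓ part 0) ⊔ (N ⊓ part 1)

/-- Simplicity of a superspace on which the operators `ops` act: it is nonzero, and its only
invariant graded subspaces are `0` and everything. -/
def IsSimpleUnder (part : ZMod 2 → Submodule ℂ V) (ops : Set (Module.End ℂ V)) : Prop :=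
  Nontrivial V ∧ ∀ N : Submodule ℂ V, IsGraded part N → (∀ T ∈ ops, ∀ v ∈ N, T v ∈ N) →
    N = ⊥ ∨ N = ⊤

/-- The simultaneous eigenspace of the operators `h i` with eigenvalues `wt i`. When `h` is linear
in `i`, a nonzero simultaneous eigenspace forces `wt` to be a linear functional. -/
def wtSpace {ι : Type*} (h : ι → Module.End ℂ V) (wt : ι → ℂ) : Submodule ℂ V :=
  ⨅ i, Module.End.eigenspace (h i) (wt i)

/-- The operators `h i` are simultaneously diagonalizable. -/
def IsWeight {ι : Type*} (h : ι → Module.End ℂ V) : Prop :=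
  ⨆ wt : ι → ℂ, wtSpace h wt = ⊤

/-- The operators `h i` are simultaneously diagonalizable and the dimensions of the weight spaces
are finite and uniformly bounded. -/
def IsBounded {ι : Type*} (h : ι → Module.End ℂ V) : Prop :=
  IsWeight h ∧ ∃ c : ℕ, ∀ wt : ι → ℂ, Module.rank ℂ (wtSpace h wt) ≤ c

end Generic

/-! ### The superalgebra `A = ℂ[t₁,…,t_q] ⊗ Λ(ξ₁,…,ξ_n)` and its superderivations -/

/-- Indices of the variables: `inl i` stands for `t_i`, `inr j` for `ξ_j`. -/
abbrev Idx (q n : ℕ) := Fin q ⊕ Fin n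

/-- The parity of a variable. -/
def par {q n : ℕ} : Idx q n → ZMod 2
  | .inl _ => 0
  | .inr _ => 1

/-- The superalgebra `A_{q,n}`. As the polynomial factor is purely even, the super tensor product
is the ordinary one. -/
abbrev A (q n : ℕ) := MvPolynomial (Fin q) ℂ ⊗[ℂ] ExteriorAlgebra ℂ (Fin n → ℂ)

/-- The homogeneous part of parity `d` of `A_{q,n}`. -/
def A.part (q n : ℕ) (d : ZMod 2) : Submodule ℂ (A q n) :=
  Submodule.map₂ (TensorProduct.mk ℂ (MvPolynomial (Fin q) ℂ) (ExteriorAlgebra ℂ (Fin n → ℂ)))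
    ⊤ (CliffordAlgebra.evenOdd (0 : QuadraticForm ℂ (Fin n → ℂ)) d)

/-- The variables `t_i`, `ξ_j` in `A_{q,n}`. -/
def A.gen {q n : ℕ} : Idx q n → A q n
  | .inl i => MvPolynomial.X i ⊗ₜ 1
  | .inr j => 1 ⊗ₜ ExteriorAlgebra.ι ℂ (Pi.single j 1)

/-- The partial derivatives `∂/∂t_i` and (left, odd) `∂/∂ξ_j` of `A_{q,n}`. -/
def A.der {q n : ℕ} : Idx q n → Module.End ℂ (A q n)
  | .inl i => LinearMap.rTensor _ (MvPolynomial.pderiv i).toLinearMap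
  | .inr j => LinearMap.lTensor _
      (CliffordAlgebra.contractLeft (Q := (0 : QuadraticForm ℂ (Fin n → ℂ)))
        (LinearMap.proj j : Module.Dual ℂ (Fin n → ℂ)))

/-- The part of parity `d` of the Lie superalgebra `W_{q,n}`: the superderivations of `A_{q,n}` of
parity `d`. -/
def W (q n : ℕ) (d : ZMod 2) : Submodule ℂ (Module.End ℂ (A q n)) where
  carrier := {D | ∀ e, ∀ a ∈ A.part q n e, D a ∈ A.part q n (d + e) ∧
    ∀ b, D (a * b) = D a * b + ksign d e • (a * D b)}
  add_mem' {D E} hD hE e a ha := by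
    refine ⟨add_mem (hD e a ha).1 (hE e a ha).1, fun b => ?_⟩
    simp only [LinearMap.add_apply, (hD e a ha).2 b, (hE e a ha).2 b, add_mul, mul_add, smul_add]
    abel
  zero_mem' e a ha := by simp
  smul_mem' c D hD e a ha := by
    refine ⟨Submodule.smul_mem _ _ (hD e a ha).1, fun b => ?_⟩
    simp only [LinearMap.smul_apply, (hD e a ha).2 b, smul_add, smul_mul_assoc, mul_smul_comm]
    rw [smul_comm c]

theorem ksign_comm (d e : ZMod 2) : ksign d e = ksign e d := by
  simp only [ksign, mul_comm]

theorem ksign_add_left (d e f : ZMod 2) : ksign (d + e) f = ksign d f * ksign e f := by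
  have h : ∀ d e f : ZMod 2, Even ((d + e).val * f.val) ↔ Even (d.val * f.val + e.val * f.val) := by
    decide
  simp only [ksign, ← pow_add]
  rcases Nat.even_or_odd ((d + e).val * f.val) with h1 | h1
  · rw [h1.neg_one_pow, ((h d e f).1 h1).neg_one_pow]
  · rw [h1.neg_one_pow, Odd.neg_one_pow]
    rw [← Nat.not_even_iff_odd] at h1 ⊢
    rwa [← h]

/-- The supercommutator of superderivations is a superderivation. -/
theorem W.scomm_mem {q n : ℕ} {d e : ZMod 2} {X Y : Module.End ℂ (A q n)} (hX : X ∈ W q n d)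
    (hY : Y ∈ W q n e) : scomm d e X Y ∈ W q n (d + e) := by
  intro f a ha
  have h1 := hX f a ha
  have h2 := hY f a ha
  have h3 := hX (e + f) (Y a) h2.1
  have h4 := hY (d + f) (X a) h1.1
  refine ⟨?_, fun b => ?_⟩
  · have h4' := h4.1
    rw [show e + (d + f) = d + e + f by ring] at h4'
    have h3' := h3.1
    rw [← add_assoc] at h3'
    exact sub_mem h3' (Submodule.smul_mem _ _ h4')
  · simp only [scomm, LinearMap.sub_apply, LinearMap.smul_apply, Module.End.mul_apply, h1.2, h2.2,
      map_add, map_smul, h3.2, h4.2, ksign_add_left, ksign_comm _ (e + f), ksign_comm _ (d + f),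
      smul_add, smul_sub, mul_sub, sub_mul, smul_mul_assoc, mul_smul_comm, smul_smul]
    simp only [ksign_comm f, ksign_comm e d]
    have h : ∀ x y : ZMod 2, ksign x y = 1 ∨ ksign x y = -1 := fun x y =>
      neg_one_pow_eq_or ℂ _
    rcases h d e with h1 | h1 <;> rcases h d f with h2 | h2 <;> rcases h e f with h3 | h3 <;>
      simp only [h1, h2, h3, mul_one, mul_neg, neg_neg, one_smul, neg_smul] <;>
      module

theorem A.gen_inl_mem {q n : ℕ} (i : Fin q) : (A.gen (.inl i) : A q n) ∈ A.part q n 0 :=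
  Submodule.apply_mem_map₂ _ trivial
    (CliffordAlgebra.one_le_evenOdd_zero _ (Submodule.one_le.1 le_rfl))

/-- The even vector field `d_i = t_i ∂/∂t_i`. -/
def W.euler {q n : ℕ} (i : Fin q) : W q n 0 :=
  ⟨LinearMap.mulLeft ℂ (A.gen (.inl i)) * A.der (.inl i), by
    intro e a ha
    constructor
    · rw [zero_add]
      refine (Submodule.map₂_le (r := (A.part q n e).comap
        (LinearMap.mulLeft ℂ (A.gen (.inl i)) * A.der (.inl i)))).2 ?_ ha
      intro p _ w hw
      simp only [Submodule.mem_comap, TensorProduct.mk_apply, Module.End.mul_apply, A.der, A.gen,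
        LinearMap.rTensor_tmul, LinearMap.mulLeft_apply, Algebra.TensorProduct.tmul_mul_tmul,
        one_mul]
      exact Submodule.apply_mem_map₂ _ trivial hw
    · intro b
      have key : ∀ a b : A q n, A.der (.inl i) (a * b) =
          A.der (.inl i) a * b + a * A.der (.inl i) b := by
        intro a b
        induction a using TensorProduct.induction_on with
        | zero => simp
        | add x y hx hy => simp only [add_mul, map_add, hx, hy]; abel
        | tmul p w =>
          induction b using TensorProduct.induction_on with
          | zero => simp
          | add x y hx hy => simp only [mul_add, map_add, hx, hy]; abel
          | tmul p' w' =>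
            simp [A.der, Algebra.TensorProduct.tmul_mul_tmul, TensorProduct.add_tmul, mul_comm,
              add_comm]
      have hc : A.gen (.inl i) * a = a * (A.gen (.inl i) : A q n) := by
        clear ha
        induction a using TensorProduct.induction_on with
        | zero => simp
        | add x y hx hy => simp only [mul_add, add_mul, hx, hy]
        | tmul p w => simp [A.gen, Algebra.TensorProduct.tmul_mul_tmul, mul_comm]
      simp only [ksign, ZMod.val_zero, zero_mul, pow_zero, one_smul, Module.End.mul_apply,
        LinearMap.mulLeft_apply, key, mul_add, ← mul_assoc, hc]⟩

/-! ### The Weyl superalgebra and its modules -/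

/-- The defining relations of the Weyl superalgebra. The generators are the elements of `A_{q,n}`,
whose algebra structure is kept, and the derivatives `∂_i`. -/
inductive Weyl.Rel (q n : ℕ) :
    FreeAlgebra ℂ (A q n ⊕ Idx q n) → FreeAlgebra ℂ (A q n ⊕ Idx q n) → Prop
  | one : Weyl.Rel q n (FreeAlgebra.ι ℂ (.inl 1)) 1
  | add (a b : A q n) : Weyl.Rel q n (FreeAlgebra.ι ℂ (.inl (a + b)))
      (FreeAlgebra.ι ℂ (.inl a) + FreeAlgebra.ι ℂ (.inl b))
  | smul (c : ℂ) (a : A q n) : Weyl.Rel q n (FreeAlgebra.ι ℂ (.inl (c • a)))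
      (c • FreeAlgebra.ι ℂ (.inl a))
  | mul (a b : A q n) : Weyl.Rel q n (FreeAlgebra.ι ℂ (.inl (a * b)))
      (FreeAlgebra.ι ℂ (.inl a) * FreeAlgebra.ι ℂ (.inl b))
  | leibniz (i : Idx q n) (e : ZMod 2) (a : A q n) (ha : a ∈ A.part q n e) :
      Weyl.Rel q n (scomm (par i) e (FreeAlgebra.ι ℂ (.inr i)) (FreeAlgebra.ι ℂ (.inl a)))
        (FreeAlgebra.ι ℂ (.inl (A.der i a)))
  | comm (i j : Idx q n) :
      Weyl.Rel q n (scomm (par i) (par j) (FreeAlgebra.ι ℂ (.inr i)) (FreeAlgebra.ι ℂ (.inr j))) 0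

/-- The Weyl superalgebra `K_{q,n}` of polynomial differential operators in the even variables
`t_i` and the odd variables `ξ_j`. -/
def Weyl (q n : ℕ) : Type := RingQuot (Weyl.Rel q n)

instance (q n : ℕ) : Ring (Weyl q n) := inferInstanceAs (Ring (RingQuot (Weyl.Rel q n)))

instance (q n : ℕ) : Algebra ℂ (Weyl q n) :=
  inferInstanceAs (Algebra ℂ (RingQuot (Weyl.Rel q n)))

/-- The natural homomorphism from `A_{q,n}` to the Weyl superalgebra. -/
def Weyl.ofA (q n : ℕ) : A q n →ₐ[ℂ] Weyl q n :=
  AlgHom.ofLinearMap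
    { toFun := fun a => RingQuot.mkAlgHom ℂ (Weyl.Rel q n) (FreeAlgebra.ι ℂ (.inl a))
      map_add' := fun a b => by
        rw [RingQuot.mkAlgHom_rel ℂ (Weyl.Rel.add a b), map_add]; rfl
      map_smul' := fun c a => by
        rw [RingQuot.mkAlgHom_rel ℂ (Weyl.Rel.smul c a), map_smul]; rfl }
    (by
      change RingQuot.mkAlgHom ℂ (Weyl.Rel q n) _ = _
      rw [RingQuot.mkAlgHom_rel ℂ Weyl.Rel.one, map_one]; rfl)
    (fun a b => by
      change RingQuot.mkAlgHom ℂ (Weyl.Rel q n) _ = _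
      rw [RingQuot.mkAlgHom_rel ℂ (Weyl.Rel.mul a b), map_mul]; rfl)

/-- The generator `∂_i` of the Weyl superalgebra. -/
def Weyl.der {q n : ℕ} (i : Idx q n) : Weyl q n :=
  RingQuot.mkAlgHom ℂ (Weyl.Rel q n) (FreeAlgebra.ι ℂ (.inr i))

/-- A `ℤ/2`-graded module over the Weyl superalgebra `K_{q,n}`. -/
structure WeylModule (q n : ℕ) (P : Type*) [AddCommGroup P] [Module ℂ P] where
  part : ZMod 2 → Submodule ℂ P
  isCompl : IsCompl (part 0) (part 1)
  act : Weyl q n →ₐ[ℂ] Module.End ℂ P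
  ofA_homogeneous : ∀ d, ∀ a ∈ A.part q n d, IsHomogeneous part d (act (Weyl.ofA q n a))
  der_homogeneous : ∀ i, IsHomogeneous part (par i) (act (Weyl.der i))

namespace WeylModule

variable {q n : ℕ} {P : Type*} [AddCommGroup P] [Module ℂ P] (ρ : WeylModule q n P)

/-- Simplicity as a graded `K_{q,n}`-module. -/
def IsSimple : Prop := IsSimpleUnder ρ.part (Set.range ρ.act)

/-- Weight modules: all the `d_i = t_i ∂/∂t_i` and `ξ_j ∂/∂ξ_j` act diagonalizably. -/
def IsWeight : Prop :=
  SuperVF.IsWeight fun i : Idx q n => ρ.act (Weyl.ofA q n (A.gen i) * Weyl.der i)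

/-- The operator `u ↦ (-1)^(d |u|) u`. -/
def twist (d : ZMod 2) : Module.End ℂ P :=
  Submodule.projection _ _ ρ.isCompl + ksign d 1 • Submodule.projection _ _ ρ.isCompl.symm

end WeylModule

/-! ### Modules over `𝔤𝔩_{q,n}` -/

/-- The homogeneous part of parity `d` of `𝔤𝔩_{q,n}`. -/
def glPart (q n : ℕ) (d : ZMod 2) : Set (Matrix (Idx q n) (Idx q n) ℂ) :=
  {X | ∀ i j, par i + par j ≠ d → X i j = 0}

/-- A `ℤ/2`-graded module over the general linear Lie superalgebra `𝔤𝔩_{q,n}`. -/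
structure GLModule (q n : ℕ) (M : Type*) [AddCommGroup M] [Module ℂ M] where
  part : ZMod 2 → Submodule ℂ M
  isCompl : IsCompl (part 0) (part 1)
  act : Matrix (Idx q n) (Idx q n) ℂ →ₗ[ℂ] Module.End ℂ M
  act_homogeneous : ∀ d, ∀ X ∈ glPart q n d, IsHomogeneous part d (act X)
  act_scomm : ∀ d e, ∀ X ∈ glPart q n d, ∀ Y ∈ glPart q n e,
    act (scomm d e X Y) = scomm d e (act X) (act Y)

/-- Simplicity as a graded `𝔤𝔩_{q,n}`-module. -/
def GLModule.IsSimple {q n : ℕ} {M : Type*} [AddCommGroup M] [Module ℂ M]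
    (ρ : GLModule q n M) : Prop :=
  IsSimpleUnder ρ.part (Set.range ρ.act)

/-! ### Levi subalgebras of `𝔤𝔩_p` and their modules -/

/-- `𝔨` is a Levi subalgebra of `𝔤𝔩_p` with Cartan subalgebra `𝔥`: after a change of basis, `𝔨`
consists of the matrices that are block diagonal for some partition of `{1,…,p}`, and `𝔥` of the
diagonal matrices. -/
def IsLevi {p : ℕ} (𝔨 : LieSubalgebra ℂ (Matrix (Fin p) (Fin p) ℂ)) (𝔥 : LieSubalgebra ℂ 𝔨) :
    Prop :=
  ∃ (g : GL (Fin p) ℂ) (r : Setoid (Fin p)),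
    (∀ x : Matrix (Fin p) (Fin p) ℂ,
      x ∈ 𝔨 ↔ ∀ i j, ¬ r i j → (g.val * x * g⁻¹.val) i j = 0) ∧
    (∀ x : 𝔨, x ∈ 𝔥 ↔ ∀ i j, i ≠ j → (g.val * x.val * g⁻¹.val) i j = 0)

section Lie

variable (q n : ℕ) (𝔨 : Type*) [LieRing 𝔨] [LieAlgebra ℂ 𝔨]

/-- A `ℤ/2`-graded module over a (purely even) Lie algebra `𝔨`. -/
structure EvenLieModule (S : Type*) [AddCommGroup S] [Module ℂ S] where
  part : ZMod 2 → Submodule ℂ S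
  isCompl : IsCompl (part 0) (part 1)
  act : 𝔨 →ₗ⁅ℂ⁆ Module.End ℂ S
  act_homogeneous : ∀ x, IsHomogeneous part 0 (act x)

/-! ### Modules over `W ⋉ (𝔨 ⊗ A ⊕ A)` -/

/-- The data of operators by which `W_{q,n} ⋉ (𝔨 ⊗ A_{q,n} ⊕ A_{q,n})` acts on a superspace `V`:
`actW` is the action of the vector fields of each parity, `actK x f` that of `x ⊗ f`, and `actA`
that of `A_{q,n}`. -/
structure AkAction (V : Type*) [AddCommGroup V] [Module ℂ V] where
  part : ZMod 2 → Submodule ℂ V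
  actA : A q n →ₗ[ℂ] Module.End ℂ V
  actW : ∀ d, W q n d →ₗ[ℂ] Module.End ℂ V
  actK : 𝔨 →ₗ[ℂ] A q n →ₗ[ℂ] Module.End ℂ V

variable {q n 𝔨}

/-- Simplicity as a graded `𝔨`-module. -/
def EvenLieModule.IsSimple {S : Type*} [AddCommGroup S] [Module ℂ S]
    (ρ : EvenLieModule 𝔨 S) : Prop :=
  IsSimpleUnder ρ.part (Set.range ρ.act)

/-- Bounded weight modules with respect to a subalgebra `𝔥` of `𝔨`. -/
def EvenLieModule.IsBounded {S : Type*} [AddCommGroup S] [Module ℂ S]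
    (ρ : EvenLieModule 𝔨 S) (𝔥 : LieSubalgebra ℂ 𝔨) : Prop :=
  SuperVF.IsBounded fun h : 𝔥 => ρ.act h

namespace AkAction

variable {V V' : Type*} [AddCommGroup V] [Module ℂ V] [AddCommGroup V'] [Module ℂ V']

/-- The operators form an `A_{q,n} k̂`-module, `k̂ = W_{q,n} ⋉ (𝔨 ⊗ A_{q,n})`: a graded module over
the Lie superalgebra `W_{q,n} ⋉ (𝔨 ⊗ A_{q,n} ⊕ A_{q,n})`, with brackets
`[X, x ⊗ f] = x ⊗ X(f)`, `[x ⊗ f, y ⊗ g] = [x, y] ⊗ f g`, `[X, f] = X(f)`, `[x ⊗ f, g] = 0`,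
`[f, g] = 0`, on which `A_{q,n}` acts associatively. -/
structure IsModule (ρ : AkAction q n 𝔨 V) : Prop where
  isCompl : IsCompl (ρ.part 0) (ρ.part 1)
  actA_homogeneous : ∀ d, ∀ a ∈ A.part q n d, IsHomogeneous ρ.part d (ρ.actA a)
  actW_homogeneous : ∀ d X, IsHomogeneous ρ.part d (ρ.actW d X)
  actK_homogeneous : ∀ x d, ∀ f ∈ A.part q n d, IsHomogeneous ρ.part d (ρ.actK x f)
  actA_one : ρ.actA 1 = 1
  actA_mul : ∀ f g, ρ.actA (f * g) = ρ.actA f * ρ.actA g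
  W_W : ∀ d e (X : W q n d) (Y : W q n e),
    scomm d e (ρ.actW d X) (ρ.actW e Y) =
      ρ.actW (d + e) ⟨scomm d e X.1 Y.1, W.scomm_mem X.2 Y.2⟩
  W_K : ∀ d e (X : W q n d) x, ∀ f ∈ A.part q n e,
    scomm d e (ρ.actW d X) (ρ.actK x f) = ρ.actK x (X.1 f)
  W_A : ∀ d e (X : W q n d), ∀ f ∈ A.part q n e,
    scomm d e (ρ.actW d X) (ρ.actA f) = ρ.actA (X.1 f)
  K_K : ∀ d e x y, ∀ f ∈ A.part q n d, ∀ g ∈ A.part q n e,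
    scomm d e (ρ.actK x f) (ρ.actK y g) = ρ.actK ⁅x, y⁆ (f * g)
  K_A : ∀ d e x, ∀ f ∈ A.part q n d, ∀ g ∈ A.part q n e,
    scomm d e (ρ.actK x f) (ρ.actA g) = 0

/-- Simplicity as a graded `A_{q,n} k̂`-module. -/
def IsSimple (ρ : AkAction q n 𝔨 V) : Prop :=
  IsSimpleUnder ρ.part
    (Set.range ρ.actA ∪ (⋃ d, Set.range (ρ.actW d)) ∪ ⋃ x, Set.range (ρ.actK x))

/-- Bounded weight modules with respect to `ĥ = ⟨d_1,…,d_q⟩ ⊕ 𝔥`, where `h ∈ 𝔥` acts as `h ⊗ 1`. -/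
def IsBounded (ρ : AkAction q n 𝔨 V) (𝔥 : LieSubalgebra ℂ 𝔨) : Prop :=
  SuperVF.IsBounded
    (Sum.elim (fun i : Fin q => ρ.actW 0 (W.euler i)) (fun h : 𝔥 => ρ.actK h 1))

/-- (Parity preserving) isomorphisms. -/
structure Iso (ρ : AkAction q n 𝔨 V) (ρ' : AkAction q n 𝔨 V') where
  toEquiv : V ≃ₗ[ℂ] V'
  map_part : ∀ d, (ρ.part d).map toEquiv.toLinearMap = ρ'.part d
  map_actA : ∀ f v, toEquiv (ρ.actA f v) = ρ'.actA f (toEquiv v)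
  map_actW : ∀ d X v, toEquiv (ρ.actW d X v) = ρ'.actW d X (toEquiv v)
  map_actK : ∀ x f v, toEquiv (ρ.actK x f v) = ρ'.actK x f (toEquiv v)

end AkAction

/-! ### The tensor modules -/

section Tensor

variable {P M S : Type*} [AddCommGroup P] [Module ℂ P] [AddCommGroup M] [Module ℂ M]
  [AddCommGroup S] [Module ℂ S]

/-- The tensor module `𝓕(F(P,M),S)`, with underlying superspace `P ⊗ M ⊗ S`. Writing a vector field
`X` of parity `d` as `X = ∑ᵢ fᵢ ∂ᵢ` with `fᵢ = X(tᵢ)` (where `t_{q+j} = ξ_j`, so that `fᵢ` has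
parity `d + |tᵢ|`), the action on `u ⊗ v ⊗ s` is
* `f · (u ⊗ v ⊗ s) = f u ⊗ v ⊗ s`,
* `(x ⊗ f) · (u ⊗ v ⊗ s) = f u ⊗ v ⊗ x s`,
* `X · (u ⊗ v ⊗ s) = ∑ᵢ fᵢ ∂ᵢ u ⊗ v ⊗ s + ∑_{i,k} (-1)^(|t_k|(|fᵢ| - 1))
  (-1)^((|t_k| + |tᵢ|)|u|) ∂_k(fᵢ) u ⊗ E_{k,i} v ⊗ s`,
the last sign coming from moving `E_{k,i}` past `u`. -/
def tensorModule (p : WeylModule q n P) (m : GLModule q n M) (σ : EvenLieModule 𝔨 S) :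
    AkAction q n 𝔨 ((P ⊗[ℂ] M) ⊗[ℂ] S) where
  part d := Submodule.span ℂ {w | ∃ a b c, a + b + c = d ∧ ∃ u ∈ p.part a, ∃ v ∈ m.part b,
    ∃ s ∈ σ.part c, w = (u ⊗ₜ v) ⊗ₜ s}
  actA := LinearMap.rTensorHom S ∘ₗ LinearMap.rTensorHom M ∘ₗ
    (p.act.comp (Weyl.ofA q n)).toLinearMap
  actW d :=
    { toFun := fun X =>
        ∑ i, TensorProduct.map (TensorProduct.map
          (p.act (Weyl.ofA q n (X.1 (A.gen i)) * Weyl.der i)) 1) 1 +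
        ∑ i, ∑ k, ksign (par k) (d + par i - 1) • TensorProduct.map (TensorProduct.map
          (p.act (Weyl.ofA q n (A.der k (X.1 (A.gen i)))) * p.twist (par k + par i))
          (m.act (Matrix.single k i 1))) 1
      map_add' := fun X Y => by
        simp only [Submodule.coe_add, LinearMap.add_apply, map_add, add_mul,
          TensorProduct.map_add_left, smul_add, Finset.sum_add_distrib]
        abel
      map_smul' := fun c X => by
        simp only [Submodule.coe_smul, LinearMap.smul_apply, map_smul, smul_mul_assoc,
          TensorProduct.map_smul_left, smul_comm _ c, ← Finset.smul_sum, smul_add,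
          RingHom.id_apply] }
  actK := LinearMap.mk₂ ℂ
    (fun x f => TensorProduct.map (TensorProduct.map (p.act (Weyl.ofA q n f)) 1) (σ.act x))
    (fun x y f => by rw [map_add, TensorProduct.map_add_right])
    (fun c x f => by rw [map_smul, TensorProduct.map_smul_right])
    (fun x f g => by simp only [map_add, TensorProduct.map_add_left])
    (fun c x f => by simp only [map_smul, TensorProduct.map_smul_left])

end Tensor

end Lie

end SuperVF

end

noncomputable section

namespace SuperVF

/-! ### Signs -/

/-! The variables and the constant vector fields make `V` a module over the Weyl superalgebra `K`.
What the rest of the action adds to `K` is isolated by difference operators. For an operator-valued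
function `φ` on `A`, namely `φ(f) = x ⊗ f` or `φ(f) = f ∂_i`, put `(δ_j φ)(g) = φ(g t_j) ∓ t_j
φ(g)`. The value at `1` of the difference of `φ` along a word `l` supercommutes with `K` (for `f
∂_i` only if `l` is nonempty), and a Taylor expansion recovers `φ` from these values
(`IsCovariant.isConst`, `forall_apply_mem_of_deltas`). These constant operators play the role of `x
⊗ t^l` and of the vector fields `t^l ∂_i` vanishing at the origin, and they have the corresponding
brackets. So `V` is a module over two supercommuting structures: `K` and a Lie superalgebra of
constant operators.

Splitting off `K`. Boundedness gives a common eigenvector of all `t_a ∂_a`; powers of `t_a` and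
`∂_a` move it to a vacuum vector, which generates a simple weight `K`-module `P` whose only
endomorphisms are scalars. Then `V = P ⊗ N` with `N = Hom_K(P, V)` (`Vac.ev_bijective`), and `N` is
simple over the constant operators together with parity (`Vac.N_simple`).

Finiteness. Let `U` be the sum of the weight spaces of `N` whose weights differ by integral weights
of `W`. Pairing independent weight vectors of `N` with monomials of `P` of complementary weight puts
all products into one weight space of `V`, so `dim U ≤ c` for the bound `c` of `V`
(`Vac.finrank_U_le`). A constant operator that preserves every `U` and has a nonzero eigenvalue
under some `ad F` is therefore nilpotent, with exponent `c` (`IsModule.exists_nilpotency_bound`).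

Vanishing. The operators of `z ⊗ t^l` with `z` in the Cartan subalgebra and `l` nonempty are
nilpotent, hence so are those of the root vectors. The operator of `t_i^2 ∂_i` is nilpotent as well,
which kills all sufficiently long words. Descending induction on the length, with a common kernel
that is a submodule, kills every `x ⊗ t^l` with `l` nonempty (`IsModule.deltas_actK_eq_zero`). A
vector of highest degree for the Euler operator in a space `U` then kills all vector fields of order
at least two (`IsModule.deltas_vf_eq_zero`).

What survives on `N` is the linear vector fields, which form `𝔤𝔩_{q,n}`, together with `𝔨` and
parity. A minimal subspace `M` of some `U` invariant under `𝔤𝔩_{q,n}` and parity gives `N = M ⊗ S`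
with `S = Hom(M, N)` (`exists_tensor_decomposition`), and the first-order Taylor formula is exactly
the action on the tensor module. -/

theorem zmod_two_cases (d : ZMod 2) : d = 0 ∨ d = 1 := by
  revert d; decide

theorem zmod_two_add_self (d : ZMod 2) : d + d = 0 := by
  revert d; decide

@[simp] theorem ksign_zero_left (d : ZMod 2) : ksign 0 d = 1 := by simp [ksign]

@[simp] theorem ksign_zero_right (d : ZMod 2) : ksign d 0 = 1 := by simp [ksign]

@[simp] theorem ksign_one_one : ksign 1 1 = -1 := by
  simp [ksign, show ((1 : ZMod 2).val) = 1 from rfl]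

theorem ksign_add_right (d e f : ZMod 2) : ksign d (e + f) = ksign d e * ksign d f := by
  rw [ksign_comm, ksign_add_left, ksign_comm e, ksign_comm f]

theorem ksign_mul_self (d e : ZMod 2) : ksign d e * ksign d e = 1 := by
  rcases zmod_two_cases d with rfl | rfl <;> rcases zmod_two_cases e with rfl | rfl <;> simp

theorem ksign_ne_zero (d e : ZMod 2) : ksign d e ≠ 0 := by
  rcases zmod_two_cases d with rfl | rfl <;> rcases zmod_two_cases e with rfl | rfl <;> simp

/-! ### The superalgebra `A` -/

section AlgebraA

variable {q n : ℕ}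

/-- The `d`-th power of the parity involution of `A`. -/
def A.sgn (d : ZMod 2) : A q n →ₐ[ℂ] A q n :=
  Algebra.TensorProduct.map (AlgHom.id ℂ _)
    (if d = 0 then AlgHom.id ℂ _ else CliffordAlgebra.involute)

theorem A.sgn_zero (a : A q n) : A.sgn 0 a = a := by
  simp [A.sgn]

theorem A.sgn_one_tmul (f : MvPolynomial (Fin q) ℂ) (w : ExteriorAlgebra ℂ (Fin n → ℂ)) :
    A.sgn 1 (f ⊗ₜ[ℂ] w) = f ⊗ₜ[ℂ] CliffordAlgebra.involute w := by
  simp [A.sgn]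

theorem A.sgn_one_sgn_one (a : A q n) : A.sgn 1 (A.sgn 1 a) = a := by
  induction a using TensorProduct.induction_on with
  | zero => simp
  | add x y hx hy => rw [map_add, map_add, hx, hy]
  | tmul f w => rw [A.sgn_one_tmul, A.sgn_one_tmul, CliffordAlgebra.involute_involute]

theorem A.sgn_sgn (d e : ZMod 2) (a : A q n) : A.sgn d (A.sgn e a) = A.sgn (d + e) a := by
  rcases zmod_two_cases d with rfl | rfl <;> rcases zmod_two_cases e with rfl | rfl <;>
    simp [A.sgn_zero, A.sgn_one_sgn_one, zmod_two_add_self]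

theorem A.sgn_self_sgn_self (d : ZMod 2) (a : A q n) : A.sgn d (A.sgn d a) = a := by
  rw [A.sgn_sgn, zmod_two_add_self, A.sgn_zero]

theorem A.sgn_one_of_mem {e : ZMod 2} {a : A q n} (ha : a ∈ A.part q n e) :
    A.sgn 1 a = ksign 1 e • a := by
  refine (Submodule.map₂_le (r := LinearMap.ker ((A.sgn (q := q) (n := n) 1).toLinearMap -
    ksign 1 e • LinearMap.id))).2 ?_ ha |> fun h => by simpa [sub_eq_zero] using h
  intro f _ w hw
  simp only [TensorProduct.mk_apply, LinearMap.mem_ker, LinearMap.sub_apply,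
    AlgHom.toLinearMap_apply, A.sgn_one_tmul, LinearMap.smul_apply, LinearMap.id_apply, sub_eq_zero]
  rcases zmod_two_cases e with rfl | rfl
  · rw [CliffordAlgebra.involute_eq_of_mem_even hw]; simp
  · rw [CliffordAlgebra.involute_eq_of_mem_odd hw]; simp [TensorProduct.tmul_neg]

theorem A.sgn_of_mem (d : ZMod 2) {e : ZMod 2} {a : A q n} (ha : a ∈ A.part q n e) :
    A.sgn d a = ksign d e • a := by
  rcases zmod_two_cases d with rfl | rfl
  · simp [A.sgn_zero]
  · exact A.sgn_one_of_mem ha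

theorem A.exists_add (a : A q n) : ∃ b ∈ A.part q n 0, ∃ c ∈ A.part q n 1, a = b + c := by
  induction a using TensorProduct.induction_on with
  | zero => exact ⟨0, zero_mem _, 0, zero_mem _, by simp⟩
  | add x y hx hy =>
    obtain ⟨b, hb, c, hc, rfl⟩ := hx
    obtain ⟨b', hb', c', hc', rfl⟩ := hy
    exact ⟨b + b', add_mem hb hb', c + c', add_mem hc hc', by abel⟩
  | tmul f w =>
    have hw : w ∈ CliffordAlgebra.evenOdd (0 : QuadraticForm ℂ (Fin n → ℂ)) 0 ⊔
        CliffordAlgebra.evenOdd (0 : QuadraticForm ℂ (Fin n → ℂ)) 1 := by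
      rw [(CliffordAlgebra.evenOdd_isCompl _).sup_eq_top]; trivial
    obtain ⟨b, hb, c, hc, rfl⟩ := Submodule.mem_sup.1 hw
    exact ⟨f ⊗ₜ b, Submodule.apply_mem_map₂ _ trivial hb, f ⊗ₜ c,
      Submodule.apply_mem_map₂ _ trivial hc, TensorProduct.tmul_add _ _ _⟩

theorem A.neg_one_smul (a : A q n) : (-1 : ℂ) • a = -a := _root_.neg_one_smul ℂ a

theorem A.eq_zero_of_eq_neg {a : A q n} (h : a = -a) : a = 0 := by
  have h2 : (2 : ℂ) • a = 0 := by
    rw [two_smul]; nth_rewrite 2 [h]; exact add_neg_cancel a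
  exact (smul_eq_zero.1 h2).resolve_left two_ne_zero

/-- Parity as an eigenvalue condition: questions about homogeneous parts become identities for the
involution, which can be checked on generators. -/
theorem A.mem_part_iff {e : ZMod 2} {a : A q n} :
    a ∈ A.part q n e ↔ A.sgn 1 a = ksign 1 e • a := by
  refine ⟨A.sgn_one_of_mem, fun h => ?_⟩
  obtain ⟨b, hb, c, hc, rfl⟩ := A.exists_add a
  rw [map_add, A.sgn_one_of_mem hb, A.sgn_one_of_mem hc] at h
  rcases zmod_two_cases e with rfl | rfl
  · have : c = 0 := by
      simp only [ksign_zero_right, one_smul, ksign_one_one, A.neg_one_smul] at h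
      exact A.eq_zero_of_eq_neg (add_left_cancel h).symm
    rw [this, add_zero]; exact hb
  · have : b = 0 := by
      simp only [ksign_zero_right, one_smul, ksign_one_one, A.neg_one_smul, neg_add] at h
      exact A.eq_zero_of_eq_neg (add_right_cancel h)
    rw [this, zero_add]; exact hc

theorem A.induction_homogeneous {p : A q n → Prop}
    (add : ∀ a b, p a → p b → p (a + b)) (mem : ∀ e, ∀ a ∈ A.part q n e, p a) (a : A q n) :
    p a := by
  obtain ⟨b, hb, c, hc, rfl⟩ := A.exists_add a
  exact add _ _ (mem _ _ hb) (mem _ _ hc)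

theorem A.sgn_one_gen (j : Idx q n) :
    A.sgn 1 (A.gen j : A q n) = ksign 1 (par j) • A.gen j := by
  rcases j with i | j
  · simp [A.gen, A.sgn_one_tmul, par]
  · simp only [A.gen, A.sgn_one_tmul, par, ksign_one_one, A.neg_one_smul]
    rw [show ExteriorAlgebra.ι ℂ (Pi.single j (1 : ℂ) : Fin n → ℂ) =
      CliffordAlgebra.ι (0 : QuadraticForm ℂ (Fin n → ℂ)) (Pi.single j 1) from rfl,
      CliffordAlgebra.involute_ι, TensorProduct.tmul_neg]

theorem A.gen_mem (j : Idx q n) : (A.gen j : A q n) ∈ A.part q n (par j) :=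
  A.mem_part_iff.2 (A.sgn_one_gen j)

theorem A.sgn_gen (d : ZMod 2) (j : Idx q n) :
    A.sgn d (A.gen j : A q n) = ksign d (par j) • A.gen j :=
  A.sgn_of_mem d (A.gen_mem j)

theorem A.one_mem : (1 : A q n) ∈ A.part q n 0 :=
  A.mem_part_iff.2 (by simp)

theorem A.mul_mem {d e : ZMod 2} {a b : A q n} (ha : a ∈ A.part q n d) (hb : b ∈ A.part q n e) :
    a * b ∈ A.part q n (d + e) :=
  A.mem_part_iff.2 (by
    rw [map_mul, A.sgn_one_of_mem ha, A.sgn_one_of_mem hb, ksign_add_right, smul_mul_smul_comm])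

theorem A.sgn_mem (d : ZMod 2) {e : ZMod 2} {a : A q n} (ha : a ∈ A.part q n e) :
    A.sgn d a ∈ A.part q n e := by
  rw [A.sgn_of_mem d ha]; exact Submodule.smul_mem _ _ ha

/-- Right multiplication by the variables generates `A` from `1`. -/
theorem A.induction_mul_gen {p : A q n → Prop} (one : p 1)
    (add : ∀ a b, p a → p b → p (a + b)) (smul : ∀ (c : ℂ) a, p a → p (c • a))
    (mul_gen : ∀ a j, p a → p (a * A.gen j)) (a : A q n) : p a := by
  let S : Submodule ℂ (A q n) :=
    { carrier := {a | p a}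
      add_mem' := fun ha hb => add _ _ ha hb
      zero_mem' := by simpa using smul 0 1 one
      smul_mem' := fun c a ha => smul c a ha }
  have key1 : ∀ f : MvPolynomial (Fin q) ℂ, ∀ a ∈ S,
      a * (f ⊗ₜ[ℂ] (1 : ExteriorAlgebra ℂ (Fin n → ℂ))) ∈ S := by
    intro f
    induction f using MvPolynomial.induction_on with
    | C c =>
      intro a ha
      rw [show (MvPolynomial.C c : MvPolynomial (Fin q) ℂ) = c • 1 by
        rw [MvPolynomial.smul_eq_C_mul, mul_one], ← TensorProduct.smul_tmul', mul_smul_comm]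
      exact S.smul_mem _ (by simpa [← Algebra.TensorProduct.one_def] using ha)
    | add f g hf hg =>
      intro a ha
      rw [TensorProduct.add_tmul, mul_add]
      exact S.add_mem (hf a ha) (hg a ha)
    | mul_X f i hf =>
      intro a ha
      have := mul_gen _ (.inl i) (hf a ha)
      rwa [mul_assoc, A.gen, Algebra.TensorProduct.tmul_mul_tmul, one_mul] at this
  have key2 : ∀ w : ExteriorAlgebra ℂ (Fin n → ℂ), ∀ a ∈ S,
      a * ((1 : MvPolynomial (Fin q) ℂ) ⊗ₜ[ℂ] w) ∈ S := by
    intro w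
    induction w using ExteriorAlgebra.induction with
    | algebraMap c =>
      intro a ha
      rw [Algebra.algebraMap_eq_smul_one, TensorProduct.tmul_smul, mul_smul_comm]
      exact S.smul_mem _ (by simpa [← Algebra.TensorProduct.one_def] using ha)
    | ι v =>
      intro a ha
      have hv : v = ∑ j, v j • (Pi.single j 1 : Fin n → ℂ) := by
        ext k; simp [Finset.sum_apply, Pi.single_apply]
      rw [hv, map_sum, TensorProduct.tmul_sum, Finset.mul_sum]
      refine S.sum_mem fun j _ => ?_
      rw [map_smul, TensorProduct.tmul_smul, mul_smul_comm]
      exact S.smul_mem _ (mul_gen _ (.inr j) ha)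
    | mul x y hx hy =>
      intro a ha
      rw [show (1 : MvPolynomial (Fin q) ℂ) ⊗ₜ[ℂ] (x * y) = (1 ⊗ₜ x) * (1 ⊗ₜ y) by
        rw [Algebra.TensorProduct.tmul_mul_tmul, one_mul], ← mul_assoc]
      exact hy _ (hx _ ha)
    | add x y hx hy =>
      intro a ha
      rw [TensorProduct.tmul_add, mul_add]
      exact S.add_mem (hx a ha) (hy a ha)
  induction a using TensorProduct.induction_on with
  | zero => exact S.zero_mem
  | add x y hx hy => exact S.add_mem hx hy
  | tmul f w =>
    have := key2 w _ (key1 f 1 one)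
    rwa [one_mul, Algebra.TensorProduct.tmul_mul_tmul, one_mul, mul_one] at this

theorem A.gen_mul (j : Idx q n) (a : A q n) : A.gen j * a = A.sgn (par j) a * A.gen j := by
  rcases j with i | j
  · rw [show par (Sum.inl i : Idx q n) = 0 from rfl, A.sgn_zero]
    induction a using TensorProduct.induction_on with
    | zero => simp
    | add x y hx hy => rw [mul_add, add_mul, hx, hy]
    | tmul f w => simp [A.gen, Algebra.TensorProduct.tmul_mul_tmul, mul_comm]
  · rw [show par (Sum.inr j : Idx q n) = 1 from rfl]
    have key : ∀ w : CliffordAlgebra (0 : QuadraticForm ℂ (Fin n → ℂ)),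
        CliffordAlgebra.ι _ (Pi.single j (1 : ℂ) : Fin n → ℂ) * w =
          CliffordAlgebra.involute w * CliffordAlgebra.ι _ (Pi.single j 1) := by
      intro w
      induction w using CliffordAlgebra.induction with
      | algebraMap c => rw [AlgHom.commutes, Algebra.commutes]
      | ι v =>
        rw [CliffordAlgebra.involute_ι, neg_mul, eq_neg_iff_add_eq_zero]
        exact ExteriorAlgebra.ι_add_mul_swap _ _
      | mul x y hx hy => rw [map_mul, ← mul_assoc, hx, mul_assoc, hy, mul_assoc]
      | add x y hx hy => rw [mul_add, map_add, add_mul, hx, hy]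
    induction a using TensorProduct.induction_on with
    | zero => simp
    | add x y hx hy => rw [mul_add, map_add, add_mul, hx, hy]
    | tmul f w =>
      rw [A.sgn_one_tmul, A.gen, Algebra.TensorProduct.tmul_mul_tmul,
        Algebra.TensorProduct.tmul_mul_tmul, one_mul, mul_one]
      exact congrArg _ (key w)

/-- The sign depends on the parity of `b`, so it is first replaced by the involution applied to `b`.
The resulting identity makes sense for inhomogeneous `b` and can be proved by appending variables to
`b` one at a time. -/
theorem A.mul_comm_of_mem {d e : ZMod 2} {a b : A q n} (ha : a ∈ A.part q n d)
    (hb : b ∈ A.part q n e) : a * b = ksign d e • (b * a) := by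
  have key : ∀ b : A q n, a * A.sgn d b = b * a := by
    intro b
    induction b using A.induction_mul_gen with
    | one => simp
    | add x y hx hy => rw [map_add, mul_add, hx, hy, add_mul]
    | smul c x hx => rw [map_smul, mul_smul_comm, hx, smul_mul_assoc]
    | mul_gen x j hx =>
      rw [map_mul, A.sgn_gen, ← mul_assoc, hx, mul_smul_comm, mul_assoc, mul_assoc, A.gen_mul,
        A.sgn_of_mem _ ha, smul_mul_assoc, mul_smul_comm, ksign_comm]
  rw [← key b, A.sgn_of_mem _ hb, mul_smul_comm, smul_smul, ksign_mul_self, one_smul]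

/-- The sign is carried by the involution, so that no homogeneity is needed. For an odd variable
this is the antiderivation property of contraction, obtained by induction from the left on the
Clifford algebra of the zero form. -/
theorem A.der_mul (i : Idx q n) (a b : A q n) :
    A.der i (a * b) = A.der i a * b + A.sgn (par i) a * A.der i b := by
  rcases i with i | j
  · rw [show par (Sum.inl i : Idx q n) = 0 from rfl, A.sgn_zero]
    induction a using TensorProduct.induction_on with
    | zero => simp
    | add x y hx hy => simp only [add_mul, map_add, hx, hy]; abel
    | tmul p w =>
      induction b using TensorProduct.induction_on with
      | zero => simp
      | add x y hx hy => simp only [mul_add, map_add, hx, hy]; abel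
      | tmul p' w' =>
        simp [A.der, Algebra.TensorProduct.tmul_mul_tmul, TensorProduct.add_tmul, mul_comm,
          add_comm]
  · rw [show par (Sum.inr j : Idx q n) = 1 from rfl]
    have key : ∀ (d : Module.Dual ℂ (Fin n → ℂ))
        (w w' : CliffordAlgebra (0 : QuadraticForm ℂ (Fin n → ℂ))),
        CliffordAlgebra.contractLeft d (w * w') = CliffordAlgebra.contractLeft d w * w' +
          CliffordAlgebra.involute w * CliffordAlgebra.contractLeft d w' := by
      intro d w
      induction w using CliffordAlgebra.left_induction with
      | algebraMap c =>
        intro w'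
        rw [CliffordAlgebra.contractLeft_algebraMap_mul, CliffordAlgebra.contractLeft_algebraMap,
          AlgHom.commutes, zero_mul, zero_add]
      | add x y hx hy =>
        intro w'
        rw [add_mul, map_add, hx, hy, map_add, map_add, add_mul, add_mul]; abel
      | ι_mul x v hx =>
        intro w'
        rw [mul_assoc, CliffordAlgebra.contractLeft_ι_mul, hx, CliffordAlgebra.contractLeft_ι_mul,
          map_mul, CliffordAlgebra.involute_ι, mul_add, sub_mul, smul_mul_assoc, neg_mul, neg_mul,
          mul_assoc, mul_assoc]
        abel
    induction a using TensorProduct.induction_on with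
    | zero => simp
    | add x y hx hy => simp only [add_mul, map_add, hx, hy]; abel
    | tmul p w =>
      induction b using TensorProduct.induction_on with
      | zero => simp
      | add x y hx hy => simp only [mul_add, map_add, hx, hy]; abel
      | tmul p' w' =>
        rw [A.sgn_one_tmul, Algebra.TensorProduct.tmul_mul_tmul]
        simp only [A.der, LinearMap.lTensor_tmul, Algebra.TensorProduct.tmul_mul_tmul]
        rw [← TensorProduct.tmul_add]
        exact congrArg _ (key _ _ _)

@[simp] theorem A.der_one (i : Idx q n) : A.der i (1 : A q n) = 0 := by
  have h := A.der_mul i (1 : A q n) 1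
  simpa using h

theorem A.der_gen (i j : Idx q n) : A.der i (A.gen j : A q n) = if i = j then 1 else 0 := by
  rcases i with i | i <;> rcases j with j | j
  · rcases eq_or_ne i j with rfl | h
    · simp [A.der, A.gen, Algebra.TensorProduct.one_def]
    · simp [A.der, A.gen, h, MvPolynomial.pderiv_X, h.symm]
  · simp [A.der, A.gen]
  · simp only [A.der, A.gen, LinearMap.lTensor_tmul, reduceCtorEq, if_false]
    rw [show (1 : ExteriorAlgebra ℂ (Fin n → ℂ)) =
      (1 : CliffordAlgebra (0 : QuadraticForm ℂ (Fin n → ℂ))) from rfl,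
      CliffordAlgebra.contractLeft_one, TensorProduct.tmul_zero]
  · simp only [A.der, A.gen, LinearMap.lTensor_tmul]
    rw [show ExteriorAlgebra.ι ℂ (Pi.single j (1 : ℂ) : Fin n → ℂ) =
      CliffordAlgebra.ι (0 : QuadraticForm ℂ (Fin n → ℂ)) (Pi.single j 1) from rfl,
      CliffordAlgebra.contractLeft_ι]
    rcases eq_or_ne i j with rfl | h
    · simp [Algebra.TensorProduct.one_def]
    · simp [h]

theorem A.der_mul_gen (i j : Idx q n) (a : A q n) :
    A.der i (a * A.gen j) = A.der i a * A.gen j + if i = j then A.sgn (par i) a else 0 := by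
  rw [A.der_mul, A.der_gen]; split_ifs <;> simp

theorem A.sgn_der (d : ZMod 2) (i : Idx q n) (a : A q n) :
    A.sgn d (A.der i a) = ksign d (par i) • A.der i (A.sgn d a) := by
  induction a using A.induction_mul_gen with
  | one => simp
  | add x y hx hy => simp only [map_add, hx, hy, smul_add]
  | smul c x hx => simp only [map_smul, hx, smul_comm c]
  | mul_gen x j hx =>
    rw [A.der_mul_gen, map_add, map_mul, hx, map_mul, A.sgn_gen, mul_smul_comm, mul_smul_comm,
      map_smul,
      A.der_mul_gen, smul_mul_assoc, smul_add, smul_add, smul_comm (ksign d (par i))]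
    congr 1
    split_ifs with h
    · subst h; rw [smul_smul, ksign_mul_self, one_smul, A.sgn_sgn, A.sgn_sgn, add_comm]
    · simp

theorem A.der_mem (i : Idx q n) {e : ZMod 2} {a : A q n} (ha : a ∈ A.part q n e) :
    A.der i a ∈ A.part q n (par i + e) :=
  A.mem_part_iff.2 (by
    rw [A.sgn_der, A.sgn_one_of_mem ha, map_smul, smul_smul, ksign_add_right])

end AlgebraA


/-! ### Parity operators of a superspace. -/

section SignOperator

variable {V : Type*} [AddCommGroup V] [Module ℂ V] {part : ZMod 2 → Submodule ℂ V}

/-- The operator `v ↦ (-1)^(d |v|) v` of a superspace. -/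
def signOp (hc : IsCompl (part 0) (part 1)) (d : ZMod 2) : Module.End ℂ V :=
  Submodule.projection _ _ hc + ksign d 1 • Submodule.projection _ _ hc.symm

theorem signOp_of_mem (hc : IsCompl (part 0) (part 1)) (d : ZMod 2) {e : ZMod 2} {v : V}
    (hv : v ∈ part e) : signOp hc d v = ksign d e • v := by
  rcases zmod_two_cases e with rfl | rfl
  · rw [signOp, LinearMap.add_apply, LinearMap.smul_apply,
      Submodule.projection_apply_of_mem_left hc hv,
      Submodule.projection_apply_of_mem_right hc.symm hv]
    simp
  · rw [signOp, LinearMap.add_apply, LinearMap.smul_apply,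
      Submodule.projection_apply_of_mem_right hc hv,
      Submodule.projection_apply_of_mem_left hc.symm hv]
    simp

theorem exists_add_of_isCompl (hc : IsCompl (part 0) (part 1)) (v : V) :
    ∃ b ∈ part 0, ∃ c ∈ part 1, v = b + c := by
  have hv : v ∈ part 0 ⊔ part 1 := by rw [hc.sup_eq_top]; trivial
  obtain ⟨b, hb, c, hc, rfl⟩ := Submodule.mem_sup.1 hv
  exact ⟨b, hb, c, hc, rfl⟩

theorem end_ext_of_isCompl {V' : Type*} [AddCommGroup V'] [Module ℂ V']
    (hc : IsCompl (part 0) (part 1)) {S T : V →ₗ[ℂ] V'}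
    (h : ∀ e, ∀ v ∈ part e, S v = T v) : S = T := by
  ext v
  obtain ⟨b, hb, c, hc, rfl⟩ := exists_add_of_isCompl hc v
  rw [map_add, map_add, h _ _ hb, h _ _ hc]

theorem signOp_zero (hc : IsCompl (part 0) (part 1)) : signOp hc 0 = 1 :=
  end_ext_of_isCompl hc fun e v hv => by rw [signOp_of_mem hc _ hv]; simp

theorem signOp_mul_signOp (hc : IsCompl (part 0) (part 1)) (d e : ZMod 2) :
    signOp hc d * signOp hc e = signOp hc (d + e) :=
  end_ext_of_isCompl hc fun f v hv => by
    rw [Module.End.mul_apply, signOp_of_mem hc _ hv, map_smul, signOp_of_mem hc _ hv,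
      signOp_of_mem hc _ hv, smul_smul, ksign_add_left, mul_comm]

theorem signOp_mul_of_isHomogeneous (hc : IsCompl (part 0) (part 1)) (e : ZMod 2) {d : ZMod 2}
    {T : Module.End ℂ V} (hT : IsHomogeneous part d T) :
    signOp hc e * T = ksign e d • (T * signOp hc e) :=
  end_ext_of_isCompl hc fun f v hv => by
    rw [Module.End.mul_apply, signOp_of_mem hc _ (hT f v hv), LinearMap.smul_apply,
      Module.End.mul_apply, signOp_of_mem hc _ hv, map_smul, smul_smul, ksign_add_right]

theorem mem_part_iff_signOp (hc : IsCompl (part 0) (part 1)) {e : ZMod 2} {v : V} :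
    v ∈ part e ↔ signOp hc 1 v = ksign 1 e • v := by
  refine ⟨signOp_of_mem hc 1, fun h => ?_⟩
  have key : ∀ w : V, w = -w → w = 0 := fun w hw => by
    have h2 : (2 : ℂ) • w = 0 := by
      rw [two_smul]; nth_rewrite 2 [hw]; exact add_neg_cancel w
    exact (smul_eq_zero.1 h2).resolve_left two_ne_zero
  obtain ⟨b, hb, c, hc', rfl⟩ := exists_add_of_isCompl hc v
  rw [map_add, signOp_of_mem hc _ hb, signOp_of_mem hc _ hc'] at h
  rcases zmod_two_cases e with rfl | rfl
  · simp only [ksign_zero_right, one_smul, ksign_one_one, neg_smul] at h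
    rw [key c (add_left_cancel h).symm, add_zero]; exact hb
  · simp only [ksign_zero_right, one_smul, ksign_one_one, neg_smul, neg_add] at h
    rw [key b (add_right_cancel h), zero_add]; exact hc'

theorem isHomogeneous_of_signOp (hc : IsCompl (part 0) (part 1)) {d : ZMod 2}
    {T : Module.End ℂ V} (hT : signOp hc 1 * T = ksign 1 d • (T * signOp hc 1)) :
    IsHomogeneous part d T := by
  intro e v hv
  rw [mem_part_iff_signOp hc, ← Module.End.mul_apply, hT, LinearMap.smul_apply,
    Module.End.mul_apply, signOp_of_mem hc _ hv, map_smul, smul_smul, ksign_add_right]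

/-- This allows gradings to be forgotten: a graded submodule is a subspace invariant under one
further operator, the parity operator. -/
theorem isGraded_iff_signOp (hc : IsCompl (part 0) (part 1)) {N : Submodule ℂ V} :
    IsGraded part N ↔ ∀ v ∈ N, signOp hc 1 v ∈ N := by
  constructor
  · intro h v hv
    obtain ⟨b, hb, c, hc', rfl⟩ := Submodule.mem_sup.1 (h hv)
    rw [map_add, signOp_of_mem hc _ hb.2, signOp_of_mem hc _ hc'.2]
    exact N.add_mem (N.smul_mem _ hb.1) (N.smul_mem _ hc'.1)
  · intro h v hv
    obtain ⟨b, hb, c, hc', rfl⟩ := exists_add_of_isCompl hc v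
    have h1 := h _ hv
    rw [map_add, signOp_of_mem hc _ hb, signOp_of_mem hc _ hc', ksign_zero_right, ksign_one_one,
      one_smul, neg_smul, one_smul] at h1
    have hbN : b ∈ N := by
      have h2 : (2⁻¹ : ℂ) • ((b + c) + (b + -c)) ∈ N := N.smul_mem _ (N.add_mem hv h1)
      have h3 : (2⁻¹ : ℂ) • ((b + c) + (b + -c)) = b := by module
      rwa [h3] at h2
    have hcN : c ∈ N := by simpa using N.sub_mem hv hbN
    exact add_mem (Submodule.mem_sup_left ⟨hbN, hb⟩) (Submodule.mem_sup_right ⟨hcN, hc'⟩)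

end SignOperator

/-! ### Vector fields -/

section VectorFields

variable {q n : ℕ}

/-- The projection of `A` to its part of parity `d`. -/
def A.pr (d : ZMod 2) : A q n →ₗ[ℂ] A q n :=
  (2⁻¹ : ℂ) • (LinearMap.id + ksign d 1 • (A.sgn 1).toLinearMap)

theorem A.pr_of_mem {d : ZMod 2} {a : A q n} (ha : a ∈ A.part q n d) : A.pr d a = a := by
  simp only [A.pr, LinearMap.smul_apply, LinearMap.add_apply, LinearMap.id_apply,
    AlgHom.toLinearMap_apply, A.sgn_one_of_mem ha, smul_smul, ksign_comm d, ksign_mul_self,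
    one_smul]
  module

theorem A.pr_of_mem_add_one {d : ZMod 2} {a : A q n} (ha : a ∈ A.part q n (d + 1)) :
    A.pr d a = 0 := by
  simp only [A.pr, LinearMap.smul_apply, LinearMap.add_apply, LinearMap.id_apply,
    AlgHom.toLinearMap_apply, A.sgn_one_of_mem ha, smul_smul, ksign_add_right, ksign_comm d]
  rw [← mul_assoc, ksign_mul_self, ksign_one_one]
  module

theorem A.pr_mem (d : ZMod 2) (a : A q n) : A.pr d a ∈ A.part q n d := by
  rw [A.mem_part_iff]
  simp only [A.pr, LinearMap.smul_apply, LinearMap.add_apply, LinearMap.id_apply,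
    AlgHom.toLinearMap_apply, map_smul, map_add, A.sgn_one_sgn_one, ksign_comm d]
  rw [smul_comm (ksign 1 d), smul_add (ksign 1 d), smul_smul (ksign 1 d), ksign_mul_self, one_smul,
    add_comm (A.sgn 1 a)]

theorem W.apply_mul {d : ZMod 2} {X : Module.End ℂ (A q n)} (hX : X ∈ W q n d) (a b : A q n) :
    X (a * b) = X a * b + A.sgn d a * X b := by
  induction a using A.induction_homogeneous with
  | add x y hx hy => rw [add_mul, map_add, hx, hy, map_add, map_add, add_mul, add_mul]; abel
  | mem e a ha => rw [(hX e a ha).2, A.sgn_of_mem _ ha, smul_mul_assoc]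

theorem W.apply_one {d : ZMod 2} {X : Module.End ℂ (A q n)} (hX : X ∈ W q n d) : X 1 = 0 := by
  simpa using W.apply_mul hX 1 1

theorem W.ext_gen {d : ZMod 2} {X Y : Module.End ℂ (A q n)} (hX : X ∈ W q n d)
    (hY : Y ∈ W q n d) (h : ∀ j, X (A.gen j) = Y (A.gen j)) : X = Y := by
  refine LinearMap.ext fun a => ?_
  induction a using A.induction_mul_gen with
  | one => rw [W.apply_one hX, W.apply_one hY]
  | add x y hx hy => rw [map_add, map_add, hx, hy]
  | smul c x hx => rw [map_smul, map_smul, hx]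
  | mul_gen x j hx => rw [W.apply_mul hX, W.apply_mul hY, hx, h]

theorem W.mulLeft_mul_der_mem {d : ZMod 2} {f : A q n} (i : Idx q n)
    (hf : f ∈ A.part q n (d + par i)) : LinearMap.mulLeft ℂ f * A.der i ∈ W q n d := by
  intro e a ha
  have h2 : d + par i + (par i + e) = d + e := by
    rw [add_assoc, ← add_assoc (par i), zmod_two_add_self, zero_add]
  refine ⟨?_, fun b => ?_⟩
  · have := A.mul_mem hf (A.der_mem i ha)
    rwa [h2] at this
  · simp only [Module.End.mul_apply, LinearMap.mulLeft_apply, A.der_mul, A.sgn_of_mem _ ha,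
      mul_add, smul_mul_assoc, mul_smul_comm]
    rw [← mul_assoc, ← mul_assoc, A.mul_comm_of_mem hf ha, smul_mul_assoc, smul_smul, mul_assoc,
      mul_assoc, ksign_add_left, ksign_comm (par i), mul_comm, mul_assoc, ksign_comm _ e,
      ksign_mul_self, mul_one, ksign_comm e]

/-- The component of parity `d` of the vector field `f ∂_i`. -/
def W.vf (i : Idx q n) (d : ZMod 2) : A q n →ₗ[ℂ] W q n d where
  toFun f := ⟨LinearMap.mulLeft ℂ (A.pr (d + par i) f) * A.der i,
    W.mulLeft_mul_der_mem i (A.pr_mem _ _)⟩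
  map_add' f g := Subtype.ext (LinearMap.ext fun a => by simp [add_mul])
  map_smul' c f := Subtype.ext (LinearMap.ext fun a => by
    simp only [map_smul]; exact smul_mul_assoc c (A.pr (d + par i) f) (A.der i a))

theorem W.coe_vf (i : Idx q n) {d : ZMod 2} {f : A q n} (hf : f ∈ A.part q n (d + par i)) :
    (W.vf i d f : Module.End ℂ (A q n)) = LinearMap.mulLeft ℂ f * A.der i := by
  simp [W.vf, A.pr_of_mem hf]

theorem W.vf_eq_zero (i : Idx q n) {d : ZMod 2} {f : A q n}
    (hf : f ∈ A.part q n (d + par i + 1)) : W.vf i d f = 0 := by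
  exact Subtype.ext (by simp [W.vf, A.pr_of_mem_add_one hf, LinearMap.mulLeft_zero_eq_zero])

theorem W.apply_gen_mem {d : ZMod 2} {X : Module.End ℂ (A q n)} (hX : X ∈ W q n d)
    (i : Idx q n) : X (A.gen i) ∈ A.part q n (d + par i) :=
  (hX _ _ (A.gen_mem i)).1

theorem W.eq_sum_vf {d : ZMod 2} (X : W q n d) :
    X = ∑ i, W.vf i d (X.1 (A.gen i)) := by
  refine Subtype.ext (W.ext_gen X.2 (Subtype.prop _) fun j => ?_)
  rw [Submodule.coe_sum, LinearMap.sum_apply]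
  simp only [W.coe_vf _ (W.apply_gen_mem X.2 _), Module.End.mul_apply, LinearMap.mulLeft_apply,
    A.der_gen, mul_ite, mul_one, mul_zero, Finset.sum_ite_eq', Finset.mem_univ, if_true]

end VectorFields

/-! ### The operators attached to a module -/

section Action

variable {q n : ℕ} {𝔨 : Type*} [LieRing 𝔨] [LieAlgebra ℂ 𝔨] {V : Type*} [AddCommGroup V]
  [Module ℂ V]

namespace AkAction

/-- The action of the vector fields `f ∂_i`. -/
def vf (ρ : AkAction q n 𝔨 V) (i : Idx q n) : A q n →ₗ[ℂ] Module.End ℂ V :=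
  ρ.actW 0 ∘ₗ W.vf i 0 + ρ.actW 1 ∘ₗ W.vf i 1

/-- The action of the variable `t_i`. -/
def t (ρ : AkAction q n 𝔨 V) (i : Idx q n) : Module.End ℂ V := ρ.actA (A.gen i)

/-- The action of the vector field `∂_i`. -/
def D (ρ : AkAction q n 𝔨 V) (i : Idx q n) : Module.End ℂ V := ρ.vf i 1

/-- `ρ.vf` adds up both parities in order to be linear in all of `A`; on homogeneous coefficients
only the summand of the right parity survives. -/
theorem vf_of_mem (ρ : AkAction q n 𝔨 V) (i : Idx q n) {d : ZMod 2} {f : A q n}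
    (hf : f ∈ A.part q n (d + par i)) : ρ.vf i f = ρ.actW d (W.vf i d f) := by
  have h2 : ∀ d : ZMod 2, d + 1 + 1 = d := by decide
  rcases zmod_two_cases d with rfl | rfl
  · rw [vf, LinearMap.add_apply, LinearMap.comp_apply, LinearMap.comp_apply,
      W.vf_eq_zero i (d := 1),
      map_zero, add_zero]
    rw [zero_add] at hf
    rwa [add_comm 1, h2]
  · rw [vf, LinearMap.add_apply, LinearMap.comp_apply, LinearMap.comp_apply,
      W.vf_eq_zero i (d := 0),
      map_zero, zero_add]
    rwa [zero_add, add_comm]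

theorem actW_eq_sum_vf (ρ : AkAction q n 𝔨 V) {d : ZMod 2} (X : W q n d) :
    ρ.actW d X = ∑ i, ρ.vf i (X.1 (A.gen i)) := by
  conv_lhs => rw [W.eq_sum_vf X]
  rw [map_sum]
  exact Finset.sum_congr rfl fun i _ => (ρ.vf_of_mem i (W.apply_gen_mem X.2 i)).symm

namespace IsModule

variable {ρ : AkAction q n 𝔨 V} (h : ρ.IsModule)

/-- The parity operators of the module. -/
abbrev s (h : ρ.IsModule) (d : ZMod 2) : Module.End ℂ V := signOp h.isCompl d

include h

theorem vf_homogeneous (i : Idx q n) {d : ZMod 2} {f : A q n} (hf : f ∈ A.part q n d) :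
    IsHomogeneous ρ.part (d + par i) (ρ.vf i f) := by
  have h2 : d + par i + par i = d := by rw [add_assoc, zmod_two_add_self, add_zero]
  rw [ρ.vf_of_mem i (d := d + par i) (by rwa [h2])]
  exact h.actW_homogeneous _ _

theorem vf_mul_actA (i : Idx q n) {d e : ZMod 2} {f g : A q n} (hf : f ∈ A.part q n d)
    (hg : g ∈ A.part q n e) : ρ.vf i f * ρ.actA g =
      ρ.actA (f * A.der i g) + ksign (d + par i) e • (ρ.actA g * ρ.vf i f) := by
  have h2 : d + par i + par i = d := by rw [add_assoc, zmod_two_add_self, add_zero]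
  have h3 := h.W_A (d + par i) e (W.vf i _ f) g hg
  rw [← ρ.vf_of_mem i (by rwa [h2]), W.coe_vf _ (by rwa [h2]), scomm, sub_eq_iff_eq_add] at h3
  exact h3

theorem vf_mul_actK (i : Idx q n) (x : 𝔨) {d e : ZMod 2} {f g : A q n} (hf : f ∈ A.part q n d)
    (hg : g ∈ A.part q n e) : ρ.vf i f * ρ.actK x g =
      ρ.actK x (f * A.der i g) + ksign (d + par i) e • (ρ.actK x g * ρ.vf i f) := by
  have h2 : d + par i + par i = d := by rw [add_assoc, zmod_two_add_self, add_zero]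
  have h3 := h.W_K (d + par i) e (W.vf i _ f) x g hg
  rw [← ρ.vf_of_mem i (by rwa [h2]), W.coe_vf _ (by rwa [h2]), scomm, sub_eq_iff_eq_add] at h3
  exact h3

theorem actK_mul_actK (x y : 𝔨) {d e : ZMod 2} {f g : A q n} (hf : f ∈ A.part q n d)
    (hg : g ∈ A.part q n e) : ρ.actK x f * ρ.actK y g =
      ρ.actK ⁅x, y⁆ (f * g) + ksign d e • (ρ.actK y g * ρ.actK x f) := by
  rw [← h.K_K d e x y f hf g hg, scomm, sub_add_cancel]

theorem actK_mul_actA (x : 𝔨) {d e : ZMod 2} {f g : A q n} (hf : f ∈ A.part q n d)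
    (hg : g ∈ A.part q n e) : ρ.actK x f * ρ.actA g = ksign d e • (ρ.actA g * ρ.actK x f) := by
  rw [← sub_eq_zero]; exact h.K_A d e x f hf g hg

theorem vf_mul_vf (i j : Idx q n) {d e : ZMod 2} {f g : A q n} (hf : f ∈ A.part q n d)
    (hg : g ∈ A.part q n e) : ρ.vf i f * ρ.vf j g =
      ρ.vf j (f * A.der i g) - ksign (d + par i) (e + par j) • ρ.vf i (g * A.der j f) +
        ksign (d + par i) (e + par j) • (ρ.vf j g * ρ.vf i f) := by
  have h2 : ∀ d e : ZMod 2, d + e + e = d := by decide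
  have hf' : f ∈ A.part q n (d + par i + par i) := by rwa [h2]
  have hg' : g ∈ A.part q n (e + par j + par j) := by rwa [h2]
  have h3 := h.W_W (d + par i) (e + par j) (W.vf i _ f) (W.vf j _ g)
  rw [← ρ.vf_of_mem i hf', ← ρ.vf_of_mem j hg', scomm, sub_eq_iff_eq_add] at h3
  rw [h3]
  congr 1
  have hfg : f * A.der i g ∈ A.part q n (d + par i + (e + par j) + par j) := by
    have h4 := A.mul_mem hf (A.der_mem i hg)
    rwa [show d + (par i + e) = d + par i + (e + par j) + par j by
      rw [← add_assoc, ← add_assoc, h2]] at h4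
  have hgf : g * A.der j f ∈ A.part q n (d + par i + (e + par j) + par i) := by
    have h4 := A.mul_mem hg (A.der_mem j hf)
    rwa [show e + (par j + d) = d + par i + (e + par j) + par i by
      rw [show d + par i + (e + par j) + par i = d + (e + par j) + par i + par i by abel, h2]
      abel] at h4
  rw [ρ.vf_of_mem j hfg, ρ.vf_of_mem i hgf, sub_eq_add_neg, ← neg_smul, ← map_smul, ← map_add]
  congr 1
  -- Superderivations are determined by their values on the variables, so the bracket formula is
  -- compared there.
  refine Subtype.ext (W.ext_gen (Subtype.prop _) (Subtype.prop _) fun k => ?_)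
  simp only [W.coe_vf _ hf', W.coe_vf _ hg', scomm, Submodule.coe_add, Submodule.coe_smul,
    W.coe_vf _ hfg, W.coe_vf _ hgf, LinearMap.neg_apply, LinearMap.add_apply, LinearMap.smul_apply,
    Module.End.mul_apply, LinearMap.mulLeft_apply, A.der_gen, sub_eq_add_neg, neg_smul]
  congr 1
  · split_ifs <;> simp
  · split_ifs <;> simp

theorem s_mul_actA (d : ZMod 2) (a : A q n) :
    h.s d * ρ.actA a = ρ.actA (A.sgn d a) * h.s d := by
  induction a using A.induction_homogeneous with
  | add x y hx hy => rw [map_add, map_add, mul_add, hx, hy, map_add, add_mul]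
  | mem e a ha =>
    rw [signOp_mul_of_isHomogeneous _ _ (h.actA_homogeneous e a ha), A.sgn_of_mem _ ha, map_smul,
      smul_mul_assoc]

theorem D_mul_actA (k : Idx q n) (a : A q n) :
    ρ.D k * ρ.actA a = ρ.actA (A.der k a) + ρ.actA (A.sgn (par k) a) * ρ.D k := by
  induction a using A.induction_homogeneous with
  | add x y hx hy =>
    rw [map_add, mul_add, hx, hy, map_add, map_add, map_add, map_add, add_mul]
    abel
  | mem e a ha =>
    rw [D, h.vf_mul_actA k A.one_mem ha, A.sgn_of_mem _ ha, map_smul, smul_mul_assoc, one_mul,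
      zero_add]

theorem s_mul_D (d : ZMod 2) (k : Idx q n) :
    h.s d * ρ.D k = ksign d (par k) • (ρ.D k * h.s d) := by
  have := signOp_mul_of_isHomogeneous h.isCompl d (h.vf_homogeneous k A.one_mem)
  rwa [zero_add] at this

theorem D_mul_D (j k : Idx q n) : ρ.D j * ρ.D k = ksign (par j) (par k) • (ρ.D k * ρ.D j) := by
  have := h.vf_mul_vf j k A.one_mem A.one_mem
  simpa [D] using this

theorem s_mul_t (d : ZMod 2) (k : Idx q n) :
    h.s d * ρ.t k = ksign d (par k) • (ρ.t k * h.s d) := by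
  rw [t, h.s_mul_actA, A.sgn_gen, map_smul, smul_mul_assoc]

theorem t_mul_t (j k : Idx q n) : ρ.t j * ρ.t k = ksign (par j) (par k) • (ρ.t k * ρ.t j) := by
  rw [t, t, ← h.actA_mul, A.mul_comm_of_mem (A.gen_mem j) (A.gen_mem k), map_smul, h.actA_mul]

theorem D_mul_t (j k : Idx q n) : ρ.D j * ρ.t k =
    (if j = k then 1 else 0) + ksign (par j) (par k) • (ρ.t k * ρ.D j) := by
  rw [t, h.D_mul_actA, A.der_gen, A.sgn_gen, map_smul, smul_mul_assoc]
  split_ifs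
  · rw [h.actA_one]
  · rw [map_zero]

omit h in
/-- The compatibility of an operator valued function of parity `d` on `A` with the variables, the
derivatives and the grading. -/
structure IsCovariant (h : ρ.IsModule) (φ : A q n →ₗ[ℂ] Module.End ℂ V) (d : ZMod 2) : Prop where
  D_mul : ∀ k g, ρ.D k * φ g =
    φ (A.der k g) + ksign (par k) d • (φ (A.sgn (par k) g) * ρ.D k)
  mul_t : ∀ k g, φ g * ρ.t k = ksign (par k) d • (ρ.t k * φ (A.sgn (par k) g))
  s_mul : ∀ e g, h.s e * φ g = ksign e d • (φ (A.sgn e g) * h.s e)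

theorem isCovariant_actK (x : 𝔨) : h.IsCovariant (ρ.actK x) 0 where
  D_mul k g := by
    induction g using A.induction_homogeneous with
    | add x y hx hy => simp only [map_add, mul_add, hx, hy, add_mul, smul_add]; abel
    | mem e a ha =>
      rw [D, h.vf_mul_actK k x A.one_mem ha, A.sgn_of_mem _ ha, map_smul, smul_mul_assoc, one_mul,
        zero_add, ksign_zero_right, one_smul]
  mul_t k g := by
    induction g using A.induction_homogeneous with
    | add x y hx hy => simp only [map_add, mul_add, hx, hy, add_mul, smul_add]
    | mem e a ha =>
      rw [t, h.actK_mul_actA x ha (A.gen_mem k), A.sgn_of_mem _ ha, map_smul, mul_smul_comm,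
        ksign_zero_right, one_smul, ksign_comm]
  s_mul e g := by
    induction g using A.induction_homogeneous with
    | add x y hx hy => simp only [map_add, mul_add, hx, hy, add_mul, smul_add]
    | mem d a ha =>
      rw [signOp_mul_of_isHomogeneous _ _ (h.actK_homogeneous x d a ha), A.sgn_of_mem _ ha,
        map_smul, smul_mul_assoc, ksign_zero_right, one_smul]

theorem D_mul_vf (i k : Idx q n) (g : A q n) : ρ.D k * ρ.vf i g =
    ρ.vf i (A.der k g) + ksign (par k) (par i) • (ρ.vf i (A.sgn (par k) g) * ρ.D k) := by
  induction g using A.induction_homogeneous with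
  | add x y hx hy => simp only [map_add, mul_add, hx, hy, add_mul, smul_add]; abel
  | mem e a ha =>
    rw [D, h.vf_mul_vf k i A.one_mem ha, A.sgn_of_mem _ ha, map_smul, smul_mul_assoc, one_mul,
      zero_add, A.der_one, mul_zero, map_zero, smul_zero, sub_zero, ksign_add_right, smul_smul,
      mul_comm]

theorem vf_mul_t (i k : Idx q n) (g : A q n) : ρ.vf i g * ρ.t k =
    (if i = k then ρ.actA g else 0) +
      ksign (par k) (par i) • (ρ.t k * ρ.vf i (A.sgn (par k) g)) := by
  induction g using A.induction_homogeneous with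
  | add x y hx hy =>
    simp only [map_add, mul_add, hx, hy, add_mul, smul_add]; split_ifs <;> abel
  | mem e a ha =>
    rw [t, h.vf_mul_actA i ha (A.gen_mem k), A.sgn_of_mem _ ha, map_smul, mul_smul_comm,
      A.der_gen, smul_smul, ksign_add_left, ksign_comm e, ksign_comm (par i), mul_comm]
    split_ifs <;> simp

theorem s_mul_vf (i : Idx q n) (e : ZMod 2) (g : A q n) : h.s e * ρ.vf i g =
    ksign e (par i) • (ρ.vf i (A.sgn e g) * h.s e) := by
  induction g using A.induction_homogeneous with
  | add x y hx hy => simp only [map_add, mul_add, hx, hy, add_mul, smul_add]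
  | mem d a ha =>
    rw [signOp_mul_of_isHomogeneous _ _ (h.vf_homogeneous i ha), A.sgn_of_mem _ ha,
      map_smul, smul_mul_assoc, ksign_add_right, smul_smul, mul_comm]

end IsModule

end AkAction

end Action


/-! ### The difference operators -/

section Difference

variable {q n : ℕ} {𝔨 : Type*} [LieRing 𝔨] [LieAlgebra ℂ 𝔨] {V : Type*} [AddCommGroup V]
  [Module ℂ V]

/-- The parity of a word in the variables. -/
def listPar (l : List (Idx q n)) : ZMod 2 := (l.map par).sum

@[simp] theorem listPar_nil : listPar ([] : List (Idx q n)) = 0 := rfl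

@[simp] theorem listPar_cons (j : Idx q n) (l : List (Idx q n)) :
    listPar (j :: l) = par j + listPar l := by simp [listPar]

/-- The number of occurrences of a variable in a word. -/
def cnt (k : Idx q n) (l : List (Idx q n)) : ℕ := (l.map fun j => if k = j then 1 else 0).sum

@[simp] theorem cnt_nil (k : Idx q n) : cnt k [] = 0 := rfl

theorem cnt_cons (k j : Idx q n) (l : List (Idx q n)) :
    cnt k (j :: l) = cnt k l + if k = j then 1 else 0 := by simp [cnt, add_comm]

/-- The right derivative `∂_i^R` of `A`. -/
def A.derR (i : Idx q n) : Module.End ℂ (A q n) := (A.sgn (par i)).toLinearMap ∘ₗ A.der i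

theorem A.derR_apply (i : Idx q n) (a : A q n) : A.derR i a = A.sgn (par i) (A.der i a) := rfl

@[simp] theorem A.derR_one (i : Idx q n) : A.derR i (1 : A q n) = 0 := by
  rw [A.derR_apply, A.der_one, map_zero]

theorem A.derR_mul_gen (i j : Idx q n) (a : A q n) : A.derR i (a * A.gen j) =
    ksign (par i) (par j) • (A.derR i a * A.gen j) + if i = j then a else 0 := by
  rw [A.derR_apply, A.der_mul_gen, map_add, map_mul, A.sgn_gen, mul_smul_comm, A.derR_apply]
  split_ifs
  · rw [A.sgn_self_sgn_self]
  · rw [map_zero]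

theorem A.sgn_derR (d : ZMod 2) (i : Idx q n) (a : A q n) :
    A.sgn d (A.derR i a) = ksign d (par i) • A.derR i (A.sgn d a) := by
  rw [A.derR_apply, A.sgn_sgn, add_comm, ← A.sgn_sgn, A.sgn_der, map_smul, A.derR_apply]

theorem A.gen_mul_sgn (j : Idx q n) (a : A q n) : A.gen j * A.sgn (par j) a = a * A.gen j := by
  rw [A.gen_mul, A.sgn_self_sgn_self]

namespace AkAction

variable (ρ : AkAction q n 𝔨 V)

/-- The difference operator `φ ↦ (g ↦ φ(g t_j) - (-1)^(|t_j| |g|) t_j φ(g))`. -/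
def delta (j : Idx q n) : Module.End ℂ (A q n →ₗ[ℂ] Module.End ℂ V) where
  toFun φ := φ ∘ₗ LinearMap.mulRight ℂ (A.gen j) -
    LinearMap.mulLeft ℂ (ρ.t j) ∘ₗ φ ∘ₗ (A.sgn (par j)).toLinearMap
  map_add' φ ψ := by
    refine LinearMap.ext fun a => ?_
    simp only [LinearMap.sub_apply, LinearMap.comp_apply, LinearMap.add_apply,
      LinearMap.mulLeft_apply, mul_add]
    abel
  map_smul' c φ := by
    refine LinearMap.ext fun a => ?_
    simp only [LinearMap.sub_apply, LinearMap.comp_apply, LinearMap.smul_apply,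
      LinearMap.mulLeft_apply, mul_smul_comm, RingHom.id_apply, smul_sub]

theorem delta_apply (j : Idx q n) (φ : A q n →ₗ[ℂ] Module.End ℂ V) (g : A q n) :
    ρ.delta j φ g = φ (g * A.gen j) - ρ.t j * φ (A.sgn (par j) g) := rfl

/-- The composition of the difference operators along a word. -/
def deltas (l : List (Idx q n)) : Module.End ℂ (A q n →ₗ[ℂ] Module.End ℂ V) :=
  (l.map ρ.delta).prod

@[simp] theorem deltas_nil (φ : A q n →ₗ[ℂ] Module.End ℂ V) : ρ.deltas [] φ = φ := rfl

@[simp] theorem deltas_cons (j : Idx q n) (l : List (Idx q n))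
    (φ : A q n →ₗ[ℂ] Module.End ℂ V) : ρ.deltas (j :: l) φ = ρ.delta j (ρ.deltas l φ) := by
  simp [deltas]

theorem deltas_append (l l' : List (Idx q n)) (φ : A q n →ₗ[ℂ] Module.End ℂ V) :
    ρ.deltas (l ++ l') φ = ρ.deltas l (ρ.deltas l' φ) := by
  simp [deltas]

theorem apply_mul_gen (j : Idx q n) (φ : A q n →ₗ[ℂ] Module.End ℂ V) (g : A q n) :
    φ (g * A.gen j) = ρ.delta j φ g + ρ.t j * φ (A.sgn (par j) g) := by
  rw [delta_apply, sub_add_cancel]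

/-- The right derivative is used because differences append a variable on the right: the Leibniz
rule then either lets the derivative pass or consumes the appended variable. -/
theorem delta_comp_derR (i j : Idx q n) (φ : A q n →ₗ[ℂ] Module.End ℂ V) :
    ρ.delta j (φ ∘ₗ A.derR i) =
      ksign (par i) (par j) • (ρ.delta j φ ∘ₗ A.derR i) + if i = j then φ else 0 := by
  refine LinearMap.ext fun g => ?_
  rw [LinearMap.add_apply, LinearMap.smul_apply, LinearMap.comp_apply, delta_apply, delta_apply,
    LinearMap.comp_apply, LinearMap.comp_apply, A.derR_mul_gen, map_add, map_smul, A.sgn_derR,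
    map_smul, mul_smul_comm, smul_sub, smul_smul, ksign_comm (par j), ksign_mul_self, one_smul]
  split_ifs
  · abel
  · simp

/-- A derivative can consume at most one letter of the word, and every term in which it consumes one
has order lower by one. -/
theorem deltas_comp_derR (i : Idx q n) (l : List (Idx q n)) (φ : A q n →ₗ[ℂ] Module.End ℂ V) :
    ∃ c : ℂ, ∃ ψ ∈ Submodule.span ℂ {ψ | ∃ l' : List (Idx q n), l'.length + 1 = l.length ∧
      ψ = ρ.deltas l' φ}, ρ.deltas l (φ ∘ₗ A.derR i) = c • (ρ.deltas l φ ∘ₗ A.derR i) + ψ := by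
  induction l with
  | nil => exact ⟨1, 0, zero_mem _, by simp⟩
  | cons j l ih =>
    obtain ⟨c, ψ, hψ, h⟩ := ih
    refine ⟨c * ksign (par i) (par j), c • (if i = j then ρ.deltas l φ else 0) + ρ.delta j ψ,
      ?_, ?_⟩
    · refine add_mem (Submodule.smul_mem _ _ ?_) ?_
      · split_ifs
        · exact Submodule.subset_span ⟨l, rfl, rfl⟩
        · exact zero_mem _
      · refine (Submodule.span_le (p := (Submodule.span ℂ _).comap (ρ.delta j))).2 ?_ hψ
        rintro _ ⟨l', hl', rfl⟩
        exact Submodule.subset_span ⟨j :: l', by simp [hl'], by simp⟩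
    · rw [deltas_cons, h, map_add, map_smul, delta_comp_derR, smul_add, smul_smul, deltas_cons,
        add_assoc]

theorem deltas_comp_derR_one_mem (i : Idx q n) (l : List (Idx q n))
    (φ : A q n →ₗ[ℂ] Module.End ℂ V) :
    ρ.deltas l (φ ∘ₗ A.derR i) 1 ∈ Submodule.span ℂ {T | ∃ l' : List (Idx q n),
      l'.length + 1 = l.length ∧ T = ρ.deltas l' φ 1} := by
  obtain ⟨c, ψ, hψ, h⟩ := ρ.deltas_comp_derR i l φ
  rw [h, LinearMap.add_apply, LinearMap.smul_apply, LinearMap.comp_apply, A.derR_one, map_zero,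
    smul_zero, zero_add]
  refine (Submodule.span_le (p := (Submodule.span ℂ _).comap (LinearMap.applyₗ 1))).2 ?_ hψ
  rintro _ ⟨l', hl', rfl⟩
  exact Submodule.subset_span ⟨l', hl', rfl⟩

/-- Taylor expansion: `φ(g t_j)` is a difference at `g` plus `t_j` times a value at `g`, so by
induction on `g` every value of `φ` is built from the variables and the differences at `1`. The
induction has to run over all words and all sign twists simultaneously. -/
theorem forall_apply_mem_of_deltas {N N' : Submodule ℂ V} (ht : ∀ j, ∀ v ∈ N', ρ.t j v ∈ N')
    {φ : A q n →ₗ[ℂ] Module.End ℂ V} (hφ : ∀ l, ∀ v ∈ N, ρ.deltas l φ 1 v ∈ N') (g : A q n) :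
    ∀ v ∈ N, φ g v ∈ N' := by
  have key : ∀ g : A q n, ∀ l e, ∀ v ∈ N, ρ.deltas l φ (A.sgn e g) v ∈ N' := by
    intro g
    induction g using A.induction_mul_gen with
    | one => intro l e v hv; rw [map_one]; exact hφ l v hv
    | add x y hx hy =>
      intro l e v hv
      rw [map_add, map_add, LinearMap.add_apply]; exact add_mem (hx l e v hv) (hy l e v hv)
    | smul c x hx =>
      intro l e v hv
      rw [map_smul, map_smul, LinearMap.smul_apply]; exact N'.smul_mem _ (hx l e v hv)
    | mul_gen x j hx =>
      intro l e v hv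
      rw [map_mul, A.sgn_gen, mul_smul_comm, map_smul, LinearMap.smul_apply, ρ.apply_mul_gen,
        LinearMap.add_apply, ← deltas_cons, A.sgn_sgn, Module.End.mul_apply]
      exact N'.smul_mem _ (add_mem (hx _ _ v hv) (ht j _ (hx _ _ v hv)))
  intro v hv
  simpa [A.sgn_zero] using key g [] 0 v hv

theorem eq_zero_of_deltas {φ : A q n →ₗ[ℂ] Module.End ℂ V} (hφ : ∀ l, ρ.deltas l φ 1 = 0) :
    φ = 0 := by
  refine LinearMap.ext fun g => LinearMap.ext fun v => ?_
  have := ρ.forall_apply_mem_of_deltas (N := ⊤) (N' := ⊥) (φ := φ) (fun j v hv => by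
    rw [Submodule.mem_bot] at hv; rw [hv, map_zero]; exact zero_mem _)
    (fun l v _ => by rw [hφ l]; exact zero_mem _) g v trivial
  simpa using this

namespace IsModule

variable {ρ} (h : ρ.IsModule)

include h

/-- Differences supercommute because the variables do; hence only the multiset of letters of a word
matters, up to a scalar, and repeated odd letters give zero. -/
theorem delta_delta (i j : Idx q n) (φ : A q n →ₗ[ℂ] Module.End ℂ V) :
    ρ.delta i (ρ.delta j φ) = ksign (par i) (par j) • ρ.delta j (ρ.delta i φ) := by
  refine LinearMap.ext fun g => ?_
  simp only [LinearMap.smul_apply, delta_apply, map_mul, A.sgn_gen, mul_smul_comm, map_smul,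
    mul_sub, smul_sub, smul_smul, ksign_comm (par j) (par i), ksign_mul_self, one_smul]
  rw [mul_assoc, A.mul_comm_of_mem (A.gen_mem i) (A.gen_mem j), mul_smul_comm, map_smul,
    ← mul_assoc, ← mul_assoc, h.t_mul_t i j, ← mul_assoc, smul_mul_assoc, A.sgn_sgn, A.sgn_sgn,
    add_comm (par j)]
  abel

theorem delta_actA_mul (j : Idx q n) (T : Module.End ℂ V) :
    ρ.delta j (LinearMap.mulRight ℂ T ∘ₗ ρ.actA) = 0 := by
  refine LinearMap.ext fun g => ?_
  rw [delta_apply, LinearMap.comp_apply, LinearMap.comp_apply, LinearMap.mulRight_apply,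
    LinearMap.mulRight_apply, ← mul_assoc, t, ← h.actA_mul, A.gen_mul_sgn, sub_self]
  rfl

/-- Taylor expansion of order zero: vanishing first differences mean linearity over `A`. Applied to
`x ⊗ f`, it shows that `𝔨 ⊗ A` acts through `𝔨`. -/
theorem eq_actA_mul_of_delta {φ : A q n →ₗ[ℂ] Module.End ℂ V} (hφ : ∀ j, ρ.delta j φ = 0)
    (g : A q n) : φ g = ρ.actA g * φ 1 := by
  have key : ∀ e, φ (A.sgn e g) = ρ.actA (A.sgn e g) * φ 1 := by
    induction g using A.induction_mul_gen with
    | one => intro e; rw [map_one, h.actA_one, one_mul]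
    | add x y hx hy => intro e; rw [map_add, map_add, hx, hy, map_add, add_mul]
    | smul c x hx => intro e; rw [map_smul, map_smul, hx, map_smul, smul_mul_assoc]
    | mul_gen x j hx =>
      intro e
      rw [map_mul, A.sgn_gen, mul_smul_comm, map_smul, map_smul, ρ.apply_mul_gen, hφ, A.sgn_sgn, hx,
        ← mul_assoc, t, ← h.actA_mul, ← A.sgn_sgn, A.gen_mul_sgn, LinearMap.zero_apply, zero_add,
        smul_mul_assoc]
  simpa [A.sgn_zero] using key 0

/-- Taylor expansion of order one. It is the formula of the tensor module, with the first
differences at `1` in the place of the matrix units and the signs hidden in the right derivative. -/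
theorem vf_eq_of_delta_delta {i : Idx q n} (hφ : ∀ j k, ρ.delta k (ρ.delta j (ρ.vf i)) = 0)
    (g : A q n) : ρ.vf i g =
      ρ.actA g * ρ.D i + ∑ k, ρ.actA (A.derR k g) * ρ.delta k (ρ.vf i) 1 := by
  have key : ∀ e, ρ.vf i (A.sgn e g) = ρ.actA (A.sgn e g) * ρ.D i +
      ∑ k, ρ.actA (A.derR k (A.sgn e g)) * ρ.delta k (ρ.vf i) 1 := by
    induction g using A.induction_mul_gen with
    | one => intro e; simp [h.actA_one, D]
    | add x y hx hy =>
      intro e; simp only [map_add, hx, hy, add_mul, Finset.sum_add_distrib]; abel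
    | smul c x hx =>
      intro e; simp only [map_smul, hx, smul_add, smul_mul_assoc, Finset.smul_sum]
    | mul_gen x j hx =>
      intro e
      have h1 : ∀ k, A.gen j * A.derR k (A.sgn (par j) (A.sgn e x)) =
          ksign (par k) (par j) • (A.derR k (A.sgn e x) * A.gen j) := by
        intro k
        rw [← A.gen_mul_sgn j (A.derR k _), A.sgn_derR, mul_smul_comm, smul_smul,
          ksign_comm (par j), ksign_mul_self, one_smul]
      have h2 : ∀ k, ρ.t j * (ρ.actA (A.derR k (A.sgn (par j) (A.sgn e x))) *
          ρ.delta k (ρ.vf i) 1) =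
          ksign (par k) (par j) • (ρ.actA (A.derR k (A.sgn e x) * A.gen j) *
            ρ.delta k (ρ.vf i) 1) := by
        intro k
        rw [← mul_assoc, t, ← h.actA_mul, h1, map_smul, smul_mul_assoc]
      rw [map_mul, A.sgn_gen, mul_smul_comm, map_smul, map_smul, ρ.apply_mul_gen,
        h.eq_actA_mul_of_delta (hφ j), A.sgn_sgn, hx, ← A.sgn_sgn, mul_add, ← mul_assoc, t,
        ← h.actA_mul, A.gen_mul_sgn, Finset.mul_sum]
      rw [show ρ.actA (A.gen j) = ρ.t j from rfl]
      simp only [h2, map_smul, A.derR_mul_gen, map_add, add_mul, smul_mul_assoc,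
        Finset.sum_add_distrib, apply_ite ρ.actA, map_zero, ite_mul, zero_mul, Finset.sum_ite_eq',
        Finset.mem_univ, if_true, ← Finset.smul_sum, ← smul_add]
      congr 1
      abel
  simpa [A.sgn_zero] using key 0

omit h in
/-- Operators of parity `d` that supercommute with the Weyl superalgebra. -/
structure IsConst (h : ρ.IsModule) (T : Module.End ℂ V) (d : ZMod 2) : Prop where
  mul_D : ∀ k, T * ρ.D k = ksign (par k) d • (ρ.D k * T)
  mul_t : ∀ k, T * ρ.t k = ksign (par k) d • (ρ.t k * T)
  s_mul : ∀ e, h.s e * T = ksign e d • (T * h.s e)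

namespace IsCovariant

variable {h} {φ : A q n →ₗ[ℂ] Module.End ℂ V} {d : ZMod 2}

/-- Derivatives kill `1`, so at `1` the covariance relations reduce to supercommutation with the
variables and the derivatives. -/
theorem isConst (hφ : h.IsCovariant φ d) : h.IsConst (φ 1) d where
  mul_D k := by
    rw [hφ.D_mul, A.der_one, map_zero, map_one (A.sgn _), zero_add, smul_smul, ksign_mul_self,
      one_smul]
  mul_t k := by rw [hφ.mul_t, map_one (A.sgn _)]
  s_mul e := by rw [hφ.s_mul, map_one (A.sgn _)]

theorem delta (hφ : h.IsCovariant φ d) (j : Idx q n) :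
    h.IsCovariant (ρ.delta j φ) (d + par j) where
  D_mul k g := by
    simp only [delta_apply]
    rw [mul_sub, hφ.D_mul, A.der_mul_gen, map_mul, A.sgn_gen, mul_smul_comm, map_smul, ← mul_assoc,
      h.D_mul_t, add_mul]
    simp only [smul_mul_assoc]
    rw [mul_assoc (ρ.t j), hφ.D_mul, map_add, A.sgn_der, map_smul,
      mul_add, A.sgn_sgn, A.sgn_sgn, ksign_add_right, sub_mul]
    simp only [mul_smul_comm, smul_add, smul_sub, smul_smul, ← mul_assoc,
      ksign_comm (par j) (par k), mul_comm (ksign (par k) (par j)), add_comm (par j) (par k)]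
    -- For equal indices, `∂_k t_k = 1` produces one extra term from `φ(g t_k)` and one from `t_k
    -- φ(g)`; they cancel.
    split_ifs with hkj
    · subst hkj; rw [one_mul]; abel
    · simp only [map_zero, zero_mul]; abel
  mul_t k g := by
    simp only [delta_apply]
    rw [sub_mul, hφ.mul_t, map_mul, A.sgn_gen, mul_smul_comm, map_smul, mul_assoc, hφ.mul_t,
      mul_sub, A.sgn_sgn, A.sgn_sgn, ← mul_assoc (ρ.t k), h.t_mul_t k j, ksign_add_right,
      add_comm (par j)]
    simp only [mul_smul_comm, smul_mul_assoc, smul_sub, smul_smul, ← mul_assoc]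
    rw [mul_assoc (ksign _ d), ksign_mul_self, mul_one]
  s_mul e g := by
    simp only [delta_apply]
    rw [mul_sub, hφ.s_mul, map_mul, A.sgn_gen, mul_smul_comm, map_smul, ← mul_assoc, h.s_mul_t]
    simp only [smul_mul_assoc]
    rw [mul_assoc (ρ.t j), hφ.s_mul, sub_mul, A.sgn_sgn, A.sgn_sgn, ksign_add_right,
      add_comm (par j)]
    simp only [mul_smul_comm, smul_sub, smul_smul, ← mul_assoc]
    rw [mul_comm (ksign e d)]

theorem deltas (hφ : h.IsCovariant φ d) (l : List (Idx q n)) :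
    h.IsCovariant (ρ.deltas l φ) (d + listPar l) := by
  induction l with
  | nil => simpa using hφ
  | cons j l ih =>
    rw [deltas_cons, listPar_cons, add_comm (par j), ← add_assoc]
    exact ih.delta j

end IsCovariant

/-- The function `f ↦ f ∂_i` itself is not covariant, since its bracket with `t_i` is multiplication
by `f`. That defect is linear over `A`, so a single difference removes it; this is why words for
vector fields must be nonempty. -/
theorem isCovariant_delta_vf (i j : Idx q n) :
    h.IsCovariant (ρ.delta j (ρ.vf i)) (par i + par j) where
  D_mul k g := by
    simp only [delta_apply]
    rw [mul_sub, h.D_mul_vf, A.der_mul_gen, map_mul, A.sgn_gen, mul_smul_comm, map_smul,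
      ← mul_assoc, h.D_mul_t, add_mul]
    simp only [smul_mul_assoc]
    rw [mul_assoc (ρ.t j), h.D_mul_vf, map_add, A.sgn_der,
      map_smul, mul_add, A.sgn_sgn, A.sgn_sgn, ksign_add_right, sub_mul]
    simp only [mul_smul_comm, smul_add, smul_sub, smul_smul, ← mul_assoc,
      ksign_comm (par j) (par k), mul_comm (ksign (par k) (par j)), add_comm (par j) (par k)]
    split_ifs with hkj
    · subst hkj; rw [one_mul]; abel
    · simp only [map_zero, zero_mul]; abel
  mul_t k g := by
    simp only [delta_apply]
    rw [sub_mul, h.vf_mul_t, map_mul (A.sgn _), A.sgn_gen, mul_smul_comm, map_smul, mul_assoc,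
      h.vf_mul_t,
      mul_sub, A.sgn_sgn, A.sgn_sgn, mul_add, ← mul_assoc (ρ.t k), h.t_mul_t k j, ksign_add_right,
      add_comm (par j), mul_ite, mul_zero, show ρ.t j * ρ.actA (A.sgn (par j) g) =
        ρ.actA (g * A.gen j) by rw [t, ← h.actA_mul, A.gen_mul_sgn]]
    simp only [mul_smul_comm, smul_mul_assoc, smul_sub, smul_smul, ← mul_assoc]
    rw [mul_assoc (ksign _ (par i)), ksign_mul_self, mul_one]
    abel
  s_mul e g := by
    simp only [delta_apply]
    rw [mul_sub, h.s_mul_vf, map_mul, A.sgn_gen, mul_smul_comm, map_smul, ← mul_assoc, h.s_mul_t]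
    simp only [smul_mul_assoc]
    rw [mul_assoc (ρ.t j), h.s_mul_vf, sub_mul, A.sgn_sgn, A.sgn_sgn, ksign_add_right,
      add_comm (par j)]
    simp only [mul_smul_comm, smul_sub, smul_smul, ← mul_assoc]
    rw [mul_comm (ksign e (par i))]

theorem isConst_deltas_actK (x : 𝔨) (l : List (Idx q n)) :
    h.IsConst (ρ.deltas l (ρ.actK x) 1) (listPar l) := by
  simpa using ((h.isCovariant_actK x).deltas l).isConst

theorem isCovariant_deltas_vf (i : Idx q n) {l : List (Idx q n)} (hl : l ≠ []) :
    h.IsCovariant (ρ.deltas l (ρ.vf i)) (par i + listPar l) := by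
  rcases List.eq_nil_or_concat l with rfl | ⟨l', j, rfl⟩
  · exact absurd rfl hl
  · have := (h.isCovariant_delta_vf i j).deltas l'
    rw [List.concat_eq_append, deltas_append]
    simpa [listPar, add_assoc, add_comm, add_left_comm] using this

theorem isConst_deltas_vf (i : Idx q n) {l : List (Idx q n)} (hl : l ≠ []) :
    h.IsConst (ρ.deltas l (ρ.vf i) 1) (par i + listPar l) :=
  (h.isCovariant_deltas_vf i hl).isConst

end IsModule

/-! ### Brackets of difference operators -/

/-- The supercommutators of `ψ` and `χ`, of parities `d` and `e`, are
`[ψ(g), χ(h)] = ω(g θ(h))`. -/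
def HasBracket (ψ : A q n →ₗ[ℂ] Module.End ℂ V) (d : ZMod 2) (χ : A q n →ₗ[ℂ] Module.End ℂ V)
    (e : ZMod 2) (ω : A q n →ₗ[ℂ] Module.End ℂ V) (θ : Module.End ℂ (A q n)) : Prop :=
  ∀ a b, ∀ g ∈ A.part q n a, ∀ f ∈ A.part q n b,
    ψ g * χ f = ω (g * θ f) + ksign (d + a) (e + b) • (χ f * ψ g)

/-- The supercommutators of an operator `T` of parity `d` with `χ` of parity `e` are
`[T, χ(g)] = (-1)^(d |g|) ω(g)`. -/
def HasAd (T : Module.End ℂ V) (d : ZMod 2) (χ : A q n →ₗ[ℂ] Module.End ℂ V) (e : ZMod 2)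
    (ω : A q n →ₗ[ℂ] Module.End ℂ V) : Prop :=
  ∀ g, T * χ g = ω (A.sgn d g) + ksign d e • (χ (A.sgn d g) * T)

namespace IsModule

variable {ρ} {h : ρ.IsModule} {ψ χ ω : A q n →ₗ[ℂ] Module.End ℂ V} {d e : ZMod 2}

/-- Differencing the first argument only requires moving `t_j` past a value of `χ`, which is part of
the covariance of `χ`. The sign that arises is absorbed into `θ`. -/
theorem _root_.SuperVF.AkAction.HasBracket.delta {θ : Module.End ℂ (A q n)}
    (hb : HasBracket ψ d χ e ω θ) (hχ : h.IsCovariant χ e) (j : Idx q n) :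
    HasBracket (ρ.delta j ψ) (d + par j) χ e (ρ.delta j ω)
      ((A.sgn (par j)).toLinearMap ∘ₗ θ) := by
  intro a b g hg f hf
  have h1 := hb _ b _ (A.mul_mem hg (A.gen_mem j)) f hf
  have h2 := hb a b _ (A.sgn_mem (par j) hg) f hf
  have h3 := hχ.mul_t j f
  rw [A.sgn_of_mem _ hf, map_smul, mul_smul_comm, smul_smul, ← ksign_add_right] at h3
  have h4 : ρ.t j * χ f = ksign (par j) (e + b) • (χ f * ρ.t j) := by
    rw [h3, smul_smul, ksign_mul_self, one_smul]
  simp only [delta_apply]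
  rw [sub_mul, h1, mul_assoc (ρ.t j), h2, mul_add, mul_smul_comm, ← mul_assoc (ρ.t j), h4,
    LinearMap.comp_apply,
    AlgHom.toLinearMap_apply, mul_assoc g, A.gen_mul, map_mul (A.sgn _), A.sgn_self_sgn_self,
    ← mul_assoc g,
    smul_mul_assoc, mul_sub, smul_sub, smul_smul, ← mul_assoc (χ f)]
  rw [show d + (a + par j) = d + par j + a by ring, ← ksign_add_left,
    show d + a + par j = d + par j + a by ring]
  simp only [mul_assoc]
  abel

theorem _root_.SuperVF.AkAction.HasBracket.deltas {θ : Module.End ℂ (A q n)}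
    (hb : HasBracket ψ d χ e ω θ) (hχ : h.IsCovariant χ e) (l : List (Idx q n)) :
    HasBracket (ρ.deltas l ψ) (d + listPar l) χ e (ρ.deltas l ω)
      ((A.sgn (listPar l)).toLinearMap ∘ₗ θ) := by
  induction l with
  | nil =>
    rw [show (A.sgn (listPar ([] : List (Idx q n)))).toLinearMap ∘ₗ θ = θ from
      LinearMap.ext fun a => A.sgn_zero _]
    simpa using hb
  | cons j l ih =>
    rw [deltas_cons, deltas_cons, listPar_cons, add_comm (par j), ← add_assoc,
      show (A.sgn (listPar l + par j)).toLinearMap ∘ₗ θ =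
        (A.sgn (par j)).toLinearMap ∘ₗ (A.sgn (listPar l)).toLinearMap ∘ₗ θ from
        LinearMap.ext fun a => by simp [A.sgn_sgn, add_comm]]
    exact ih.delta hχ j

theorem _root_.SuperVF.AkAction.HasBracket.hasAd {θ : Module.End ℂ (A q n)}
    (hb : HasBracket ψ d χ e ω θ) :
    HasAd (ψ 1) d χ e (ω ∘ₗ θ ∘ₗ (A.sgn d).toLinearMap) := by
  intro g
  induction g using A.induction_homogeneous with
  | add x y hx hy => simp only [map_add, mul_add, hx, hy, add_mul, smul_add]; abel
  | mem b f hf =>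
    rw [hb 0 b 1 A.one_mem f hf, one_mul, add_zero, ksign_add_right, LinearMap.comp_apply,
      LinearMap.comp_apply, AlgHom.toLinearMap_apply, A.sgn_self_sgn_self, A.sgn_of_mem _ hf,
      map_smul, smul_mul_assoc, smul_smul]

/-- Once the first argument is a constant operator it supercommutes with `t_j`, so its bracket
passes through differences of the second argument. -/
theorem _root_.SuperVF.AkAction.HasAd.delta {T : Module.End ℂ V} (ha : HasAd T d χ e ω)
    (hT : h.IsConst T d) (j : Idx q n) :
    HasAd T d (ρ.delta j χ) (e + par j) (ksign d (par j) • ρ.delta j ω) := by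
  intro g
  rw [LinearMap.smul_apply]
  simp only [delta_apply]
  rw [mul_sub, ha, ← mul_assoc, hT.mul_t, smul_mul_assoc, mul_assoc, ha, map_mul, A.sgn_gen,
    mul_smul_comm, map_smul, map_smul, ksign_comm (par j), mul_add, mul_smul_comm, sub_mul,
    A.sgn_sgn, A.sgn_sgn, ksign_add_right, add_comm (par j)]
  simp only [smul_mul_assoc, smul_add, smul_sub, smul_smul, mul_assoc,
    mul_comm (ksign d (par j))]
  abel

theorem _root_.SuperVF.AkAction.HasAd.deltas {T : Module.End ℂ V} (ha : HasAd T d χ e ω)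
    (hT : h.IsConst T d) (l : List (Idx q n)) :
    HasAd T d (ρ.deltas l χ) (e + listPar l) (ksign d (listPar l) • ρ.deltas l ω) := by
  induction l with
  | nil => simpa using ha
  | cons j l ih =>
    have := ih.delta hT j
    rw [map_smul, smul_smul, ← ksign_add_right, add_assoc, add_comm _ (par j)] at this
    rwa [deltas_cons, deltas_cons, listPar_cons]

theorem _root_.SuperVF.AkAction.HasAd.apply_one {T : Module.End ℂ V} (ha : HasAd T d χ e ω) :
    T * χ 1 = ω 1 + ksign d e • (χ 1 * T) := by
  have := ha 1
  rwa [map_one (A.sgn _)] at this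

variable (h)

include h

theorem hasBracket_actK (x y : 𝔨) :
    HasBracket (ρ.actK x) 0 (ρ.actK y) 0 (ρ.actK ⁅x, y⁆) LinearMap.id := by
  intro a b g hg f hf
  rw [h.actK_mul_actK x y hg hf, zero_add, zero_add, LinearMap.id_apply]

theorem hasBracket_vf_actK (i : Idx q n) (y : 𝔨) :
    HasBracket (ρ.vf i) (par i) (ρ.actK y) 0 (ρ.actK y) (A.der i) := by
  intro a b g hg f hf
  rw [h.vf_mul_actK i y hg hf, zero_add, add_comm a]

theorem hasAd_deltas_actK (x y : 𝔨) (l : List (Idx q n)) :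
    HasAd (ρ.deltas l (ρ.actK x) 1) (listPar l) (ρ.actK y) 0 (ρ.deltas l (ρ.actK ⁅x, y⁆)) := by
  have := ((h.hasBracket_actK x y).deltas (h.isCovariant_actK y) l).hasAd
  rw [zero_add] at this
  rwa [show (ρ.deltas l (ρ.actK ⁅x, y⁆)) ∘ₗ ((A.sgn (listPar l)).toLinearMap ∘ₗ LinearMap.id) ∘ₗ
    (A.sgn (listPar l)).toLinearMap = ρ.deltas l (ρ.actK ⁅x, y⁆) from LinearMap.ext fun a => by
      simp [A.sgn_self_sgn_self]] at this

/-- The relation `[x ⊗ t^l, y ⊗ t^l'] = ± [x, y] ⊗ t^(l' l)` of the current algebra: orders add. -/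
theorem deltas_actK_mul_deltas_actK (x y : 𝔨) (l l' : List (Idx q n)) :
    ρ.deltas l (ρ.actK x) 1 * ρ.deltas l' (ρ.actK y) 1 =
      ksign (listPar l) (listPar l') • ρ.deltas l' (ρ.deltas l (ρ.actK ⁅x, y⁆)) 1 +
      ksign (listPar l) (listPar l') • (ρ.deltas l' (ρ.actK y) 1 * ρ.deltas l (ρ.actK x) 1) := by
  have := ((h.hasAd_deltas_actK x y l).deltas (h.isConst_deltas_actK x l) l').apply_one
  rwa [zero_add, LinearMap.smul_apply] at this

theorem hasAd_deltas_vf_actK (i : Idx q n) (y : 𝔨) (l : List (Idx q n)) :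
    HasAd (ρ.deltas l (ρ.vf i) 1) (par i + listPar l) (ρ.actK y) 0
      (ksign (par i + listPar l) (par i) • ρ.deltas l (ρ.actK y) ∘ₗ A.derR i) := by
  have := ((h.hasBracket_vf_actK i y).deltas (h.isCovariant_actK y) l).hasAd
  rwa [show (ρ.deltas l (ρ.actK y)) ∘ₗ ((A.sgn (listPar l)).toLinearMap ∘ₗ A.der i) ∘ₗ
    (A.sgn (par i + listPar l)).toLinearMap =
    ksign (par i + listPar l) (par i) • ρ.deltas l (ρ.actK y) ∘ₗ A.derR i from
    LinearMap.ext fun a => by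
      simp only [LinearMap.comp_apply, LinearMap.smul_apply, AlgHom.toLinearMap_apply,
        A.derR_apply, A.sgn_der, map_smul, A.sgn_sgn, smul_smul, ksign_add_left]
      rw [show listPar l + (par i + listPar l) = par i by
        rw [add_comm (par i), ← add_assoc, zmod_two_add_self, zero_add]]
      congr 1
      rw [mul_comm (ksign (par i) (par i)), mul_assoc, ksign_mul_self, mul_one]] at this

/-- A vector field differentiates once, so orders add up to a loss of one. The bracket is zero on `y
⊗ 1`, which has nothing to differentiate; this is recorded by `l' ≠ []` in the spanning set. -/
theorem deltas_vf_mul_deltas_actK_sub_mem (i : Idx q n) (y : 𝔨) {l : List (Idx q n)} (hl : l ≠ [])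
    (l' : List (Idx q n)) :
    ρ.deltas l (ρ.vf i) 1 * ρ.deltas l' (ρ.actK y) 1 -
      ksign (par i + listPar l) (listPar l') •
        (ρ.deltas l' (ρ.actK y) 1 * ρ.deltas l (ρ.vf i) 1) ∈
      Submodule.span ℂ {T | ∃ l'' : List (Idx q n), l''.length + 1 = l.length + l'.length ∧
        l' ≠ [] ∧ T = ρ.deltas l'' (ρ.actK y) 1} := by
  have := ((h.hasAd_deltas_vf_actK i y l).deltas (h.isConst_deltas_vf i hl) l').apply_one
  rw [zero_add, ← sub_eq_iff_eq_add] at this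
  rw [this, LinearMap.smul_apply, map_smul, LinearMap.smul_apply]
  refine Submodule.smul_mem _ _ (Submodule.smul_mem _ _ ?_)
  refine Submodule.span_mono ?_ (ρ.deltas_comp_derR_one_mem i l' (ρ.deltas l (ρ.actK y)))
  rintro _ ⟨l'', hl'', rfl⟩
  refine ⟨l'' ++ l, by simp; omega, ?_, by rw [deltas_append]⟩
  rintro rfl; simp at hl''

theorem deltas_delta_comp_derR (k : Idx q n) (l : List (Idx q n))
    (φ : A q n →ₗ[ℂ] Module.End ℂ V) :
    ρ.deltas l (ρ.delta k φ ∘ₗ A.derR k) =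
      ρ.delta k (ρ.deltas l φ) ∘ₗ A.derR k + (cnt k l : ℂ) • ρ.deltas l φ := by
  induction l with
  | nil => simp
  | cons j l ih =>
    rw [deltas_cons, ih, map_add, map_smul, delta_comp_derR, h.delta_delta j k, deltas_cons,
      cnt_cons, LinearMap.smul_comp, smul_smul, ksign_comm (par j), ksign_mul_self, one_smul]
    rcases eq_or_ne k j with rfl | hkj
    · simp only [if_true, Nat.cast_add, Nat.cast_one, add_smul, one_smul]
      abel
    · simp [hkj]

/-- The operators `E_k` corresponding to `t_k ∂_k`. -/
theorem delta_vf_mul_deltas_actK (k : Idx q n) (y : 𝔨) (l : List (Idx q n)) :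
    ρ.delta k (ρ.vf k) 1 * ρ.deltas l (ρ.actK y) 1 =
      (cnt k l : ℂ) • ρ.deltas l (ρ.actK y) 1 +
        ρ.deltas l (ρ.actK y) 1 * ρ.delta k (ρ.vf k) 1 := by
  have h1 := h.hasAd_deltas_vf_actK k y [k]
  have h2 := h.isConst_deltas_vf k (l := [k]) (by simp)
  simp only [listPar_cons, listPar_nil, add_zero, zmod_two_add_self, deltas_cons, deltas_nil,
    ksign_zero_left, one_smul] at h1 h2
  have := (h1.deltas h2 l).apply_one
  simp only [ksign_zero_left, one_smul] at this
  rw [this, h.deltas_delta_comp_derR]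
  simp

theorem deltas_delta_delta_comp_derR (i : Fin q) (l : List (Idx q n))
    (φ : A q n →ₗ[ℂ] Module.End ℂ V) :
    ρ.deltas l (ρ.delta (.inl i) (ρ.delta (.inl i) φ) ∘ₗ A.derR (.inl i)) =
      ρ.delta (.inl i) (ρ.delta (.inl i) (ρ.deltas l φ)) ∘ₗ A.derR (.inl i) +
        (cnt (.inl i) l : ℂ) • ρ.delta (.inl i) (ρ.deltas l φ) := by
  have hi : par (Sum.inl i : Idx q n) = 0 := rfl
  induction l with
  | nil => simp
  | cons j l ih =>
    have h1 : ∀ φ, ρ.delta j (ρ.delta (.inl i) φ) = ρ.delta (.inl i) (ρ.delta j φ) := by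
      intro φ; rw [h.delta_delta, hi, ksign_zero_right, one_smul]
    rw [deltas_cons, ih, map_add, map_smul, delta_comp_derR, h1, h1, deltas_cons,
      cnt_cons, hi, ksign_zero_left, one_smul]
    rcases eq_or_ne (.inl i) j with rfl | hkj
    · simp only [if_true, Nat.cast_add, Nat.cast_one, add_smul, one_smul]
      abel
    · simp [hkj]

/-- The operators corresponding to the quadratic vector fields `t_i ^ 2 ∂_i`. -/
theorem deltas_vf_mul_deltas_actK_of_even (i : Fin q) (y : 𝔨) (l : List (Idx q n)) :
    ρ.deltas [.inl i, .inl i] (ρ.vf (.inl i)) 1 * ρ.deltas l (ρ.actK y) 1 =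
      (cnt (.inl i) l : ℂ) • ρ.deltas (.inl i :: l) (ρ.actK y) 1 +
        ρ.deltas l (ρ.actK y) 1 * ρ.deltas [.inl i, .inl i] (ρ.vf (.inl i)) 1 := by
  have hi : par (Sum.inl i : Idx q n) = 0 := rfl
  have h1 := h.hasAd_deltas_vf_actK (.inl i) y [.inl i, .inl i]
  have h2 := h.isConst_deltas_vf (.inl i) (l := [.inl i, .inl i]) (by simp)
  simp only [listPar_cons, listPar_nil, add_zero, hi, ksign_zero_left, one_smul] at h1 h2
  have := (h1.deltas h2 l).apply_one
  simp only [ksign_zero_left, one_smul, deltas_cons, deltas_nil] at this ⊢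
  rw [this, h.deltas_delta_delta_comp_derR]
  simp

/-- The bracket of a linear vector field `t_j ∂_k` with `f ∂_i`. In the term coming from `∂_i t_j`,
the part of `f ∂_k` lying in the Weyl superalgebra is subtracted; further differences annihilate the
subtracted function. -/
theorem hasAd_delta_vf_vf (i j k : Idx q n) :
    HasAd (ρ.delta j (ρ.vf k) 1) (par j + par k) (ρ.vf i) (par i)
      (ksign (par j + par k) (par k) • ρ.delta j (ρ.vf i) ∘ₗ A.derR k -
        (if i = j then ksign (par j + par k) (par i) else 0) •
          (ρ.vf k - LinearMap.mulRight ℂ (ρ.D k) ∘ₗ ρ.actA)) := by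
  have h11 : (1 : ZMod 2) + 1 = 0 := rfl
  intro g
  induction g using A.induction_homogeneous with
  | add x y hx hy => simp only [map_add, mul_add, hx, hy, add_mul, smul_add]; abel
  | mem b f hf =>
    have h1 := h.vf_mul_vf k i (A.gen_mem j) hf
    have h2 := h.D_mul_vf i k f
    have h3 := h.vf_mul_t i j f
    have h4 : ρ.t j * ρ.vf i f = ksign (par j) (par i + b) • (ρ.vf i f * ρ.t j) -
        if i = j then ksign (par j) (par i + b) • ρ.actA f else 0 := by
      rw [h3, A.sgn_of_mem _ hf, map_smul, mul_smul_comm, smul_smul, ← ksign_add_right, smul_add,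
        smul_smul, ksign_mul_self, one_smul]
      split_ifs <;> simp
    rw [A.sgn_of_mem _ hf, map_smul, smul_mul_assoc] at h2
    rw [delta_apply, one_mul, map_one, sub_mul, h1, mul_assoc,
      show ρ.vf k 1 = ρ.D k from rfl, h2, mul_add, smul_smul, mul_smul_comm, ← mul_assoc, h4,
      A.sgn_of_mem _ hf]
    have h5 : A.gen j * A.der k f =
        ksign (par j) (par k + b) • (A.der k f * A.gen j) :=
      A.mul_comm_of_mem (A.gen_mem j) (A.der_mem k hf)
    simp only [LinearMap.sub_apply, LinearMap.smul_apply, LinearMap.comp_apply,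
      LinearMap.mulRight_apply, delta_apply, map_smul, A.derR_apply,
      A.sgn_of_mem _ (A.der_mem k hf), smul_mul_assoc, mul_smul_comm, A.der_gen, mul_sub, h5]
    clear h1 h2 h3 h4 h5
    -- Only signs remain to be compared, so all parities are enumerated.
    rcases eq_or_ne i j with rfl | hij
    · rcases zmod_two_cases (par i) with hi | hi <;> rcases zmod_two_cases (par k) with hk | hk <;>
      rcases zmod_two_cases b with rfl | rfl <;>
      simp only [hi, hk, if_true, ksign_zero_left, ksign_zero_right, ksign_one_one, h11, add_zero,
        zero_add, sub_mul, smul_mul_assoc, mul_assoc, mul_one] <;> module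
    · rcases zmod_two_cases (par i) with hi | hi <;> rcases zmod_two_cases (par k) with hk | hk <;>
      rcases zmod_two_cases (par j) with hj | hj <;> rcases zmod_two_cases b with rfl | rfl <;>
      simp only [hi, hk, hj, hij, if_false, ksign_zero_left, ksign_zero_right, ksign_one_one, h11,
        add_zero, zero_add, smul_mul_assoc, mul_assoc, mul_one, mul_zero, map_zero,
        sub_zero] <;>
      module

end IsModule

end AkAction

end Difference


/-! ### Linear algebra -/

section LinearAlgebra

variable {V : Type*} [AddCommGroup V] [Module ℂ V]

theorem mem_wtSpace {ι : Type*} {h : ι → Module.End ℂ V} {wt : ι → ℂ} {v : V} :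
    v ∈ wtSpace h wt ↔ ∀ i, h i v = wt i • v := by
  simp [wtSpace]

/-- An invariant subspace contains the weight components of its elements. -/
theorem mem_of_sum_mem_of_mem_wtSpace {ι κ : Type*} {h : ι → Module.End ℂ V} {Q : Submodule ℂ V}
    (hQ : ∀ i, ∀ v ∈ Q, h i v ∈ Q) {χ : κ → ι → ℂ} (hχ : Function.Injective χ) (F : Finset κ)
    (w : κ → V) (hw : ∀ k ∈ F, w k ∈ wtSpace h (χ k)) (hsum : ∑ k ∈ F, w k ∈ Q) :
    ∀ k ∈ F, w k ∈ Q := by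
  classical
  induction F using Finset.induction_on generalizing w with
  | empty => simp
  | insert a F ha ih =>
    rw [Finset.sum_insert ha] at hsum
    have h1 : ∀ k ∈ F, w k ∈ Q := by
      intro k hk
      have hne : χ k ≠ χ a := fun h' => ha (hχ h' ▸ hk)
      obtain ⟨i, hi⟩ := Function.ne_iff.1 hne
      have h2 := ih (fun k => (χ k i - χ a i) • w k)
        (fun k hk => Submodule.smul_mem _ _ (hw k (Finset.mem_insert_of_mem hk))) (by
          have h3 := Q.sub_mem (hQ i _ hsum) (Q.smul_mem (χ a i) hsum)
          rw [map_add, mem_wtSpace.1 (hw a (Finset.mem_insert_self _ _)), map_sum, smul_add,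
            Finset.smul_sum, add_sub_add_left_eq_sub, ← Finset.sum_sub_distrib] at h3
          convert h3 using 1
          refine Finset.sum_congr rfl fun k hk => ?_
          rw [mem_wtSpace.1 (hw k (Finset.mem_insert_of_mem hk)), sub_smul]) k hk
      have h4 := Q.smul_mem (χ k i - χ a i)⁻¹ h2
      rwa [smul_smul, inv_mul_cancel₀ (sub_ne_zero.2 hi), one_smul] at h4
    intro k hk
    rcases Finset.mem_insert.1 hk with rfl | hk
    · simpa using Q.sub_mem hsum (Q.sum_mem h1)
    · exact h1 k hk

theorem eq_zero_of_sum_eq_zero_of_mem_wtSpace {ι κ : Type*} {h : ι → Module.End ℂ V}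
    {χ : κ → ι → ℂ} (hχ : Function.Injective χ) (F : Finset κ)
    (w : κ → V) (hw : ∀ k ∈ F, w k ∈ wtSpace h (χ k)) (hsum : ∑ k ∈ F, w k = 0) :
    ∀ k ∈ F, w k = 0 := by
  have := mem_of_sum_mem_of_mem_wtSpace (Q := ⊥) (h := h) (by simp) hχ F w hw (by simp [hsum])
  simpa using this

theorem le_iSup_inf_wtSpace {ι : Type*} {h : ι → Module.End ℂ V} (hh : IsWeight h)
    {Q : Submodule ℂ V} (hQ : ∀ i, ∀ v ∈ Q, h i v ∈ Q) : Q ≤ ⨆ χ, Q ⊓ wtSpace h χ := by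
  intro v hv
  have hv' : v ∈ ⨆ χ : ι → ℂ, wtSpace h χ := by rw [show _ = ⊤ from hh]; trivial
  obtain ⟨f, hf, rfl⟩ := (Submodule.mem_iSup_iff_exists_finsupp _ _).1 hv'
  have := mem_of_sum_mem_of_mem_wtSpace hQ Function.injective_id f.support f (fun k _ => hf k) hv
  exact Submodule.sum_mem _ fun k hk => Submodule.mem_iSup_of_mem k ⟨this k hk, hf k⟩

/-- On `End U` the powers of `B` satisfy `[E, B^m] = m k B^m`. Nonzero powers would be eigenvectors
for infinitely many eigenvalues in finite dimension, so `B` is nilpotent on `U`, and by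
Cayley–Hamilton the dimension bounds the exponent. -/
theorem pow_finrank_apply_eq_zero {U : Submodule ℂ V} [FiniteDimensional ℂ U] {c : ℕ}
    (hc : Module.finrank ℂ U ≤ c) {B E : Module.End ℂ V} (hB : ∀ v ∈ U, B v ∈ U)
    (hE : ∀ v ∈ U, E v ∈ U) {k : ℂ} (hk : k ≠ 0) (h : E * B = k • B + B * E) :
    ∀ v ∈ U, (B ^ c) v = 0 := by
  set b : Module.End ℂ U := B.restrict hB with hb
  set e : Module.End ℂ U := E.restrict hE with he
  have hbe : e * b = k • b + b * e := by
    ext v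
    have := congrArg (fun T : Module.End ℂ V => T v) h
    simpa [hb, he] using this
  have hpow : ∀ m : ℕ, e * b ^ m = ((m : ℂ) * k) • b ^ m + b ^ m * e := by
    intro m
    induction m with
    | zero => simp
    | succ m ih =>
      rw [pow_succ, ← mul_assoc, ih, add_mul, mul_assoc _ e b, hbe, mul_add, smul_mul_assoc,
        mul_smul_comm, ← mul_assoc, ← add_assoc, ← add_smul]
      congr 2
      push_cast; ring
  have hnil : IsNilpotent b := by
    by_contra hnot
    have hne : ∀ m : ℕ, b ^ m ≠ 0 := fun m hm => hnot ⟨m, hm⟩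
    let ad : Module.End ℂ (Module.End ℂ U) := LinearMap.mulLeft ℂ e - LinearMap.mulRight ℂ e
    have hev : ∀ m : ℕ, ad.HasEigenvalue ((m : ℂ) * k) := by
      intro m
      refine Module.End.hasEigenvalue_of_hasEigenvector (x := b ^ m) ⟨?_, hne m⟩
      rw [Module.End.mem_eigenspace_iff]
      simp [ad, hpow m]
    have hfin : Set.Finite {μ | ad.HasEigenvalue μ} := Module.End.finite_hasEigenvalue ad
    refine Set.infinite_of_injective_forall_mem (f := fun m : ℕ => (m : ℂ) * k) ?_ hev hfin
    intro m m' hm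
    exact_mod_cast mul_right_cancel₀ hk hm
  have h0 : b ^ c = 0 := by
    have h1 : b ^ Module.finrank ℂ U = 0 := by
      have h := (LinearMap.isNilpotent_iff_charpoly b).1 hnil
      have h' := LinearMap.aeval_self_charpoly b
      rwa [h, map_pow, Polynomial.aeval_X] at h'
    exact pow_eq_zero_of_le hc h1
  intro v hv
  have h2 := congrArg (fun T : Module.End ℂ U => ((T ⟨v, hv⟩ : U) : V)) h0
  have h3 : ∀ m : ℕ, (((b ^ m) ⟨v, hv⟩ : U) : V) = (B ^ m) v := by
    intro m
    induction m with
    | zero => rfl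
    | succ m ih => rw [pow_succ', pow_succ', Module.End.mul_apply, Module.End.mul_apply, ← ih]; rfl
  rw [← h3]
  simpa using h2

/-- If `ad a` maps `b` to `y` and kills `y`, then `y ^ c = 0` as soon as `b ^ c = 0`. -/
theorem pow_eq_zero_of_commutator {R : Type*} [Ring R] [Algebra ℂ R] {a b y : R}
    (hab : a * b = y + b * a) (hay : a * y = y * a) {c : ℕ} (hb : b ^ c = 0) : y ^ c = 0 := by
  let D : Module.End ℂ R := LinearMap.mulLeft ℂ a - LinearMap.mulRight ℂ a
  have hD : ∀ x, D x = a * x - x * a := fun x => rfl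
  have hDmul : ∀ x z, D (x * z) = D x * z + x * D z := by
    intro x z; simp only [hD]; noncomm_ring
  have hDb : D b = y := by rw [hD, hab]; abel
  have hDy : D y = 0 := by rw [hD, hay, sub_self]
  have h1 : ∀ (j : ℕ) (x : R), (D ^ (j + 1)) (x * b) =
      (D ^ (j + 1)) x * b + ((j : ℂ) + 1) • ((D ^ j) x * y) := by
    intro j
    induction j with
    | zero => intro x; simp [hDmul, hDb]
    | succ j ih =>
      intro x
      rw [pow_succ' D (j + 1), Module.End.mul_apply, ih, map_add, map_smul, hDmul, hDmul, hDb, hDy,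
        mul_zero, add_zero, ← Module.End.mul_apply, ← pow_succ', ← Module.End.mul_apply,
        ← pow_succ', add_assoc]
      congr 1
      push_cast
      module
  -- With `D = ad a`, `D b = y` and `D y = 0`, the power `b^k` behaves like a polynomial of degree
  -- `k`: its `k`-th derivative is `k! y^k` and the next one is zero. The second statement is what
  -- makes the induction work.
  have h2 : ∀ k : ℕ, (D ^ k) (b ^ k) = (k.factorial : ℂ) • y ^ k ∧ (D ^ (k + 1)) (b ^ k) = 0 := by
    intro k
    induction k with
    | zero => simp [hD]
    | succ k ih =>
      constructor
      · rw [pow_succ b, h1, ih.2, ih.1, zero_mul, zero_add, smul_mul_assoc, smul_smul, pow_succ]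
        congr 1
        rw [Nat.factorial_succ]; push_cast; ring
      · rw [pow_succ b, h1, ih.2, zero_mul, smul_zero, add_zero, pow_succ' D, Module.End.mul_apply,
          ih.2, map_zero, zero_mul]
  have h3 := (h2 c).1
  rw [hb, map_zero] at h3
  exact (smul_eq_zero.1 h3.symm).resolve_left (by exact_mod_cast c.factorial_ne_zero)

/-- An elementary substitute for Engel's theorem: each nilpotent operator has nonzero kernel on the
current subspace, and commutation up to scalars makes that kernel invariant under the remaining
operators. No finite dimension is used. -/
theorem exists_mem_forall_apply_eq_zero (L : List (Module.End ℂ V))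
    (hcomm : ∀ B ∈ L, ∀ B' ∈ L, ∃ c : ℂ, B * B' = c • (B' * B))
    (hnil : ∀ B ∈ L, IsNilpotent B) (K : Submodule ℂ V) (hK : K ≠ ⊥)
    (hLK : ∀ B ∈ L, ∀ v ∈ K, B v ∈ K) : ∃ v ∈ K, v ≠ 0 ∧ ∀ B ∈ L, B v = 0 := by
  induction L generalizing K with
  | nil =>
    obtain ⟨v, hv, h0⟩ := (Submodule.ne_bot_iff K).1 hK
    exact ⟨v, hv, h0, by simp⟩
  | cons B L ih =>
    have hK' : K ⊓ LinearMap.ker B ≠ ⊥ := by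
      obtain ⟨v, hv, h0⟩ := (Submodule.ne_bot_iff K).1 hK
      have hex : ∃ m, (B ^ m) v = 0 := by
        obtain ⟨m, hm⟩ := hnil B (by simp)
        exact ⟨m, by rw [hm]; rfl⟩
      classical
      have hpos : Nat.find hex ≠ 0 := by
        intro h1
        have := Nat.find_spec hex
        rw [h1] at this
        exact h0 this
      obtain ⟨m, hm⟩ := Nat.exists_eq_succ_of_ne_zero hpos
      have h1 : (B ^ m) v ≠ 0 := Nat.find_min hex (by omega)
      have h2 : B ((B ^ m) v) = 0 := by
        have := Nat.find_spec hex
        rwa [hm, pow_succ', Module.End.mul_apply] at this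
      have h3 : ∀ j : ℕ, (B ^ j) v ∈ K := by
        intro j
        induction j with
        | zero => exact hv
        | succ j ihj => rw [pow_succ', Module.End.mul_apply]; exact hLK B (by simp) _ ihj
      exact (Submodule.ne_bot_iff _).2 ⟨_, ⟨h3 m, h2⟩, h1⟩
    obtain ⟨v, hv, h0, hv'⟩ := ih (fun B hB B' hB' => hcomm B (by simp [hB]) B' (by simp [hB']))
      (fun B hB => hnil B (by simp [hB])) _ hK' (fun B' hB' v hv =>
        ⟨hLK B' (by simp [hB']) v hv.1, by
        obtain ⟨c, hc⟩ := hcomm B (by simp) B' (by simp [hB'])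
        rw [SetLike.mem_coe, LinearMap.mem_ker, ← Module.End.mul_apply, hc, LinearMap.smul_apply,
          Module.End.mul_apply, LinearMap.mem_ker.1 hv.2, map_zero, smul_zero]⟩)
    refine ⟨v, hv.1, h0, ?_⟩
    intro B' hB'
    rcases List.mem_cons.1 hB' with rfl | hB'
    · exact hv.2
    · exact hv' B' hB'

theorem exists_mem_forall_apply_eq_smul (L : List (Module.End ℂ V))
    (hcomm : ∀ B ∈ L, ∀ B' ∈ L, B * B' = B' * B) (K : Submodule ℂ V) [FiniteDimensional ℂ K]
    (hK : K ≠ ⊥) (hLK : ∀ B ∈ L, ∀ v ∈ K, B v ∈ K) :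
    ∃ v ∈ K, v ≠ 0 ∧ ∀ B ∈ L, ∃ μ : ℂ, B v = μ • v := by
  induction L generalizing K with
  | nil =>
    obtain ⟨v, hv, h0⟩ := (Submodule.ne_bot_iff K).1 hK
    exact ⟨v, hv, h0, by simp⟩
  | cons B L ih =>
    have : Nontrivial K := Submodule.nontrivial_iff_ne_bot.2 hK
    obtain ⟨μ, hμ⟩ := Module.End.exists_eigenvalue (B.restrict (hLK B (by simp)))
    obtain ⟨w, hw, hw0⟩ := hμ.exists_hasEigenvector
    have hBw : B w = μ • (w : V) := by
      have := congrArg Subtype.val (Module.End.mem_eigenspace_iff.1 hw)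
      simpa using this
    have hK' : K ⊓ Module.End.eigenspace B μ ≠ ⊥ :=
      (Submodule.ne_bot_iff _).2 ⟨w, ⟨w.2, Module.End.mem_eigenspace_iff.2 hBw⟩, by simpa using hw0⟩
    have : FiniteDimensional ℂ (K ⊓ Module.End.eigenspace B μ : Submodule ℂ V) :=
      Submodule.finiteDimensional_of_le inf_le_left
    obtain ⟨v, hv, h0, hv'⟩ := ih (fun B hB B' hB' => hcomm B (by simp [hB]) B' (by simp [hB']))
      (K ⊓ Module.End.eigenspace B μ) hK' (fun B' hB' v hv => ⟨hLK B' (by simp [hB']) v hv.1, by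
        rw [SetLike.mem_coe, Module.End.mem_eigenspace_iff, ← Module.End.mul_apply,
          hcomm B (by simp) B' (by simp [hB']),
          Module.End.mul_apply, Module.End.mem_eigenspace_iff.1 hv.2, map_smul]⟩)
    refine ⟨v, hv.1, h0, ?_⟩
    intro B' hB'
    rcases List.mem_cons.1 hB' with rfl | hB'
    · exact ⟨μ, Module.End.mem_eigenspace_iff.1 hv.2⟩
    · exact hv' B' hB'

/-- The linear maps that intertwine two families of operators. -/
def intertwiners {ι M N : Type*} [AddCommGroup M] [Module ℂ M] [AddCommGroup N] [Module ℂ N]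
    (gM : ι → Module.End ℂ M) (gN : ι → Module.End ℂ N) : Submodule ℂ (M →ₗ[ℂ] N) where
  carrier := {φ | ∀ i m, φ (gM i m) = gN i (φ m)}
  add_mem' h h' i m := by simp [h i m, h' i m]
  zero_mem' i m := by simp
  smul_mem' c φ h i m := by simp [h i m]

/-! ### Intertwiners from a simple module and the evaluation map. -/

section Intertwiners

variable {ι M N : Type*} [AddCommGroup M] [Module ℂ M] [AddCommGroup N] [Module ℂ N]
  {gM : ι → Module.End ℂ M} {gN : ι → Module.End ℂ N}

/-- The evaluation map `M ⊗ Hom(M, N) → N`. -/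
def evalIntertwiners (gM : ι → Module.End ℂ M) (gN : ι → Module.End ℂ N) :
    M ⊗[ℂ] intertwiners gM gN →ₗ[ℂ] N :=
  TensorProduct.lift (intertwiners gM gN).subtype.flip

@[simp] theorem evalIntertwiners_tmul (m : M) (φ : intertwiners gM gN) :
    evalIntertwiners gM gN (m ⊗ₜ φ) = φ.1 m := rfl

theorem exists_eq_smul_of_intertwiner [FiniteDimensional ℂ M] [Nontrivial M]
    (hsimple : ∀ Q : Submodule ℂ M, (∀ i, ∀ v ∈ Q, gM i v ∈ Q) → Q = ⊥ ∨ Q = ⊤) {ψ : Module.End ℂ M}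
    (hψ : ∀ i m, ψ (gM i m) = gM i (ψ m)) : ∃ c : ℂ, ∀ m, ψ m = c • m := by
  obtain ⟨c, hc⟩ := Module.End.exists_eigenvalue ψ
  refine ⟨c, fun m => ?_⟩
  have h1 := hsimple (Module.End.eigenspace ψ c) (fun i v hv => by
    rw [Module.End.mem_eigenspace_iff] at hv ⊢
    rw [hψ, hv, map_smul])
  have h2 := h1.resolve_left hc
  exact Module.End.mem_eigenspace_iff.1 (h2 ▸ Submodule.mem_top)

/-- Images of linearly independent intertwiners from a simple module form a direct sum. Schur's
property is a separate hypothesis because the lemma is also applied to infinite-dimensional modules.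
-/
theorem eq_zero_of_sum_intertwiners
    (hsimple : ∀ Q : Submodule ℂ M, (∀ i, ∀ v ∈ Q, gM i v ∈ Q) → Q = ⊥ ∨ Q = ⊤)
    (hschur : ∀ ψ : Module.End ℂ M,
    (∀ i m, ψ (gM i m) = gM i (ψ m)) → ∃ c : ℂ, ∀ m, ψ m = c • m) {κ : Type*}
    {b : κ → intertwiners gM gN} (hb : LinearIndependent ℂ b) (F : Finset κ) (m : κ → M)
    (hsum : ∑ k ∈ F, (b k).1 (m k) = 0) : ∀ k ∈ F, m k = 0 := by
  classical
  induction F using Finset.induction_on generalizing m with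
  | empty => simp
  | insert a F ha ih =>
    -- The elements whose image under `b a` lies in the sum of the other images. By simplicity
    -- either none does, except zero, or all do.
    let Q : Submodule ℂ M :=
      { carrier := {x | ∃ m : κ → M, (b a).1 x = ∑ k ∈ F, (b k).1 (m k)}
        add_mem' := by
          rintro x y ⟨m, hm⟩ ⟨m', hm'⟩
          exact ⟨m + m', by simp [hm, hm', Finset.sum_add_distrib]⟩
        zero_mem' := ⟨0, by simp⟩
        smul_mem' := by
          rintro c x ⟨m, hm⟩
          exact ⟨c • m, by simp [hm, Finset.smul_sum]⟩ }
    rcases hsimple Q (by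
      rintro i x ⟨m, hm⟩
      refine ⟨fun k => gM i (m k), ?_⟩
      rw [(b a).2, hm, map_sum]
      exact Finset.sum_congr rfl fun k _ => ((b k).2 i _).symm) with hQ | hQ
    · rw [Finset.sum_insert ha] at hsum
      have h1 : m a ∈ Q := ⟨-m, by simpa [add_eq_zero_iff_eq_neg] using hsum⟩
      rw [hQ, Submodule.mem_bot] at h1
      rw [h1, map_zero, zero_add] at hsum
      intro k hk
      rcases Finset.mem_insert.1 hk with rfl | hk
      · exact h1
      · exact ih m hsum k hk
    · exfalso
      have h1 : ∀ x, ∃ m : κ → M, (b a).1 x = ∑ k ∈ F, (b k).1 (m k) := fun x =>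
        show x ∈ Q from hQ ▸ Submodule.mem_top
      choose f hf using h1
      have huniq : ∀ m m' : κ → M, ∑ k ∈ F, (b k).1 (m k) = ∑ k ∈ F, (b k).1 (m' k) →
          ∀ k ∈ F, m k = m' k := by
        intro m m' h k hk
        rw [← sub_eq_zero, ← Finset.sum_sub_distrib] at h
        have := ih (fun k => m k - m' k) (by simpa using h) k hk
        exact sub_eq_zero.1 this
      -- If all do, the coordinates are unique by the induction hypothesis, hence intertwining
      -- endomorphisms of `M`, hence scalars. So `b a` is a combination of the others, contrary to
      -- independence.
      have hscal : ∀ k ∈ F, ∃ c : ℂ, ∀ x, f x k = c • x := by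
        intro k hk
        let ψ : Module.End ℂ M :=
          { toFun := fun x => f x k
            map_add' := fun x y => huniq (f (x + y)) (fun k => f x k + f y k) (by
              rw [← hf, map_add, hf, hf]; simp [Finset.sum_add_distrib]) k hk
            map_smul' := fun c x => huniq (f (c • x)) (fun k => c • f x k) (by
              rw [← hf, map_smul, hf]; simp [Finset.smul_sum]) k hk }
        exact hschur ψ fun i x =>
          huniq (f (gM i x)) (fun k => gM i (f x k)) (by
            rw [← hf, (b a).2, hf, map_sum]
            exact Finset.sum_congr rfl fun k _ => ((b k).2 i _).symm) k hk
      choose! c hc using hscal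
      have hba : b a = ∑ k ∈ F, c k • b k := by
        refine Subtype.ext (LinearMap.ext fun x => ?_)
        rw [hf x, Submodule.coe_sum, LinearMap.sum_apply]
        refine Finset.sum_congr rfl fun k hk => ?_
        rw [hc k hk, map_smul]; rfl
      have h2 : b a ∈ Submodule.span ℂ (b '' F) := by
        rw [hba]
        exact Submodule.sum_mem _ fun k hk =>
          Submodule.smul_mem _ _ (Submodule.subset_span ⟨k, hk, rfl⟩)
      exact hb.notMem_span_image (by simpa using ha) h2

theorem evalIntertwiners_injective
    (hsimple : ∀ Q : Submodule ℂ M, (∀ i, ∀ v ∈ Q, gM i v ∈ Q) → Q = ⊥ ∨ Q = ⊤)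
    (hschur : ∀ ψ : Module.End ℂ M,
    (∀ i m, ψ (gM i m) = gM i (ψ m)) → ∃ c : ℂ, ∀ m, ψ m = c • m) :
    Function.Injective (evalIntertwiners gM gN) := by
  rw [injective_iff_map_eq_zero]
  intro z hz
  let b := Module.Basis.ofVectorSpace ℂ (intertwiners gM gN)
  obtain ⟨m, rfl⟩ := TensorProduct.eq_repr_basis_right b z
  rw [Finsupp.sum, map_sum] at hz
  have h := eq_zero_of_sum_intertwiners hsimple hschur b.linearIndependent m.support m hz
  exact Finset.sum_eq_zero fun k hk => by simp [h k hk]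

end Intertwiners

/-- A simple module over two commuting families of operators that contains a nonzero
finite-dimensional subspace invariant under the first family is a tensor product. -/
theorem exists_tensor_decomposition {ι κ N : Type*} [AddCommGroup N] [Module ℂ N]
    {g : ι → Module.End ℂ N} {t : κ → Module.End ℂ N} (hcomm : ∀ i k, g i * t k = t k * g i)
    (hsimple : ∀ Q : Submodule ℂ N, (∀ i, ∀ v ∈ Q, g i v ∈ Q) → (∀ k, ∀ v ∈ Q, t k v ∈ Q) →
      Q = ⊥ ∨ Q = ⊤)
    (U : Submodule ℂ N) [FiniteDimensional ℂ U] (hU : U ≠ ⊥) (hgU : ∀ i, ∀ v ∈ U, g i v ∈ U) :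
    ∃ M : Submodule ℂ N, M ≤ U ∧ M ≠ ⊥ ∧ ∃ hM : ∀ i, ∀ v ∈ M, g i v ∈ M,
      (∀ Q : Submodule ℂ M, (∀ i, ∀ v ∈ Q, (g i).restrict (hM i) v ∈ Q) → Q = ⊥ ∨ Q = ⊤) ∧
      Function.Bijective (evalIntertwiners (fun i => (g i).restrict (hM i)) g) := by
  classical
  -- An invariant nonzero subspace of `U` of least dimension is simple for the first family.
  have hex : ∃ d : ℕ, ∃ M : Submodule ℂ N, M ≤ U ∧ M ≠ ⊥ ∧ (∀ i, ∀ v ∈ M, g i v ∈ M) ∧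
    Module.finrank ℂ M = d := ⟨_, U, le_rfl, hU, hgU, rfl⟩
  obtain ⟨M, hMU, hM0, hM, hd⟩ := Nat.find_spec hex
  have : FiniteDimensional ℂ M := Submodule.finiteDimensional_of_le hMU
  have : Nontrivial M := Submodule.nontrivial_iff_ne_bot.2 hM0
  have hMs : ∀ Q : Submodule ℂ M, (∀ i, ∀ v ∈ Q, (g i).restrict (hM i) v ∈ Q) →
      Q = ⊥ ∨ Q = ⊤ := by
    intro Q hQ
    by_cases hQ0 : Q = ⊥
    · exact Or.inl hQ0
    right
    have h1 : Nat.find hex ≤ Module.finrank ℂ (Q.map M.subtype) := by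
      refine Nat.find_min' hex ⟨Q.map M.subtype, (Submodule.map_subtype_le _ _).trans hMU, ?_, ?_,
        rfl⟩
      · rwa [Ne, ← Submodule.map_bot M.subtype,
          (Submodule.map_injective_of_injective M.injective_subtype).eq_iff]
      · rintro i _ ⟨v, hv, rfl⟩
        exact ⟨_, hQ i v hv, rfl⟩
    rw [← hd, Submodule.finrank_map_subtype_eq] at h1
    exact Submodule.eq_top_of_finrank_eq (le_antisymm (Submodule.finrank_le Q) h1)
  refine ⟨M, hMU, hM0, hM, hMs, evalIntertwiners_injective hMs
    (fun _ => exists_eq_smul_of_intertwiner hMs), ?_⟩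
  rw [← LinearMap.range_eq_top]
  refine (hsimple _ ?_ ?_).resolve_left ?_
  · rintro i _ ⟨z, rfl⟩
    induction z using TensorProduct.induction_on with
    | zero => simp
    | add x y hx hy => rw [map_add, map_add]; exact add_mem hx hy
    | tmul m φ =>
      rw [evalIntertwiners_tmul, ← φ.2]
      exact ⟨_ ⊗ₜ φ, rfl⟩
  · rintro k _ ⟨z, rfl⟩
    induction z using TensorProduct.induction_on with
    | zero => simp
    | add x y hx hy => rw [map_add, map_add]; exact add_mem hx hy
    | tmul m φ =>
      refine ⟨m ⊗ₜ ⟨t k ∘ₗ φ.1, fun i m => ?_⟩, rfl⟩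
      rw [LinearMap.comp_apply, φ.2, ← Module.End.mul_apply, ← hcomm]; rfl
  · intro h0
    obtain ⟨v, hv, hv0⟩ := (Submodule.ne_bot_iff M).1 hM0
    have h1 : v ∈ LinearMap.range (evalIntertwiners (fun i => (g i).restrict (hM i)) g) :=
      ⟨⟨v, hv⟩ ⊗ₜ ⟨M.subtype, fun i m => rfl⟩, rfl⟩
    rw [h0, Submodule.mem_bot] at h1
    exact hv0 h1

end LinearAlgebra


/-! ### One variable: vacuum vectors of a Weyl pair -/

section OneVariable

variable {V : Type*} [AddCommGroup V] [Module ℂ V]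

/-- A pair of operators acting as a variable and the corresponding derivative; the sign `σ` is `1`
for an even variable and `-1` for an odd one. -/
structure IsWeylPair (t D : Module.End ℂ V) (σ : ℂ) : Prop where
  D_mul_t : D * t = 1 + σ • (t * D)
  even_or_odd : σ = 1 ∨ (σ = -1 ∧ t * t = 0 ∧ D * D = 0)

/-- A vector generating a simple module under a Weyl pair and being an eigenvector of `t D`. -/
structure IsVacuumVector (t D : Module.End ℂ V) (σ lam : ℂ) (v : V) : Prop where
  tD_apply : t (D v) = lam • v
  D_apply : lam = 0 → D v = 0
  t_apply : lam = -1 → t v = 0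
  -- For an even variable, the ladder coefficients `D t^(k+1) v = (lam + k + 1) t^k v` and `t
  -- D^(k+1) v = (lam - k) D^k v` vanish only at integral `lam`. Allowing just `0` and `-1` among
  -- the integers confines this to the first step, where `D v = 0` or `t v = 0` holds anyway.
  int : ∀ k : ℤ, lam = k → k = 0 ∨ k = -1
  odd : σ = -1 → lam = 0

/-- The monomial of degree `m` in `t` or in `D`. -/
def zmonomial (t D : Module.End ℂ V) : ℤ → Module.End ℂ V
  | .ofNat k => t ^ k
  | .negSucc k => D ^ (k + 1)

@[simp] theorem zmonomial_zero (t D : Module.End ℂ V) : zmonomial t D 0 = 1 := pow_zero t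

theorem zmonomial_natCast (t D : Module.End ℂ V) (k : ℕ) : zmonomial t D k = t ^ k := rfl

theorem zmonomial_neg_natCast (t D : Module.End ℂ V) (k : ℕ) : zmonomial t D (-k) = D ^ k := by
  cases k with
  | zero => simp
  | succ k => rfl

variable {t D : Module.End ℂ V} {σ lam : ℂ} {v : V}

namespace IsWeylPair

theorem D_t_apply (hp : IsWeylPair t D σ) (v : V) : D (t v) = v + σ • t (D v) := by
  have := congrArg (fun T : Module.End ℂ V => T v) hp.D_mul_t
  simpa using this

theorem tD_pow_t (hp : IsWeylPair t D 1) {μ : ℂ} (hv : t (D v) = μ • v) (k : ℕ) :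
    t (D ((t ^ k) v)) = (μ + k) • (t ^ k) v := by
  induction k with
  | zero => simpa using hv
  | succ k ih =>
    rw [pow_succ', Module.End.mul_apply, hp.D_t_apply, ih, one_smul, map_add, map_smul]
    push_cast
    module

theorem tD_pow_D (hp : IsWeylPair t D 1) {μ : ℂ} (hv : t (D v) = μ • v) (k : ℕ) :
    t (D ((D ^ k) v)) = (μ - k) • (D ^ k) v := by
  induction k with
  | zero => simpa using hv
  | succ k ih =>
    rw [pow_succ', Module.End.mul_apply]
    have h1 := hp.D_t_apply (D ((D ^ k) v))
    rw [ih, map_smul, one_smul] at h1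
    rw [eq_sub_of_add_eq' h1.symm]
    push_cast
    module

theorem pow_t_eq_zero (hp : IsWeylPair t D (-1)) {k : ℕ} (hk : 2 ≤ k) : t ^ k = 0 := by
  rcases hp.even_or_odd with h | h
  · norm_num at h
  · obtain ⟨j, rfl⟩ := Nat.exists_eq_add_of_le hk
    rw [pow_add, pow_two, h.2.1, zero_mul]

theorem tD_zmonomial (hp : IsWeylPair t D σ) (hv : IsVacuumVector t D σ lam v) (m : ℤ) :
    t (D (zmonomial t D m v)) = (lam + m) • zmonomial t D m v := by
  rcases hp.even_or_odd with rfl | ⟨rfl, h2⟩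
  · cases m with
    | ofNat k => simpa [zmonomial] using hp.tD_pow_t hv.tD_apply k
    | negSucc k =>
      have := hp.tD_pow_D hv.tD_apply (k + 1)
      rw [zmonomial, this, Int.cast_negSucc, sub_eq_add_neg]
  · obtain rfl := hv.odd rfl
    have hD := hv.D_apply rfl
    cases m with
    | ofNat k =>
      match k with
      | 0 => simp [zmonomial, hD]
      | 1 => simp [zmonomial, hp.D_t_apply, hD]
      | k + 2 => simp [zmonomial, hp.pow_t_eq_zero]
    | negSucc k => simp [zmonomial, pow_succ, hD]

theorem t_zmonomial (hp : IsWeylPair t D σ) (hv : IsVacuumVector t D σ lam v) (m : ℤ) :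
    ∃ c : ℂ, t (zmonomial t D m v) = c • zmonomial t D (m + 1) v := by
  cases m with
  | ofNat k => exact ⟨1, by
    rw [one_smul]; simp only [zmonomial, ← Module.End.mul_apply, ← pow_succ']; rfl⟩
  | negSucc k =>
    have := hp.tD_zmonomial hv (-(k : ℤ))
    rw [zmonomial_neg_natCast, ← Module.End.mul_apply, ← Module.End.mul_apply, mul_assoc,
      ← pow_succ', Module.End.mul_apply] at this
    exact ⟨_, by
      rw [zmonomial, this, show Int.negSucc k + 1 = -(k : ℤ) by omega, zmonomial_neg_natCast]⟩

theorem D_zmonomial (hp : IsWeylPair t D σ) (hv : IsVacuumVector t D σ lam v) (m : ℤ) :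
    ∃ c : ℂ, D (zmonomial t D m v) = c • zmonomial t D (m - 1) v := by
  match m with
  | .ofNat 0 => exact ⟨1, by
      rw [one_smul, show Int.ofNat 0 - 1 = -((1 : ℕ) : ℤ) by simp, zmonomial_neg_natCast, pow_one]
      rfl⟩
  | .ofNat (k + 1) =>
    have := hp.tD_zmonomial hv k
    rw [zmonomial_natCast] at this
    refine ⟨1 + σ * (lam + (k : ℤ)), ?_⟩
    rw [zmonomial, show Int.ofNat (k + 1) - 1 = k by simp, zmonomial_natCast, pow_succ',
      Module.End.mul_apply, hp.D_t_apply, this]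
    module
  | .negSucc k =>
    refine ⟨1, ?_⟩
    rw [one_smul, show Int.negSucc k - 1 = Int.negSucc (k + 1) by omega]
    simp only [zmonomial, ← Module.End.mul_apply, ← pow_succ']

/-- A subspace invariant under `t` and `D` that contains a nonzero monomial applied to a vacuum
vector contains the vacuum vector. -/
theorem mem_of_zmonomial_mem (hp : IsWeylPair t D σ) (hv : IsVacuumVector t D σ lam v)
    {Q : Submodule ℂ V} (htQ : ∀ w ∈ Q, t w ∈ Q) (hDQ : ∀ w ∈ Q, D w ∈ Q) {m : ℤ}
    (hm : zmonomial t D m v ∈ Q) (h0 : zmonomial t D m v ≠ 0) : v ∈ Q := by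
  have hpow : ∀ k : ℕ, (t ^ k) v ∈ Q → (t ^ k) v ≠ 0 → v ∈ Q := by
    intro k
    induction k with
    | zero => intro h _; simpa using h
    | succ k ih =>
      intro h h0
      have h1 := hDQ _ h
      have h2 := hp.tD_zmonomial hv (k : ℤ)
      rw [zmonomial_natCast] at h2
      rw [pow_succ', Module.End.mul_apply] at h1 h0
      have h3 : (t ^ k) v ≠ 0 := fun h => h0 (by rw [h, map_zero])
      rw [hp.D_t_apply, h2, smul_smul] at h1
      nth_rw 1 [← one_smul ℂ ((t ^ k) v)] at h1
      rw [← add_smul] at h1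
      refine ih ((Submodule.smul_mem_iff _ ?_).1 h1) h3
      -- A vanishing ladder coefficient forces `k = 0` and `lam = -1`, and then `t v = 0`
      -- contradicts that the monomial is nonzero on `v`.
      rcases hp.even_or_odd with rfl | ⟨rfl, h4⟩
      · intro h5
        have h6 := hv.int (-((k : ℤ) + 1)) (by push_cast at h5 ⊢; linear_combination h5)
        obtain rfl : k = 0 := by omega
        refine h0 ?_
        rw [pow_zero, Module.End.one_apply]
        refine hv.t_apply ?_
        push_cast at h5
        linear_combination h5
      · obtain rfl := hv.odd rfl
        cases k with
        | zero => simp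
        | succ k =>
          exfalso
          rw [← Module.End.mul_apply, ← pow_succ', hp.pow_t_eq_zero (by omega)] at h0
          simp at h0
  have hpow' : ∀ k : ℕ, (D ^ k) v ∈ Q → (D ^ k) v ≠ 0 → v ∈ Q := by
    intro k
    induction k with
    | zero => intro h _; simpa using h
    | succ k ih =>
      intro h h0
      have h1 := htQ _ h
      have h2 := hp.tD_zmonomial hv (-(k : ℤ))
      rw [zmonomial_neg_natCast] at h2
      rw [pow_succ', Module.End.mul_apply] at h1 h0
      have h3 : (D ^ k) v ≠ 0 := fun h => h0 (by rw [h, map_zero])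
      rw [h2] at h1
      refine ih ((Submodule.smul_mem_iff _ ?_).1 h1) h3
      intro h5
      have h6 := hv.int k (by push_cast at h5 ⊢; linear_combination h5)
      obtain rfl : k = 0 := by omega
      refine h0 ?_
      rw [pow_zero, Module.End.one_apply]
      refine hv.D_apply ?_
      push_cast at h5
      linear_combination h5
  cases m with
  | ofNat k => exact hpow k hm h0
  | negSucc k => exact hpow' (k + 1) hm h0

/-- The support of the module generated by a vacuum vector of an even variable: a half-line upwards
for `lam = 0`, a half-line downwards for `lam = -1`, and all of `ℤ` otherwise. An unbounded
half-line is available in every case, which the dimension estimate below needs. -/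
theorem zmonomial_apply_ne_zero (hp : IsWeylPair t D 1) (hv : IsVacuumVector t D 1 lam v)
    (h0 : v ≠ 0) {m : ℤ} (hm0 : lam = 0 → 0 ≤ m) (hm1 : lam = -1 → m ≤ 0) :
    zmonomial t D m v ≠ 0 := by
  cases m with
  | ofNat k =>
    change (t ^ k) v ≠ 0
    by_cases hl : lam = -1
    · obtain rfl : k = 0 := by have := hm1 hl; simp at this; omega
      simpa using h0
    clear hm0 hm1
    induction k with
    | zero => simpa using h0
    | succ k ih =>
      intro h
      have h2 := hp.tD_zmonomial hv (k : ℤ)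
      rw [zmonomial_natCast] at h2
      have h3 := hp.D_t_apply ((t ^ k) v)
      rw [← Module.End.mul_apply t, ← pow_succ', h, map_zero, h2, one_smul] at h3
      nth_rw 1 [← one_smul ℂ ((t ^ k) v)] at h3
      rw [← add_smul, eq_comm, smul_eq_zero] at h3
      have h4 := h3.resolve_right ih
      rcases hv.int (-((k : ℤ) + 1)) (by push_cast at h4 ⊢; linear_combination h4) with h6 | h6
      · omega
      · obtain rfl : k = 0 := by omega
        apply hl
        push_cast at h4
        linear_combination h4
  | negSucc k =>
    have hl : lam ≠ 0 := fun h => by have := hm0 h; omega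
    change (D ^ (k + 1)) v ≠ 0
    generalize k + 1 = k
    clear hm0 hm1
    induction k with
    | zero => simpa using h0
    | succ k ih =>
      intro h
      have h2 := hp.tD_zmonomial hv (-(k : ℤ))
      rw [zmonomial_neg_natCast, ← Module.End.mul_apply D, ← pow_succ', h, map_zero, eq_comm,
        smul_eq_zero] at h2
      have h4 := h2.resolve_right ih
      rcases hv.int k (by push_cast at h4 ⊢; linear_combination h4) with h6 | h6
      · obtain rfl : k = 0 := by omega
        apply hl
        push_cast at h4
        linear_combination h4
      · omega

/-- Any eigenvector of `t D` can be moved to a vacuum vector by a power of `t` or of `D`. -/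
theorem exists_isVacuumVector (hp : IsWeylPair t D σ) {μ : ℂ} (hv : t (D v) = μ • v)
    (h0 : v ≠ 0) : ∃ r : Module.End ℂ V, (∃ k : ℕ, r = t ^ k ∨ r = D ^ k) ∧ r v ≠ 0 ∧
      ∃ lam, IsVacuumVector t D σ lam (r v) := by
  have vacD : ∀ w, D w = 0 → IsVacuumVector t D σ 0 w := fun w hw =>
    ⟨by simp [hw], fun _ => hw, fun h => by norm_num at h,
      fun k hk => Or.inl (by exact_mod_cast hk.symm), fun _ => rfl⟩
  rcases hp.even_or_odd with rfl | ⟨rfl, h2⟩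
  · have vact : ∀ w, t w = 0 → IsVacuumVector t D 1 (-1) w := fun w hw =>
      ⟨by have := hp.D_t_apply w
          rw [hw, map_zero, one_smul, eq_comm, add_comm] at this
          rw [eq_neg_of_add_eq_zero_left this, neg_one_smul], fun h => by norm_num at h,
        fun _ => hw, fun k hk => Or.inr (by exact_mod_cast hk.symm), fun h => by norm_num at h⟩
    by_cases hD : ∃ k, (D ^ k) v = 0
    · classical
      obtain ⟨k, hk⟩ := Nat.exists_eq_succ_of_ne_zero (n := Nat.find hD) (by
        intro h
        have := Nat.find_spec hD
        rw [h] at this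
        exact h0 this)
      refine ⟨D ^ k, ⟨k, Or.inr rfl⟩, Nat.find_min hD (by omega), 0, vacD _ ?_⟩
      have := Nat.find_spec hD
      rwa [hk, Nat.succ_eq_add_one, pow_succ', Module.End.mul_apply] at this
    by_cases ht : ∃ k, (t ^ k) v = 0
    · classical
      obtain ⟨k, hk⟩ := Nat.exists_eq_succ_of_ne_zero (n := Nat.find ht) (by
        intro h
        have := Nat.find_spec ht
        rw [h] at this
        exact h0 this)
      refine ⟨t ^ k, ⟨k, Or.inl rfl⟩, Nat.find_min ht (by omega), -1, vact _ ?_⟩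
      have := Nat.find_spec ht
      rwa [hk, Nat.succ_eq_add_one, pow_succ', Module.End.mul_apply] at this
    push Not at hD ht
    -- If no power of `t` or `D` kills `v` and the eigenvalue is an integer, moving it to `0` makes
    -- the next ladder coefficient vanish, so one more step ends at a vector killed by `t` or by
    -- `D`.
    by_cases hμ : ∃ k : ℤ, μ = k
    · obtain ⟨k, rfl⟩ := hμ
      cases k with
      | ofNat k =>
        refine ⟨D ^ (k + 1), ⟨_, Or.inr rfl⟩, hD _, -1, vact _ ?_⟩
        have := hp.tD_pow_D hv k
        rw [pow_succ', Module.End.mul_apply, this]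
        simp
      | negSucc k =>
        refine ⟨t ^ (k + 1), ⟨_, Or.inl rfl⟩, ht _, 0, vacD _ ?_⟩
        have := hp.tD_pow_t hv k
        rw [pow_succ', Module.End.mul_apply, hp.D_t_apply, this, one_smul]
        nth_rw 1 [← one_smul ℂ ((t ^ k) v)]
        rw [← add_smul, Int.cast_negSucc]
        push_cast
        rw [show (1 : ℂ) + (-((k : ℂ) + 1) + k) = 0 by ring, zero_smul]
    · push Not at hμ
      refine ⟨1, ⟨0, Or.inl (by simp)⟩, h0, μ, hv, fun h => absurd h (by simpa using hμ 0),
        fun h => absurd h (by simpa using hμ (-1)), fun k hk => absurd hk (hμ k),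
        fun h => by norm_num at h⟩
  · by_cases hD : D v = 0
    · exact ⟨1, ⟨0, Or.inl (by simp)⟩, h0, 0, vacD _ hD⟩
    · refine ⟨D, ⟨1, Or.inr (by simp)⟩, hD, 0, vacD _ ?_⟩
      rw [← Module.End.mul_apply, h2.2, LinearMap.zero_apply]

end IsWeylPair

/-- The operator `r` commutes with `g` up to sign. -/
def SignCommute (r g : Module.End ℂ V) (c : ℂ) : Prop := g * r = c • (r * g)

theorem SignCommute.apply {r g : Module.End ℂ V} {c : ℂ} (h : SignCommute r g c) (v : V) :
    g (r v) = c • r (g v) := by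
  have := congrArg (fun T : Module.End ℂ V => T v) h
  simpa using this

theorem SignCommute.pow {r g : Module.End ℂ V} {c : ℂ} (h : SignCommute r g c) (k : ℕ) :
    SignCommute (r ^ k) g (c ^ k) := by
  induction k with
  | zero => simp [SignCommute]
  | succ k ih =>
    unfold SignCommute at *
    rw [pow_succ, ← mul_assoc, ih, smul_mul_assoc, mul_assoc, h, mul_smul_comm, smul_smul,
      pow_succ, mul_assoc]

theorem IsVacuumVector.map {r : Module.End ℂ V} (hv : IsVacuumVector t D σ lam v) {c : ℂ}
    (hc : c * c = 1) (ht : SignCommute r t c) (hD : SignCommute r D c) :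
    IsVacuumVector t D σ lam (r v) where
  tD_apply := by rw [hD.apply, map_smul, ht.apply, smul_smul, hc, one_smul, hv.tD_apply, map_smul]
  D_apply h := by rw [hD.apply, hv.D_apply h, map_zero, smul_zero]
  t_apply h := by rw [ht.apply, hv.t_apply h, map_zero, smul_zero]
  int := hv.int
  odd := hv.odd

end OneVariable

/-! ### Vacuum vectors -/

section Vacuum

variable {q n : ℕ} {𝔨 : Type*} [LieRing 𝔨] [LieAlgebra ℂ 𝔨] {V : Type*} [AddCommGroup V]
  [Module ℂ V]

namespace AkAction

variable (ρ : AkAction q n 𝔨 V)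

/-- `v` is a vacuum vector for the variable `t_a`. -/
def IsVac (a : Idx q n) (lam : ℂ) (v : V) : Prop :=
  IsVacuumVector (ρ.t a) (ρ.D a) (ksign (par a) (par a)) lam v

/-- The ordered product of the monomials of degrees `m a` in the Weyl pairs of the variables. -/
def monomial (l : List (Idx q n)) (m : Idx q n → ℤ) : Module.End ℂ V :=
  (l.map fun a => zmonomial (ρ.t a) (ρ.D a) (m a)).prod

theorem monomial_cons_apply (a : Idx q n) (l : List (Idx q n)) (m : Idx q n → ℤ) (v : V) :
    ρ.monomial (a :: l) m v = zmonomial (ρ.t a) (ρ.D a) (m a) (ρ.monomial l m v) := by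
  simp [monomial]

theorem monomial_zero (l : List (Idx q n)) : ρ.monomial l 0 = 1 := by
  simp [monomial]

theorem monomial_congr {l : List (Idx q n)} {m m' : Idx q n → ℤ} (h : ∀ a ∈ l, m a = m' a) :
    ρ.monomial l m = ρ.monomial l m' := by
  unfold monomial
  congr 1
  exact List.map_congr_left fun a ha => by rw [h a ha]

namespace IsModule

variable {ρ} (h : ρ.IsModule)

include h

theorem isWeylPair (a : Idx q n) : IsWeylPair (ρ.t a) (ρ.D a) (ksign (par a) (par a)) where
  D_mul_t := by rw [h.D_mul_t, if_pos rfl]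
  even_or_odd := by
    rcases zmod_two_cases (par a) with ha | ha
    · left; rw [ha, ksign_zero_left]
    · right
      have key : ∀ T : Module.End ℂ V, T = -T → T = 0 := fun T hT => by
        have h2 : (2 : ℂ) • T = 0 := by rw [two_smul]; nth_rewrite 2 [hT]; exact add_neg_cancel T
        exact (smul_eq_zero.1 h2).resolve_left two_ne_zero
      have h1 := h.t_mul_t a a
      have h2 := h.D_mul_D a a
      rw [ha, ksign_one_one, neg_one_smul] at h1 h2
      rw [ha, ksign_one_one]
      exact ⟨rfl, key _ h1, key _ h2⟩

theorem exists_signCommute {a b : Idx q n} (hab : a ≠ b) {r : Module.End ℂ V}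
    (hr : ∃ k : ℕ, r = ρ.t a ^ k ∨ r = ρ.D a ^ k) :
    ∃ c : ℂ, c * c = 1 ∧ SignCommute r (ρ.t b) c ∧ SignCommute r (ρ.D b) c := by
  obtain ⟨k, hr⟩ := hr
  refine ⟨ksign (par b) (par a) ^ k, by rw [← mul_pow, ksign_mul_self, one_pow], ?_⟩
  rcases hr with rfl | rfl
  · refine ⟨SignCommute.pow (h.t_mul_t b a) k, SignCommute.pow ?_ k⟩
    rw [SignCommute, h.D_mul_t, if_neg hab.symm, zero_add]
  · refine ⟨SignCommute.pow ?_ k, SignCommute.pow (h.D_mul_D b a) k⟩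
    rw [SignCommute, h.D_mul_t, if_neg hab, zero_add, smul_smul, ksign_comm (par a), ksign_mul_self,
      one_smul]

theorem exists_signCommute_s {a : Idx q n} {r : Module.End ℂ V}
    (hr : ∃ k : ℕ, r = ρ.t a ^ k ∨ r = ρ.D a ^ k) : ∃ c : ℂ, SignCommute r (h.s 1) c := by
  obtain ⟨k, hr⟩ := hr
  rcases hr with rfl | rfl
  · exact ⟨_, SignCommute.pow (h.s_mul_t 1 a) k⟩
  · exact ⟨_, SignCommute.pow (h.s_mul_D 1 a) k⟩

omit h in
theorem zmonomial_eq_pow (a : Idx q n) (m : ℤ) : ∃ k : ℕ,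
    zmonomial (ρ.t a) (ρ.D a) m = ρ.t a ^ k ∨ zmonomial (ρ.t a) (ρ.D a) m = ρ.D a ^ k := by
  cases m with
  | ofNat k => exact ⟨k, Or.inl rfl⟩
  | negSucc k => exact ⟨k + 1, Or.inr rfl⟩

theorem isVac_map {a b : Idx q n} (hab : a ≠ b) {r : Module.End ℂ V}
    (hr : ∃ k : ℕ, r = ρ.t a ^ k ∨ r = ρ.D a ^ k) {lam : ℂ} {v : V} (hv : ρ.IsVac b lam v) :
    ρ.IsVac b lam (r v) := by
  obtain ⟨c, hc, h1, h2⟩ := h.exists_signCommute hab hr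
  exact hv.map hc h1 h2

/-- Variables are treated one at a time: operators of one variable commute up to sign with those of
the others and with parity, so they preserve the conditions already achieved. -/
theorem exists_isVac (l : List (Idx q n)) {v : V} (h0 : v ≠ 0) (hs : ∃ c : ℂ, h.s 1 v = c • v)
    (hv : ∀ a, ∃ μ : ℂ, ρ.t a (ρ.D a v) = μ • v) :
    ∃ v : V, v ≠ 0 ∧ (∃ c : ℂ, h.s 1 v = c • v) ∧ (∀ a, ∃ μ : ℂ, ρ.t a (ρ.D a v) = μ • v) ∧
      ∀ a ∈ l, ∃ lam, ρ.IsVac a lam v := by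
  induction l with
  | nil => exact ⟨v, h0, hs, hv, by simp⟩
  | cons a l ih =>
    obtain ⟨w, h0, ⟨c, hc⟩, hw, hl⟩ := ih
    obtain ⟨μ, hμ⟩ := hw a
    obtain ⟨r, hr, hr0, lam, hlam⟩ := (h.isWeylPair a).exists_isVacuumVector hμ h0
    refine ⟨r w, hr0, ?_, ?_, ?_⟩
    · obtain ⟨c', hc'⟩ := h.exists_signCommute_s hr
      exact ⟨c' * c, by rw [hc'.apply, hc, map_smul, smul_smul]⟩
    · intro b
      by_cases hab : a = b
      · subst hab
        exact ⟨lam, hlam.tD_apply⟩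
      · obtain ⟨c', hc', h1, h2⟩ := h.exists_signCommute hab hr
        obtain ⟨μ', hμ'⟩ := hw b
        exact ⟨μ', by rw [h2.apply, map_smul, h1.apply, smul_smul, hc', one_smul, hμ', map_smul]⟩
    · intro b hb
      by_cases hab : a = b
      · subst hab
        exact ⟨lam, hlam⟩
      · rcases List.mem_cons.1 hb with rfl | hb
        · exact absurd rfl hab
        · obtain ⟨lam', h'⟩ := hl b hb
          exact ⟨lam', h.isVac_map hab hr h'⟩

/-! ### Monomials applied to a vacuum vector. -/

section Monomials

variable {lam : Idx q n → ℂ} {v : V}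

theorem isVac_monomial {b : Idx q n} {μ : ℂ} (hv : ρ.IsVac b μ v) {l : List (Idx q n)}
    (hb : b ∉ l) (m : Idx q n → ℤ) : ρ.IsVac b μ (ρ.monomial l m v) := by
  induction l with
  | nil => simpa [monomial] using hv
  | cons a l ih =>
    rw [ρ.monomial_cons_apply]
    exact h.isVac_map (fun h' => hb (by simp [h'])) (zmonomial_eq_pow a _)
      (ih fun h' => hb (by simp [h']))

theorem s_monomial_apply (l : List (Idx q n)) (m : Idx q n → ℤ) (hs : ∃ c : ℂ, h.s 1 v = c • v) :
    ∃ c : ℂ, h.s 1 (ρ.monomial l m v) = c • ρ.monomial l m v := by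
  induction l with
  | nil => simpa [monomial] using hs
  | cons a l ih =>
    rw [ρ.monomial_cons_apply]
    obtain ⟨c', hc'⟩ := h.exists_signCommute_s (zmonomial_eq_pow a (m a))
    obtain ⟨c, hc⟩ := ih
    exact ⟨c' * c, by rw [hc'.apply, hc, map_smul, smul_smul]⟩

theorem tD_monomial_apply (hv : ∀ a, ρ.IsVac a (lam a) v) {l : List (Idx q n)} (hl : l.Nodup)
    {b : Idx q n} (hb : b ∈ l) (m : Idx q n → ℤ) :
    ρ.t b (ρ.D b (ρ.monomial l m v)) = (lam b + m b) • ρ.monomial l m v := by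
  induction l with
  | nil => simp at hb
  | cons a l ih =>
    rw [ρ.monomial_cons_apply]
    rw [List.nodup_cons] at hl
    by_cases hab : a = b
    · subst hab
      exact (h.isWeylPair a).tD_zmonomial (h.isVac_monomial (hv a) hl.1 m) (m a)
    · obtain ⟨c, hc, h1, h2⟩ := h.exists_signCommute hab (zmonomial_eq_pow a (m a))
      rw [h2.apply, map_smul, h1.apply, smul_smul, hc, one_smul,
        ih hl.2 ((List.mem_cons.1 hb).resolve_left (Ne.symm hab)), map_smul]

theorem t_monomial_apply (hv : ∀ a, ρ.IsVac a (lam a) v) {l : List (Idx q n)} (hl : l.Nodup)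
    {b : Idx q n} (hb : b ∈ l) (m : Idx q n → ℤ) :
    ∃ c : ℂ, ρ.t b (ρ.monomial l m v) = c • ρ.monomial l (m + Pi.single b 1) v := by
  induction l with
  | nil => simp at hb
  | cons a l ih =>
    simp only [ρ.monomial_cons_apply]
    rw [List.nodup_cons] at hl
    by_cases hab : a = b
    · subst hab
      have h3 : ∀ b ∈ l, (m + Pi.single a 1 : Idx q n → ℤ) b = m b := fun b hb' => by
        rw [Pi.add_apply, Pi.single_eq_of_ne (by rintro rfl; exact hl.1 hb'), add_zero]
      rw [ρ.monomial_congr h3, Pi.add_apply, Pi.single_eq_same]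
      exact (h.isWeylPair a).t_zmonomial (h.isVac_monomial (hv a) hl.1 m) (m a)
    · obtain ⟨c, hc, h1, h2⟩ := h.exists_signCommute hab (zmonomial_eq_pow a (m a))
      obtain ⟨c', hc'⟩ := ih hl.2 ((List.mem_cons.1 hb).resolve_left (Ne.symm hab))
      refine ⟨c * c', ?_⟩
      rw [h1.apply, hc', map_smul, smul_smul, Pi.add_apply, Pi.single_eq_of_ne hab, add_zero]

theorem D_monomial_apply (hv : ∀ a, ρ.IsVac a (lam a) v) {l : List (Idx q n)} (hl : l.Nodup)
    {b : Idx q n} (hb : b ∈ l) (m : Idx q n → ℤ) :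
    ∃ c : ℂ, ρ.D b (ρ.monomial l m v) = c • ρ.monomial l (m - Pi.single b 1) v := by
  induction l with
  | nil => simp at hb
  | cons a l ih =>
    simp only [ρ.monomial_cons_apply]
    rw [List.nodup_cons] at hl
    by_cases hab : a = b
    · subst hab
      have h3 : ∀ b ∈ l, (m - Pi.single a 1 : Idx q n → ℤ) b = m b := fun b hb' => by
        rw [Pi.sub_apply, Pi.single_eq_of_ne (by rintro rfl; exact hl.1 hb'), sub_zero]
      rw [ρ.monomial_congr h3, Pi.sub_apply, Pi.single_eq_same]
      exact (h.isWeylPair a).D_zmonomial (h.isVac_monomial (hv a) hl.1 m) (m a)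
    · obtain ⟨c, hc, h1, h2⟩ := h.exists_signCommute hab (zmonomial_eq_pow a (m a))
      obtain ⟨c', hc'⟩ := ih hl.2 ((List.mem_cons.1 hb).resolve_left (Ne.symm hab))
      refine ⟨c * c', ?_⟩
      rw [h2.apply, hc', map_smul, smul_smul, Pi.sub_apply, Pi.single_eq_of_ne hab, sub_zero]

theorem mem_of_monomial_mem (hv : ∀ a, ρ.IsVac a (lam a) v) {l : List (Idx q n)} (hl : l.Nodup)
    {Q : Submodule ℂ V} (ht : ∀ a, ∀ w ∈ Q, ρ.t a w ∈ Q) (hD : ∀ a, ∀ w ∈ Q, ρ.D a w ∈ Q)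
    {m : Idx q n → ℤ} (hm : ρ.monomial l m v ∈ Q) (h0 : ρ.monomial l m v ≠ 0) : v ∈ Q := by
  induction l with
  | nil => simpa [monomial] using hm
  | cons a l ih =>
    rw [ρ.monomial_cons_apply] at hm h0
    rw [List.nodup_cons] at hl
    refine ih hl.2 ((h.isWeylPair a).mem_of_zmonomial_mem (h.isVac_monomial (hv a) hl.1 m)
      (ht a) (hD a) hm h0) fun h' => h0 (by rw [h', map_zero])

theorem monomial_apply_ne_zero (hv : ∀ a, ρ.IsVac a (lam a) v) (hv0 : v ≠ 0)
    {l : List (Idx q n)} (hl : l.Nodup) {m : Idx q n → ℤ} (hm0 : ∀ a, lam a = 0 → 0 ≤ m a)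
    (hm1 : ∀ a, lam a = -1 → m a ≤ 0) (hodd : ∀ a, par a = 1 → m a = 0) :
    ρ.monomial l m v ≠ 0 := by
  induction l with
  | nil => simpa [monomial] using hv0
  | cons a l ih =>
    rw [ρ.monomial_cons_apply]
    rw [List.nodup_cons] at hl
    rcases zmod_two_cases (par a) with ha | ha
    · have h1 := h.isWeylPair a
      have h2 := h.isVac_monomial (hv a) hl.1 m
      rw [IsVac] at h2
      rw [ha, ksign_zero_left] at h1 h2
      exact h1.zmonomial_apply_ne_zero h2 (ih hl.2) (hm0 a) (hm1 a)
    · rw [hodd a ha, zmonomial_zero]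
      exact ih hl.2

end Monomials

end IsModule

end AkAction

end Vacuum

/-! ### The simple module over the Weyl superalgebra generated by a vacuum vector -/

section VacuumModule

variable {q n : ℕ} {𝔨 : Type*} [LieRing 𝔨] [LieAlgebra ℂ 𝔨] {V : Type*} [AddCommGroup V]
  [Module ℂ V]

namespace AkAction

variable (ρ : AkAction q n 𝔨 V)

/-- The operator `E_a`, the difference of `t_a ∂_a` as a vector field and as a differential
operator. -/
def E (a : Idx q n) : Module.End ℂ V := ρ.delta a (ρ.vf a) 1

theorem actW_euler (i : Fin q) :
    ρ.actW 0 (W.euler i) = ρ.t (.inl i) * ρ.D (.inl i) + ρ.E (.inl i) := by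
  have h1 : ∀ k, (W.euler i : W q n 0).1 (A.gen k) =
      if (.inl i : Idx q n) = k then A.gen (.inl i) else 0 := by
    intro k
    change A.gen (.inl i) * A.der (.inl i) (A.gen k) = _
    rw [A.der_gen]
    split_ifs <;> simp
  rw [ρ.actW_eq_sum_vf]
  simp only [h1, apply_ite (ρ.vf _), map_zero, Finset.sum_ite_eq, Finset.mem_univ, if_true]
  rw [E, delta_apply, one_mul, map_one, add_comm, ← D, sub_add_cancel]

/-- The submodule over the Weyl superalgebra generated by a vacuum vector. -/
def vacModule (v : V) : Submodule ℂ V :=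
  Submodule.span ℂ (Set.range fun m => ρ.monomial Finset.univ.toList m v)

theorem monomial_mem_vacModule (v : V) (m : Idx q n → ℤ) :
    ρ.monomial Finset.univ.toList m v ∈ ρ.vacModule v :=
  Submodule.subset_span ⟨m, rfl⟩

theorem self_mem_vacModule (v : V) : v ∈ ρ.vacModule v := by
  simpa [monomial_zero] using ρ.monomial_mem_vacModule v 0

/-- The operators `t_a ∂_a` of the Weyl superalgebra. -/
def tD (a : Idx q n) : Module.End ℂ V := ρ.t a * ρ.D a

namespace IsModule

variable {ρ} (h : ρ.IsModule)

theorem isConst_E (a : Idx q n) : h.IsConst (ρ.E a) 0 := by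
  simpa [E, zmod_two_add_self] using h.isConst_deltas_vf a (l := [a]) (by simp)

theorem IsConst.commute_tD {h : ρ.IsModule} {T : Module.End ℂ V} {d : ZMod 2} (hT : h.IsConst T d)
    (a : Idx q n) : T * ρ.tD a = ρ.tD a * T := by
  rw [tD, ← mul_assoc, hT.mul_t, smul_mul_assoc, mul_assoc, hT.mul_D, mul_smul_comm, smul_smul,
    ksign_mul_self, one_smul, mul_assoc]

include h

theorem tD_mul_tD (a b : Idx q n) : ρ.tD a * ρ.tD b = ρ.tD b * ρ.tD a := by
  by_cases hab : a = b
  · rw [hab]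
  obtain ⟨c, hc, h1, h2⟩ := h.exists_signCommute hab (r := ρ.t a) ⟨1, Or.inl (by simp)⟩
  obtain ⟨c', hc', h1', h2'⟩ := h.exists_signCommute hab (r := ρ.D a) ⟨1, Or.inr (by simp)⟩
  have key : ∀ {r : Module.End ℂ V} {c : ℂ}, c * c = 1 → SignCommute r (ρ.t b) c →
      SignCommute r (ρ.D b) c → ρ.tD b * r = r * ρ.tD b := by
    intro r c hc h1 h2
    rw [SignCommute] at h1 h2
    rw [tD, mul_assoc, h2, mul_smul_comm, ← mul_assoc, h1, smul_mul_assoc, smul_smul, hc, one_smul,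
      mul_assoc]
  rw [tD, mul_assoc, ← key hc' h1' h2', ← mul_assoc, ← key hc h1 h2, mul_assoc]

theorem s_mul_tD (a : Idx q n) : h.s 1 * ρ.tD a = ρ.tD a * h.s 1 := by
  rw [tD, ← mul_assoc, h.s_mul_t, smul_mul_assoc, mul_assoc, h.s_mul_D, mul_smul_comm, smul_smul,
    ksign_mul_self, one_smul, mul_assoc]

theorem isConst_actK_one (x : 𝔨) : h.IsConst (ρ.actK x 1) 0 := (h.isCovariant_actK x).isConst

/-- The Cartan operators are `t_i ∂_i` plus constant operators, so they commute with every `t_a ∂_a`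
in the Weyl superalgebra and with parity. A weight space is finite-dimensional by boundedness, so
these commuting operators have a common eigenvector in it. -/
theorem exists_vac [Nontrivial V] {𝔥 : LieSubalgebra ℂ 𝔨} (hb : ρ.IsBounded 𝔥) :
    ∃ (v : V) (lam : Idx q n → ℂ), v ≠ 0 ∧ (∃ c : ℂ, h.s 1 v = c • v) ∧
      ∀ a, ρ.IsVac a (lam a) v := by
  obtain ⟨hw, c, hc⟩ := hb
  set H : Fin q ⊕ 𝔥 → Module.End ℂ V :=
    Sum.elim (fun i : Fin q => ρ.actW 0 (W.euler i)) (fun h : 𝔥 => ρ.actK h 1) with hH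
  obtain ⟨χ, hχ⟩ : ∃ χ, wtSpace H χ ≠ ⊥ := by
    by_contra! hcon
    have : ⨆ χ, wtSpace H χ = ⊤ := hw
    simp [hcon] at this
  have hfin : FiniteDimensional ℂ (wtSpace H χ) :=
    Module.rank_lt_aleph0_iff.1 ((hc χ).trans_lt (Cardinal.natCast_lt_aleph0))
  have hcomm : ∀ T : Module.End ℂ V, (∀ i, H i * T = T * H i) →
      ∀ v ∈ wtSpace H χ, T v ∈ wtSpace H χ := by
    intro T hT v hv
    rw [mem_wtSpace] at hv ⊢
    intro i
    rw [← Module.End.mul_apply, hT, Module.End.mul_apply, hv, map_smul]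
  have hHtD : ∀ i a, H i * ρ.tD a = ρ.tD a * H i := by
    rintro (i | x) a
    · change ρ.actW 0 (W.euler i) * _ = _ * ρ.actW 0 (W.euler i)
      rw [ρ.actW_euler, add_mul, mul_add, (h.isConst_E _).commute_tD]
      congr 1
      exact h.tD_mul_tD _ _
    · exact (h.isConst_actK_one _).commute_tD a
  have hHs : ∀ i, H i * h.s 1 = h.s 1 * H i := by
    rintro (i | x)
    · change ρ.actW 0 (W.euler i) * _ = _ * ρ.actW 0 (W.euler i)
      rw [signOp_mul_of_isHomogeneous h.isCompl 1 (h.actW_homogeneous 0 _)]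
      simp
    · change ρ.actK _ 1 * _ = _ * ρ.actK _ 1
      rw [(h.isConst_actK_one _).s_mul]
      simp
  obtain ⟨v, -, hv0, hv⟩ := exists_mem_forall_apply_eq_smul
    (h.s 1 :: (Finset.univ.toList.map ρ.tD)) (by
      simp only [List.mem_cons, List.mem_map, Finset.mem_toList, Finset.mem_univ, true_and]
      rintro _ (rfl | ⟨a, rfl⟩) _ (rfl | ⟨b, rfl⟩)
      · rfl
      · exact h.s_mul_tD b
      · exact (h.s_mul_tD a).symm
      · exact h.tD_mul_tD a b) (wtSpace H χ) hχ (by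
      simp only [List.mem_cons, List.mem_map, Finset.mem_toList, Finset.mem_univ, true_and]
      rintro _ (rfl | ⟨a, rfl⟩)
      · exact hcomm _ hHs
      · exact hcomm _ fun i => hHtD i a)
  obtain ⟨w, hw0, hws, -, hwv⟩ := h.exists_isVac Finset.univ.toList hv0 (hv _ (by simp))
    (fun a => hv (ρ.tD a) (by simp))
  choose lam hlam using fun a => hwv a (by simp)
  exact ⟨w, lam, hw0, hws, hlam⟩

section

variable {v : V} {lam : Idx q n → ℂ} (hv : ∀ a, ρ.IsVac a (lam a) v)

include hv

omit h hv in
theorem vacModule_le {Q : Submodule ℂ V} (ht : ∀ a, ∀ w ∈ Q, ρ.t a w ∈ Q)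
    (hD : ∀ a, ∀ w ∈ Q, ρ.D a w ∈ Q) (hvQ : v ∈ Q) : ρ.vacModule v ≤ Q := by
  have hpow : ∀ T : Module.End ℂ V, (∀ w ∈ Q, T w ∈ Q) → ∀ k : ℕ, ∀ w ∈ Q, (T ^ k) w ∈ Q := by
    intro T hT k
    induction k with
    | zero => simp
    | succ k ih => intro w hw; rw [pow_succ, Module.End.mul_apply]; exact ih _ (hT _ hw)
  rw [vacModule, Submodule.span_le]
  rintro _ ⟨m, rfl⟩
  change ρ.monomial _ m v ∈ Q
  induction (Finset.univ : Finset (Idx q n)).toList with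
  | nil => simpa [monomial] using hvQ
  | cons a l ih =>
    rw [ρ.monomial_cons_apply]
    obtain ⟨k, hk | hk⟩ := zmonomial_eq_pow (ρ := ρ) a (m a)
    · rw [hk]; exact hpow _ (ht a) k _ ih
    · rw [hk]; exact hpow _ (hD a) k _ ih

theorem t_mem_vacModule (a : Idx q n) : ∀ w ∈ ρ.vacModule v, ρ.t a w ∈ ρ.vacModule v := by
  intro w hw
  refine (Submodule.span_le (p := (ρ.vacModule v).comap (ρ.t a))).2 ?_ hw
  rintro _ ⟨m, rfl⟩
  obtain ⟨c, hc⟩ := h.t_monomial_apply hv Finset.univ.nodup_toList (b := a) (by simp) m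
  rw [SetLike.mem_coe, Submodule.mem_comap]
  simp only [hc]
  exact Submodule.smul_mem _ _ (ρ.monomial_mem_vacModule v _)

theorem D_mem_vacModule (a : Idx q n) : ∀ w ∈ ρ.vacModule v, ρ.D a w ∈ ρ.vacModule v := by
  intro w hw
  refine (Submodule.span_le (p := (ρ.vacModule v).comap (ρ.D a))).2 ?_ hw
  rintro _ ⟨m, rfl⟩
  obtain ⟨c, hc⟩ := h.D_monomial_apply hv Finset.univ.nodup_toList (b := a) (by simp) m
  rw [SetLike.mem_coe, Submodule.mem_comap]
  simp only [hc]
  exact Submodule.smul_mem _ _ (ρ.monomial_mem_vacModule v _)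

omit hv in
theorem s_mem_vacModule (hs : ∃ c : ℂ, h.s 1 v = c • v) :
    ∀ w ∈ ρ.vacModule v, h.s 1 w ∈ ρ.vacModule v := by
  intro w hw
  refine (Submodule.span_le (p := (ρ.vacModule v).comap (h.s 1))).2 ?_ hw
  rintro _ ⟨m, rfl⟩
  obtain ⟨c, hc⟩ := h.s_monomial_apply Finset.univ.toList m hs
  rw [SetLike.mem_coe, Submodule.mem_comap]
  simp only [hc]
  exact Submodule.smul_mem _ _ (ρ.monomial_mem_vacModule v _)

theorem monomial_mem_wtSpace (m : Idx q n → ℤ) :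
    ρ.monomial Finset.univ.toList m v ∈ wtSpace ρ.tD (fun a => lam a + m a) :=
  mem_wtSpace.2 fun a => h.tD_monomial_apply hv Finset.univ.nodup_toList (by simp) m

omit h hv in
theorem wt_injective (lam : Idx q n → ℂ) :
    Function.Injective fun (m : Idx q n → ℤ) (a : Idx q n) => lam a + (m a : ℂ) := by
  intro m m' hm
  funext a
  exact_mod_cast add_left_cancel (congrFun hm a)

omit h hv in
theorem exists_eq_sum_monomial {w : V} (hw : w ∈ ρ.vacModule v) :
    ∃ f : (Idx q n → ℤ) →₀ ℂ, w = ∑ m ∈ f.support, f m • ρ.monomial Finset.univ.toList m v := by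
  obtain ⟨f, hf⟩ := (Finsupp.mem_span_range_iff_exists_finsupp).1 hw
  exact ⟨f, hf.symm⟩

/-- The module generated by a vacuum vector is simple, even without grading. -/
theorem eq_bot_or_vacModule_le {Q : Submodule ℂ V} (hQ : Q ≤ ρ.vacModule v)
    (ht : ∀ a, ∀ w ∈ Q, ρ.t a w ∈ Q) (hD : ∀ a, ∀ w ∈ Q, ρ.D a w ∈ Q) :
    Q = ⊥ ∨ ρ.vacModule v ≤ Q := by
  by_cases h0 : Q = ⊥
  · exact Or.inl h0
  right
  obtain ⟨w, hw, hw0⟩ := (Submodule.ne_bot_iff Q).1 h0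
  obtain ⟨f, rfl⟩ := exists_eq_sum_monomial (hQ hw)
  have h1 := mem_of_sum_mem_of_mem_wtSpace (h := ρ.tD) (Q := Q)
    (fun a w hw => ht a _ (hD a _ hw)) (wt_injective lam) f.support _
    (fun m _ => Submodule.smul_mem _ (f m) (h.monomial_mem_wtSpace hv m)) hw
  obtain ⟨m, hm, hm0⟩ := Finset.exists_ne_zero_of_sum_ne_zero hw0
  have h2 := h1 m hm
  have h3 : ρ.monomial Finset.univ.toList m v ∈ Q :=
    (Submodule.smul_mem_iff _ (Finsupp.mem_support_iff.1 hm)).1 h2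
  exact vacModule_le ht hD (h.mem_of_monomial_mem hv Finset.univ.nodup_toList ht hD h3
    fun h' => hm0 (by rw [h', smul_zero]))

/-- Distinct monomials have distinct weights, so the weight space of the vacuum vector is a line.
This yields Schur's property although the module may be infinite-dimensional. -/
theorem exists_eq_smul_of_mem_wtSpace {w : V} (hw : w ∈ ρ.vacModule v) 
    (hwt : w ∈ wtSpace ρ.tD lam) :
    ∃ c : ℂ, w = c • v := by
  classical
  obtain ⟨f, hf⟩ := exists_eq_sum_monomial hw
  refine ⟨f 0, ?_⟩
  have h1 := eq_zero_of_sum_eq_zero_of_mem_wtSpace (h := ρ.tD) (wt_injective lam)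
    (insert 0 f.support)
    (fun m => f m • ρ.monomial Finset.univ.toList m v - if m = 0 then w else 0)
    (fun m _ => Submodule.sub_mem _
      (Submodule.smul_mem _ (f m) (h.monomial_mem_wtSpace hv m)) (by
        split_ifs with hm
        · subst hm; simpa using hwt
        · exact Submodule.zero_mem _)) (by
      rw [Finset.sum_sub_distrib, Finset.sum_ite_eq' _ _ fun _ => w, if_pos (by simp)]
      rw [sub_eq_zero]
      rw [hf]
      refine (Finset.sum_subset (Finset.subset_insert _ _) fun m _ hm => ?_).symm
      rw [Finsupp.notMem_support_iff.1 hm, zero_smul]) 0 (by simp)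
  rw [if_pos rfl, ρ.monomial_zero, sub_eq_zero] at h1
  exact h1.symm

end

end IsModule

end AkAction

end VacuumModule

/-! ### Splitting off the module over the Weyl superalgebra -/

section Splitting

variable {q n : ℕ} {𝔨 : Type*} [LieRing 𝔨] [LieAlgebra ℂ 𝔨] {V : Type*} [AddCommGroup V]
  [Module ℂ V]

namespace AkAction

variable {ρ : AkAction q n 𝔨 V}

/-- By the Taylor expansion, invariance under the variables, the derivatives and the constant
operators is invariance under the whole action. Every application of the simplicity of `V` uses this
form. -/
theorem IsSimple.eq_bot_or_eq_top (hs : ρ.IsSimple) (h : ρ.IsModule) {Q : Submodule ℂ V}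
    (hsQ : ∀ v ∈ Q, h.s 1 v ∈ Q) (ht : ∀ a, ∀ v ∈ Q, ρ.t a v ∈ Q)
    (hD : ∀ a, ∀ v ∈ Q, ρ.D a v ∈ Q) (hK : ∀ x l, ∀ v ∈ Q, ρ.deltas l (ρ.actK x) 1 v ∈ Q)
    (hW : ∀ i l, l ≠ [] → ∀ v ∈ Q, ρ.deltas l (ρ.vf i) 1 v ∈ Q) : Q = ⊥ ∨ Q = ⊤ := by
  refine hs.2 Q ((isGraded_iff_signOp h.isCompl).2 hsQ) ?_
  have hW' : ∀ i f, ∀ v ∈ Q, ρ.vf i f v ∈ Q := fun i f =>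
    ρ.forall_apply_mem_of_deltas ht (fun l => by
      rcases eq_or_ne l [] with rfl | hl
      · exact hD i
      · exact hW i l hl) f
  rintro T ((⟨f, rfl⟩ | hT) | hT)
  · intro v hv
    induction f using A.induction_mul_gen generalizing v with
    | one => rwa [h.actA_one]
    | add x y hx hy => rw [map_add]; exact add_mem (hx v hv) (hy v hv)
    | smul c x hx => rw [map_smul]; exact Submodule.smul_mem _ _ (hx v hv)
    | mul_gen x j hx => rw [h.actA_mul]; exact hx _ (ht j v hv)
  · obtain ⟨d, X, rfl⟩ := Set.mem_iUnion.1 hT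
    intro v hv
    rw [ρ.actW_eq_sum_vf, LinearMap.sum_apply]
    exact Submodule.sum_mem _ fun i _ => hW' i _ v hv
  · obtain ⟨x, f, rfl⟩ := Set.mem_iUnion.1 hT
    exact ρ.forall_apply_mem_of_deltas ht (hK x) f

/-- A homogeneous vector that is a vacuum vector for all variables. -/
structure Vac (h : ρ.IsModule) where
  v : V
  lam : Idx q n → ℂ
  deg : ZMod 2
  ne_zero : v ≠ 0
  mem : v ∈ ρ.part deg
  isVac : ∀ a, ρ.IsVac a (lam a) v

theorem IsModule.nonempty_vac (h : ρ.IsModule) [Nontrivial V] {𝔥 : LieSubalgebra ℂ 𝔨}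
    (hb : ρ.IsBounded 𝔥) : Nonempty (Vac h) := by
  obtain ⟨v, lam, hv0, ⟨c, hc⟩, hv⟩ := h.exists_vac hb
  have h1 : h.s 1 (h.s 1 v) = v := by
    rw [← Module.End.mul_apply, signOp_mul_signOp, zmod_two_add_self, signOp_zero]; rfl
  rw [hc, map_smul, hc, smul_smul] at h1
  have h2 : c * c = 1 := by
    have := smul_left_injective ℂ hv0 (show (c * c) • v = (1 : ℂ) • v by rw [h1, one_smul])
    exact this
  rcases mul_self_eq_one_iff.1 h2 with rfl | rfl
  · exact ⟨⟨v, lam, 0, hv0, (mem_part_iff_signOp h.isCompl).2 (by rw [hc]; simp), hv⟩⟩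
  · exact ⟨⟨v, lam, 1, hv0, (mem_part_iff_signOp h.isCompl).2 (by rw [hc, ksign_one_one]), hv⟩⟩

namespace Vac

variable {h : ρ.IsModule} (w : Vac h)

theorem s_apply (d : ZMod 2) : h.s d w.v = ksign d w.deg • w.v := signOp_of_mem h.isCompl d w.mem

/-- The simple module over the Weyl superalgebra. -/
abbrev P : Submodule ℂ V := ρ.vacModule w.v

theorem t_mem (a : Idx q n) : ∀ p ∈ w.P, ρ.t a p ∈ w.P := h.t_mem_vacModule w.isVac a

theorem D_mem (a : Idx q n) : ∀ p ∈ w.P, ρ.D a p ∈ w.P := h.D_mem_vacModule w.isVac a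

theorem s_mem (d : ZMod 2) : ∀ p ∈ w.P, h.s d p ∈ w.P := by
  rcases zmod_two_cases d with rfl | rfl
  · rw [IsModule.s, signOp_zero]; exact fun p hp => hp
  · exact h.s_mem_vacModule ⟨_, w.s_apply 1⟩

/-- The vacuum vector as an element of the module it generates. -/
def vP : w.P := ⟨w.v, ρ.self_mem_vacModule w.v⟩

/-- The variables and the derivatives as operators on `w.P`. -/
def gP : Idx q n ⊕ Idx q n → Module.End ℂ w.P :=
  Sum.elim (fun a => (ρ.t a).restrict (w.t_mem a)) (fun a => (ρ.D a).restrict (w.D_mem a))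

/-- The grading of `w.P`, in which the vacuum vector is even. -/
def part (d : ZMod 2) : Submodule ℂ w.P := (ρ.part (d + w.deg)).comap w.P.subtype

theorem mem_part {d : ZMod 2} {p : w.P} : p ∈ w.part d ↔ (p : V) ∈ ρ.part (d + w.deg) := Iff.rfl

theorem isCompl : IsCompl (w.part 0) (w.part 1) := by
  have hc : ∀ d : ZMod 2, IsCompl (ρ.part d) (ρ.part (1 + d)) := by
    intro d
    rcases zmod_two_cases d with rfl | rfl
    · exact h.isCompl
    · exact h.isCompl.symm
  constructor
  · rw [Submodule.disjoint_def]
    intro p hp hp'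
    rw [mem_part] at hp hp'
    rw [zero_add] at hp
    exact Subtype.ext ((Submodule.disjoint_def.1 (hc w.deg).disjoint) _ hp hp')
  · have key : ∀ p : w.P, ∀ d : ZMod 2, ∃ b ∈ w.part d, ∃ c ∈ w.part (1 + d), p = b + c := by
      intro p d
      have h2 : ∀ e : ZMod 2, (2⁻¹ : ℂ) • ((p : V) + ksign 1 e • h.s 1 p) ∈ ρ.part e := by
        intro e
        rw [mem_part_iff_signOp h.isCompl, map_smul, map_add, map_smul, ← Module.End.mul_apply,
          signOp_mul_signOp, zmod_two_add_self, signOp_zero, Module.End.one_apply,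
          smul_comm (ksign 1 e) (2⁻¹ : ℂ), smul_add (ksign 1 e), smul_smul, ksign_mul_self,
          one_smul,
          add_comm]
      have h3 : ∀ e : ZMod 2, (2⁻¹ : ℂ) • ((p : V) + ksign 1 e • h.s 1 p) ∈ w.P := fun e =>
        Submodule.smul_mem _ _ (add_mem p.2 (Submodule.smul_mem _ _ (w.s_mem 1 _ p.2)))
      refine ⟨⟨_, h3 (d + w.deg)⟩, h2 _, ⟨_, h3 (1 + d + w.deg)⟩, h2 _, Subtype.ext ?_⟩
      change (p : V) = (2⁻¹ : ℂ) • ((p : V) + ksign 1 (d + w.deg) • h.s 1 p) +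
        (2⁻¹ : ℂ) • ((p : V) + ksign 1 (1 + d + w.deg) • h.s 1 p)
      rw [add_assoc 1, ksign_add_right 1 1, ksign_one_one]
      module
    rw [codisjoint_iff, eq_top_iff]
    intro p _
    obtain ⟨b, hb, c, hc, rfl⟩ := key p 0
    exact Submodule.add_mem_sup hb hc

/-- The parity operators of `w.P`. -/
abbrev tau (d : ZMod 2) : Module.End ℂ w.P := signOp w.isCompl d

theorem coe_tau (d : ZMod 2) (p : w.P) : (w.tau d p : V) = ksign d w.deg • h.s d p := by
  have : w.P.subtype ∘ₗ w.tau d = ksign d w.deg • (h.s d ∘ₗ w.P.subtype) :=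
    end_ext_of_isCompl w.isCompl fun e p hp => by
      rw [LinearMap.comp_apply, signOp_of_mem w.isCompl d hp, map_smul, LinearMap.smul_apply,
        LinearMap.comp_apply]
      change ksign d e • (p : V) = ksign d w.deg • h.s d (p : V)
      rw [signOp_of_mem h.isCompl d (w.mem_part.1 hp), smul_smul,
        ksign_add_right, mul_comm (ksign d e), ← mul_assoc, ksign_mul_self, one_mul]
  exact congrArg (fun f => f p) this

theorem tau_tau (d : ZMod 2) (p : w.P) : w.tau d (w.tau d p) = p := by
  rw [← Module.End.mul_apply, signOp_mul_signOp, zmod_two_add_self, signOp_zero]; rfl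

theorem tau_gP_inl (d : ZMod 2) (a : Idx q n) (p : w.P) :
    w.tau d (w.gP (.inl a) p) = ksign d (par a) • w.gP (.inl a) (w.tau d p) := by
  refine Subtype.ext ?_
  rw [coe_tau, Submodule.coe_smul]
  change _ • h.s d (ρ.t a p) = _ • ρ.t a (w.tau d p)
  rw [coe_tau, map_smul, ← Module.End.mul_apply, h.s_mul_t, LinearMap.smul_apply, smul_comm]
  rfl

theorem tau_gP_inr (d : ZMod 2) (a : Idx q n) (p : w.P) :
    w.tau d (w.gP (.inr a) p) = ksign d (par a) • w.gP (.inr a) (w.tau d p) := by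
  refine Subtype.ext ?_
  rw [coe_tau, Submodule.coe_smul]
  change _ • h.s d (ρ.D a p) = _ • ρ.D a (w.tau d p)
  rw [coe_tau, map_smul, ← Module.End.mul_apply, h.s_mul_D, LinearMap.smul_apply, smul_comm]
  rfl

theorem P_simple (Q : Submodule ℂ w.P) (hQ : ∀ i, ∀ p ∈ Q, w.gP i p ∈ Q) : Q = ⊥ ∨ Q = ⊤ := by
  have hinj := Submodule.map_injective_of_injective w.P.injective_subtype
  rcases h.eq_bot_or_vacModule_le w.isVac (Q := Q.map w.P.subtype) (Submodule.map_subtype_le _ _)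
    (by rintro a _ ⟨p, hp, rfl⟩; exact ⟨_, hQ (.inl a) p hp, rfl⟩)
    (by rintro a _ ⟨p, hp, rfl⟩; exact ⟨_, hQ (.inr a) p hp, rfl⟩) with h1 | h1
  · left; exact hinj (by rw [h1, Submodule.map_bot])
  · right
    rw [eq_top_iff]
    rintro p -
    obtain ⟨p', hp', h2⟩ := h1 p.2
    rwa [← Subtype.ext h2]

theorem eq_top_of_vP_mem {Q : Submodule ℂ w.P} (hQ : ∀ i, ∀ p ∈ Q, w.gP i p ∈ Q)
    (hv : w.vP ∈ Q) : Q = ⊤ := by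
  refine (w.P_simple Q hQ).resolve_left ?_
  rintro rfl
  exact w.ne_zero (congrArg Subtype.val ((Submodule.mem_bot _).1 hv))

/-- The space of homomorphisms of modules over the Weyl superalgebra from `w.P`. -/
def N : Submodule ℂ (w.P →ₗ[ℂ] V) := intertwiners w.gP (Sum.elim ρ.t ρ.D)

/-- An endomorphism preserves the weight of the vacuum vector, hence maps it to a multiple of
itself, and the vacuum vector generates. -/
theorem P_schur (ψ : Module.End ℂ w.P) (hψ : ∀ i p, ψ (w.gP i p) = w.gP i (ψ p)) :
    ∃ c : ℂ, ∀ p, ψ p = c • p := by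
  obtain ⟨c, hc⟩ := h.exists_eq_smul_of_mem_wtSpace w.isVac (ψ w.vP).2 (mem_wtSpace.2 fun a => by
    have h1 : w.gP (.inl a) (w.gP (.inr a) w.vP) = w.lam a • w.vP :=
      Subtype.ext (w.isVac a).tD_apply
    have h2 := congrArg Subtype.val (congrArg ψ h1)
    rw [hψ, hψ, map_smul] at h2
    exact h2)
  refine ⟨c, fun p => ?_⟩
  have h1 : LinearMap.ker (ψ - c • LinearMap.id) = ⊤ := by
    refine w.eq_top_of_vP_mem ?_ ?_
    · intro i p hp
      rw [LinearMap.mem_ker, LinearMap.sub_apply, sub_eq_zero, LinearMap.smul_apply,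
        LinearMap.id_apply] at hp ⊢
      rw [hψ, hp, map_smul]
    · rw [LinearMap.mem_ker, LinearMap.sub_apply, sub_eq_zero]
      exact Subtype.ext hc
  have h2 : p ∈ LinearMap.ker (ψ - c • LinearMap.id) := h1 ▸ Submodule.mem_top
  rw [LinearMap.mem_ker, LinearMap.sub_apply, sub_eq_zero] at h2
  exact h2

/-- The operator `φ ↦ T φ` twisted by the sign `(-1)^(d |u|)` on the argument `u` of `φ`. -/
def hat (d : ZMod 2) (T : Module.End ℂ V) : Module.End ℂ (w.P →ₗ[ℂ] V) where
  toFun φ := T ∘ₗ φ ∘ₗ w.tau d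
  map_add' φ ψ := by ext p; simp
  map_smul' c φ := by ext p; simp

theorem hat_apply (d : ZMod 2) (T : Module.End ℂ V) (φ : w.P →ₗ[ℂ] V) (p : w.P) :
    w.hat d T φ p = T (φ (w.tau d p)) := rfl

theorem hat_zero_apply (T : Module.End ℂ V) (φ : w.P →ₗ[ℂ] V) (p : w.P) :
    w.hat 0 T φ p = T (φ p) := by
  rw [hat_apply, tau, signOp_zero, Module.End.one_apply]

theorem apply_apply (d : ZMod 2) (T : Module.End ℂ V) (φ : w.P →ₗ[ℂ] V) (p : w.P) :
    T (φ p) = w.hat d T φ (w.tau d p) := by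
  rw [hat_apply, tau_tau]

theorem hat_mul_hat (d e : ZMod 2) (T T' : Module.End ℂ V) :
    w.hat d T * w.hat e T' = w.hat (d + e) (T * T') := by
  refine LinearMap.ext fun φ => LinearMap.ext fun p => ?_
  rw [Module.End.mul_apply, hat_apply, hat_apply, hat_apply, Module.End.mul_apply,
    ← Module.End.mul_apply (w.tau e), signOp_mul_signOp, add_comm]

theorem hat_add (d : ZMod 2) (T T' : Module.End ℂ V) :
    w.hat d (T + T') = w.hat d T + w.hat d T' := rfl

theorem hat_smul (d : ZMod 2) (c : ℂ) (T : Module.End ℂ V) : w.hat d (c • T) = c • w.hat d T := rfl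

theorem hat_zero_one : w.hat 0 1 = 1 :=
  LinearMap.ext fun φ => LinearMap.ext fun p => by rw [hat_zero_apply]; rfl

/-- The sign twist in `w.hat` turns supercommutation with the Weyl superalgebra into honest
commutation, so composition preserves intertwiners. -/
theorem hat_mem {d : ZMod 2} {T : Module.End ℂ V}
    (hD : ∀ k, T * ρ.D k = ksign (par k) d • (ρ.D k * T))
    (ht : ∀ k, T * ρ.t k = ksign (par k) d • (ρ.t k * T)) {φ : w.P →ₗ[ℂ] V} (hφ : φ ∈ w.N) :
    w.hat d T φ ∈ w.N := by
  rintro (a | a) p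
  · have h1 : φ (w.gP (.inl a) (w.tau d p)) = ρ.t a (φ (w.tau d p)) := hφ (.inl a) _
    have h2 : T (ρ.t a (φ (w.tau d p))) = ksign (par a) d • ρ.t a (T (φ (w.tau d p))) :=
      congrArg (fun S : Module.End ℂ V => S _) (ht a)
    rw [hat_apply, tau_gP_inl, map_smul, h1, map_smul, h2, smul_smul, ksign_comm, ksign_mul_self,
      one_smul]
    rfl
  · have h1 : φ (w.gP (.inr a) (w.tau d p)) = ρ.D a (φ (w.tau d p)) := hφ (.inr a) _
    have h2 : T (ρ.D a (φ (w.tau d p))) = ksign (par a) d • ρ.D a (T (φ (w.tau d p))) :=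
      congrArg (fun S : Module.End ℂ V => S _) (hD a)
    rw [hat_apply, tau_gP_inr, map_smul, h1, map_smul, h2, smul_smul, ksign_comm, ksign_mul_self,
      one_smul]
    rfl

theorem hat_const_mem {d : ZMod 2} {T : Module.End ℂ V} (hT : h.IsConst T d) {φ : w.P →ₗ[ℂ] V}
    (hφ : φ ∈ w.N) : w.hat d T φ ∈ w.N := w.hat_mem hT.mul_D hT.mul_t hφ

/-- The parity operators of `w.N`. -/
theorem hat_s_mem (d : ZMod 2) {φ : w.P →ₗ[ℂ] V} (hφ : φ ∈ w.N) : w.hat d (h.s d) φ ∈ w.N :=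
  w.hat_mem (fun k => by rw [h.s_mul_D, ksign_comm]) (fun k => by rw [h.s_mul_t, ksign_comm]) hφ

/-- The evaluation map `P ⊗ N → V`. -/
def ev : w.P ⊗[ℂ] w.N →ₗ[ℂ] V := evalIntertwiners w.gP (Sum.elim ρ.t ρ.D)

theorem ev_tmul (p : w.P) (φ : w.N) : w.ev (p ⊗ₜ φ) = φ.1 p := rfl

theorem ev_injective : Function.Injective w.ev := evalIntertwiners_injective w.P_simple w.P_schur

/-- The inclusion of `w.P` into `V`. -/
theorem subtype_mem : w.P.subtype ∈ w.N := by
  rintro (a | a) p <;> rfl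

/-- The sum of the images is invariant under the Weyl superalgebra because the elements of `N'` are
intertwiners, and under the constant operators by the hypotheses on `N'`; so it is a nonzero
submodule of `V`. -/
theorem eq_top_of_forall_apply_mem (hs : ρ.IsSimple) {N' : Submodule ℂ (w.P →ₗ[ℂ] V)}
    (hN : N' ≤ w.N) (h0 : N' ≠ ⊥)
    (hs' : ∀ φ ∈ N', w.hat 1 (h.s 1) φ ∈ N')
    (hK : ∀ x l, ∀ φ ∈ N', w.hat (listPar l) (ρ.deltas l (ρ.actK x) 1) φ ∈ N')
    (hW : ∀ i l, l ≠ [] → ∀ φ ∈ N', w.hat (par i + listPar l) (ρ.deltas l (ρ.vf i) 1) φ ∈ N') :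
    ⨆ φ ∈ N', LinearMap.range φ = ⊤ := by
  set Q : Submodule ℂ V := ⨆ φ ∈ N', LinearMap.range φ with hQ
  have hmem : ∀ φ ∈ N', ∀ p, φ p ∈ Q := fun φ hφ p =>
    (le_iSup₂ (f := fun φ (_ : φ ∈ N') => LinearMap.range φ) φ hφ) ⟨p, rfl⟩
  have hstab : ∀ T : Module.End ℂ V, (∀ φ ∈ N', ∀ p, T (φ p) ∈ Q) → ∀ v ∈ Q, T v ∈ Q := by
    intro T hT
    have : Q ≤ Q.comap T := iSup₂_le fun φ hφ => by
      rintro _ ⟨p, rfl⟩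
      exact hT φ hφ p
    exact this
  have hhat : ∀ d T, (∀ φ ∈ N', w.hat d T φ ∈ N') → ∀ v ∈ Q, T v ∈ Q := by
    intro d T hT
    refine hstab T fun φ hφ p => ?_
    rw [w.apply_apply d]
    exact hmem _ (hT φ hφ) _
  refine (hs.eq_bot_or_eq_top h (hhat 1 _ hs') ?_ ?_ (fun x l => hhat _ _ (hK x l))
    (fun i l hl => hhat _ _ (hW i l hl))).resolve_left ?_
  · refine fun a => hstab _ fun φ hφ p => ?_
    have : φ (w.gP (.inl a) p) = ρ.t a (φ p) := hN hφ (.inl a) p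
    rw [← this]; exact hmem φ hφ _
  · refine fun a => hstab _ fun φ hφ p => ?_
    have : φ (w.gP (.inr a) p) = ρ.D a (φ p) := hN hφ (.inr a) p
    rw [← this]; exact hmem φ hφ _
  · intro hbot
    obtain ⟨φ, hφ, hφ0⟩ := (Submodule.ne_bot_iff N').1 h0
    refine hφ0 (LinearMap.ext fun p => ?_)
    have := hmem φ hφ p
    rwa [hbot, Submodule.mem_bot] at this

theorem N_ne_bot : w.N ≠ ⊥ := (Submodule.ne_bot_iff _).2 ⟨_, w.subtype_mem, fun h0 =>
  w.ne_zero (congrArg (fun f : w.P →ₗ[ℂ] V => f w.vP) h0)⟩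

theorem ev_bijective (hs : ρ.IsSimple) : Function.Bijective w.ev := by
  refine ⟨w.ev_injective, ?_⟩
  rw [← LinearMap.range_eq_top, eq_top_iff, ← w.eq_top_of_forall_apply_mem hs le_rfl w.N_ne_bot
    (fun φ => w.hat_s_mem 1) (fun x l φ => w.hat_const_mem (h.isConst_deltas_actK x l))
    (fun i l hl φ => w.hat_const_mem (h.isConst_deltas_vf i hl))]
  refine iSup₂_le fun φ hφ => ?_
  rintro _ ⟨p, rfl⟩
  exact ⟨p ⊗ₜ ⟨φ, hφ⟩, rfl⟩

theorem exists_dual : ∃ f : w.P →ₗ[ℂ] ℂ, f w.vP = 1 := by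
  have h0 : w.vP ≠ 0 := fun h0 => w.ne_zero (congrArg Subtype.val h0)
  obtain ⟨f, hf⟩ : ∃ f : Module.Dual ℂ w.P, f w.vP ≠ 0 := by
    by_contra! hcon
    exact h0 ((Module.forall_dual_apply_eq_zero_iff ℂ _).1 hcon)
  exact ⟨(f w.vP)⁻¹ • f, inv_mul_cancel₀ hf⟩

/-- A projection of `V` to `w.N`. -/
theorem exists_proj (hs : ρ.IsSimple) : ∃ (f : w.P →ₗ[ℂ] ℂ) (G : V →ₗ[ℂ] w.P →ₗ[ℂ] V),
    f w.vP = 1 ∧ (∀ v, G v ∈ w.N) ∧ ∀ φ ∈ w.N, ∀ p, G (φ p) = f p • φ := by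
  obtain ⟨f, hf⟩ := w.exists_dual
  -- In `V = P ⊗ N` the projection contracts the first factor with a functional normalized on the
  -- vacuum vector.
  let e := LinearEquiv.ofBijective w.ev (w.ev_bijective hs)
  refine ⟨f, w.N.subtype ∘ₗ (TensorProduct.lid ℂ w.N).toLinearMap ∘ₗ f.rTensor w.N ∘ₗ
    e.symm.toLinearMap, hf, fun v => Submodule.coe_mem _, fun φ hφ p => ?_⟩
  have : e.symm (φ p) = p ⊗ₜ ⟨φ, hφ⟩ := by
    rw [LinearEquiv.symm_apply_eq]; rfl
  simp [this]

/-- Simplicity of `w.N`. -/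
theorem N_simple (hs : ρ.IsSimple) {N' : Submodule ℂ (w.P →ₗ[ℂ] V)}
    (hN : N' ≤ w.N) (h0 : N' ≠ ⊥)
    (hs' : ∀ φ ∈ N', w.hat 1 (h.s 1) φ ∈ N')
    (hK : ∀ x l, ∀ φ ∈ N', w.hat (listPar l) (ρ.deltas l (ρ.actK x) 1) φ ∈ N')
    (hW : ∀ i l, l ≠ [] → ∀ φ ∈ N', w.hat (par i + listPar l) (ρ.deltas l (ρ.vf i) 1) φ ∈ N') :
    N' = w.N := by
  obtain ⟨f, G, hf, hG, hGφ⟩ := w.exists_proj hs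
  have h1 : ∀ v, G v ∈ N' := by
    intro v
    have h2 : ⨆ φ ∈ N', LinearMap.range φ ≤ N'.comap G := iSup₂_le fun φ hφ => by
      rintro _ ⟨p, rfl⟩
      rw [Submodule.mem_comap, hGφ φ (hN hφ)]
      exact Submodule.smul_mem _ _ hφ
    rw [w.eq_top_of_forall_apply_mem hs hN h0 hs' hK hW] at h2
    exact h2 trivial
  refine le_antisymm hN fun φ hφ => ?_
  have := h1 (φ w.vP)
  rwa [hGφ φ hφ, hf, one_smul] at this

end Vac

end AkAction

end Splitting

/-! ### Weights of the multiplicity space -/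

section Weights

variable {q n : ℕ} {𝔨 : Type*} [LieRing 𝔨] [LieAlgebra ℂ 𝔨] {V : Type*} [AddCommGroup V]
  [Module ℂ V]

namespace AkAction

variable {ρ : AkAction q n 𝔨 V} {𝔥 : LieSubalgebra ℂ 𝔨}

/-- The Cartan operators of a bounded module. -/
def H (ρ : AkAction q n 𝔨 V) (𝔥 : LieSubalgebra ℂ 𝔨) : Fin q ⊕ 𝔥 → Module.End ℂ V :=
  Sum.elim (fun i : Fin q => ρ.actW 0 (W.euler i)) (fun h : 𝔥 => ρ.actK h 1)

/-- The Cartan operators, with the part lying in the Weyl superalgebra removed. -/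
def EH (ρ : AkAction q n 𝔨 V) (𝔥 : LieSubalgebra ℂ 𝔨) : Fin q ⊕ 𝔥 → Module.End ℂ V :=
  Sum.elim (fun i : Fin q => ρ.E (.inl i)) (fun h : 𝔥 => ρ.actK h 1)

/-- The operator `T` shifts the weights with respect to `ρ.EH 𝔥` by an integral weight of
`W_{q,n}`. -/
structure IsNeutral (ρ : AkAction q n 𝔨 V) (𝔥 : LieSubalgebra ℂ 𝔨) (T : Module.End ℂ V) :
    Prop where
  E_mul : ∀ i : Fin q, ∃ z : ℤ, ρ.E (.inl i) * T = (z : ℂ) • T + T * ρ.E (.inl i)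
  actK_mul : ∀ x : 𝔥, ρ.actK x 1 * T = T * ρ.actK x 1

theorem IsModule.H_mul_tD (h : ρ.IsModule) (i : Fin q ⊕ 𝔥) (a : Idx q n) :
    ρ.H 𝔥 i * ρ.tD a = ρ.tD a * ρ.H 𝔥 i := by
  rcases i with i | x
  · change ρ.actW 0 (W.euler i) * _ = _ * ρ.actW 0 (W.euler i)
    rw [ρ.actW_euler, add_mul, mul_add, (h.isConst_E _).commute_tD]
    congr 1
    exact h.tD_mul_tD _ _
  · exact (h.isConst_actK_one _).commute_tD a

theorem IsModule.isConst_EH (h : ρ.IsModule) (i : Fin q ⊕ 𝔥) : h.IsConst (ρ.EH 𝔥 i) 0 := by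
  rcases i with i | x
  · exact h.isConst_E _
  · exact h.isConst_actK_one _

namespace Vac

variable {h : ρ.IsModule} (w : Vac h)

/-- The weight spaces of `w.N`. -/
def Nwt (𝔥 : LieSubalgebra ℂ 𝔨) (χ : Fin q ⊕ 𝔥 → ℂ) : Submodule ℂ (w.P →ₗ[ℂ] V) :=
  w.N ⊓ wtSpace (fun i => w.hat 0 (ρ.EH 𝔥 i)) χ

/-- The sum of the weight spaces of `w.N` for all weights differing from `χ` by an integral weight
of `W_{q,n}`. -/
def U (𝔥 : LieSubalgebra ℂ 𝔨) (χ : Fin q ⊕ 𝔥 → ℂ) : Submodule ℂ (w.P →ₗ[ℂ] V) :=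
  ⨆ m : Fin q → ℤ, w.Nwt 𝔥 (χ + Sum.elim (fun i => (m i : ℂ)) 0)

theorem U_le_N (χ : Fin q ⊕ 𝔥 → ℂ) : w.U 𝔥 χ ≤ w.N := iSup_le fun _ => inf_le_left

theorem Nwt_le_U (χ : Fin q ⊕ 𝔥 → ℂ) : w.Nwt 𝔥 χ ≤ w.U 𝔥 χ := by
  refine le_trans (le_of_eq ?_) (le_iSup _ 0)
  congr 1
  funext i
  rcases i with i | x <;> simp

/-- An element of `N` is recovered from its value at the vacuum vector. That value has a fixed
weight for the operators `t_a ∂_a`, so its decomposition into weights of `V` can be projected back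
to `N`. -/
theorem N_le_iSup_Nwt (hs : ρ.IsSimple) (hb : ρ.IsBounded 𝔥) : w.N ≤ ⨆ χ, w.Nwt 𝔥 χ := by
  obtain ⟨f, G, hf, hG, hGφ⟩ := w.exists_proj hs
  have hGT : ∀ i v, G (ρ.EH 𝔥 i v) = w.hat 0 (ρ.EH 𝔥 i) (G v) := by
    intro i v
    obtain ⟨z, rfl⟩ := (w.ev_bijective hs).2 v
    induction z using TensorProduct.induction_on with
    | zero => simp
    | add x y hx hy => rw [map_add, map_add, map_add, hx, hy, map_add, map_add]
    | tmul p φ =>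
      rw [ev_tmul, ← hat_zero_apply, hGφ _ (w.hat_const_mem (h.isConst_EH i) φ.2),
        hGφ _ φ.2, map_smul]
  intro φ hφ
  have h1 : φ w.vP ∈ wtSpace ρ.tD w.lam := mem_wtSpace.2 fun a => by
    have h2 : w.gP (.inl a) (w.gP (.inr a) w.vP) = w.lam a • w.vP :=
      Subtype.ext (w.isVac a).tD_apply
    have h3 := congrArg φ h2
    rw [hφ, hφ, map_smul] at h3
    exact h3
  have h4 := le_iSup_inf_wtSpace (h := ρ.H 𝔥) hb.1 (Q := wtSpace ρ.tD w.lam) (fun i v hv => by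
    rw [mem_wtSpace] at hv ⊢
    intro a
    rw [← Module.End.mul_apply, ← h.H_mul_tD, Module.End.mul_apply, hv, map_smul]) h1
  have h5 : (⨆ χ, wtSpace ρ.tD w.lam ⊓ wtSpace (ρ.H 𝔥) χ) ≤ (⨆ χ, w.Nwt 𝔥 χ).comap G := by
    refine iSup_le fun χ => fun v hv => ?_
    -- A Cartan operator of `V` is `t_i ∂_i` plus `E_i`, so the weight on `N` is the weight on `V`
    -- minus that of the vacuum vector.
    refine Submodule.mem_iSup_of_mem
      (χ - Sum.elim (fun i => w.lam (.inl i)) 0) ⟨hG v, mem_wtSpace.2 fun i => ?_⟩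
    rw [← hGT, ← map_smul]
    congr 1
    have h6 := mem_wtSpace.1 hv.2 i
    rcases i with i | x
    · have h7 := mem_wtSpace.1 hv.1 (.inl i)
      change ρ.actW 0 (W.euler i) v = _ at h6
      rw [ρ.actW_euler, LinearMap.add_apply] at h6
      change ρ.tD (.inl i) v + _ = _ at h6
      rw [h7] at h6
      change ρ.E (.inl i) v = _
      rw [eq_sub_of_add_eq' h6]
      simp [sub_smul]
    · change ρ.actK x 1 v = _ at h6 ⊢
      rw [h6]
      simp
  have h6 := h5 h4
  rwa [Submodule.mem_comap, hGφ φ hφ, hf, one_smul] at h6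

/-- Each `b s` is evaluated at a monomial whose weight compensates the shift `m s`. All values land
in a single weight space of `V`, and they are independent because images of independent intertwiners
form a direct sum. -/
theorem card_le_of_linearIndependent {c : ℕ} (hc : ∀ χ, Module.rank ℂ (wtSpace (ρ.H 𝔥) χ) ≤ c)
    {χ : Fin q ⊕ 𝔥 → ℂ} {κ : Type*} [Fintype κ] {b : κ → w.N} (hb : LinearIndependent ℂ b)
    {m : κ → Fin q → ℤ}
    (hbm : ∀ s, (b s).1 ∈ w.Nwt 𝔥 (χ + Sum.elim (fun i => (m s i : ℂ)) 0)) :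
    Fintype.card κ ≤ c := by
  classical
  -- A common shift so large that `B - m s` lies, for every `s`, in a half-line on which the
  -- monomials do not annihilate the vacuum vector: upwards if `lam = 0`, downwards otherwise. Odd
  -- exponents stay zero.
  let B : Fin q → ℤ := fun i => if w.lam (.inl i) = 0 then ∑ s, |m s i| else -∑ s, |m s i|
  let e : κ → Idx q n → ℤ := fun s => Sum.elim (fun i => B i - m s i) 0
  have hm : ∀ s i, |m s i| ≤ ∑ s, |m s i| := fun s i =>
    Finset.single_le_sum (f := fun s => |m s i|) (fun _ _ => abs_nonneg _) (Finset.mem_univ s)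
  let p : κ → w.P := fun s => ⟨_, ρ.monomial_mem_vacModule w.v (e s)⟩
  have hp : ∀ s, p s ≠ 0 := by
    intro s h0
    refine h.monomial_apply_ne_zero w.isVac w.ne_zero Finset.univ.nodup_toList (m := e s) ?_ ?_ ?_
      (congrArg Subtype.val h0)
    · rintro (i | j) hl
      · have := hm s i
        have := le_abs_self (m s i)
        simp only [e, B, Sum.elim_inl, if_pos hl]
        omega
      · exact le_rfl
    · rintro (i | j) hl
      · have := hm s i
        have := neg_abs_le (m s i)
        have h2 : w.lam (.inl i) ≠ 0 := by rw [hl]; norm_num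
        simp only [e, B, Sum.elim_inl, if_neg h2]
        omega
      · exact le_rfl
    · rintro (i | j) hl
      · simp [par] at hl
      · rfl
  let ξ : Fin q ⊕ 𝔥 → ℂ := χ + Sum.elim (fun i => w.lam (.inl i) + (B i : ℂ)) 0
  have hy : ∀ s, (b s).1 (p s) ∈ wtSpace (ρ.H 𝔥) ξ := by
    intro s
    rw [mem_wtSpace]
    have h1 := fun i => congrArg (fun φ : w.P →ₗ[ℂ] V => φ (p s)) (mem_wtSpace.1 (hbm s).2 i)
    rintro (i | x)
    · have h2 := h1 (.inl i)
      simp only [hat_zero_apply] at h2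
      change ρ.E (.inl i) ((b s).1 (p s)) = _ at h2
      have h3 : w.gP (.inl (.inl i)) (w.gP (.inr (.inl i)) (p s)) =
          (w.lam (.inl i) + e s (.inl i)) • p s :=
        Subtype.ext (mem_wtSpace.1 (h.monomial_mem_wtSpace w.isVac (e s)) (.inl i))
      have h4 := congrArg (b s).1 h3
      rw [(b s).2, (b s).2, map_smul] at h4
      change ρ.t (.inl i) (ρ.D (.inl i) _) = _ at h4
      change ρ.actW 0 (W.euler i) _ = _
      rw [ρ.actW_euler, LinearMap.add_apply, Module.End.mul_apply, h2, h4, LinearMap.smul_apply,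
        ← add_smul]
      congr 1
      simp only [e, ξ, Sum.elim_inl, Pi.add_apply]
      push_cast
      ring
    · have h2 := h1 (.inr x)
      simp only [hat_zero_apply] at h2
      change ρ.actK x 1 ((b s).1 (p s)) = _ at h2 ⊢
      rw [h2, LinearMap.smul_apply]
      simp [ξ]
  have hli : LinearIndependent ℂ fun s => (⟨_, hy s⟩ : wtSpace (ρ.H 𝔥) ξ) := by
    refine LinearIndependent.of_comp (wtSpace (ρ.H 𝔥) ξ).subtype ?_
    rw [Fintype.linearIndependent_iff]
    intro a ha s
    have := eq_zero_of_sum_intertwiners w.P_simple w.P_schur hb Finset.univ (fun s => a s • p s)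
      (by simpa using ha) s (Finset.mem_univ s)
    exact (smul_eq_zero.1 this).resolve_right (hp s)
  have h1 := hli.cardinal_lift_le_rank
  have h2 := hc ξ
  have h3 : Cardinal.lift.{_} (Cardinal.mk κ) ≤ Cardinal.lift.{_} ((c : ℕ) : Cardinal) :=
    h1.trans (Cardinal.lift_le.2 h2)
  rw [Cardinal.mk_fintype, Cardinal.lift_natCast, Cardinal.lift_natCast] at h3
  exact_mod_cast h3

/-- A basis can be chosen inside the union of the weight spaces; more than `c` basis vectors would
contradict the previous estimate. -/
theorem finrank_U_le {c : ℕ} (hc : ∀ χ, Module.rank ℂ (wtSpace (ρ.H 𝔥) χ) ≤ c)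
    (χ : Fin q ⊕ 𝔥 → ℂ) : FiniteDimensional ℂ (w.U 𝔥 χ) ∧ Module.finrank ℂ (w.U 𝔥 χ) ≤ c := by
  classical
  set S : Set (w.P →ₗ[ℂ] V) :=
    ⋃ m : Fin q → ℤ, (w.Nwt 𝔥 (χ + Sum.elim (fun i => (m i : ℂ)) 0) : Set (w.P →ₗ[ℂ] V)) with hS
  have hU : w.U 𝔥 χ = Submodule.span ℂ S := by
    rw [hS, Submodule.span_iUnion]
    simp [U]
  obtain ⟨b, hbS, hspan, hli⟩ := exists_linearIndependent ℂ S
  have hcard : b.encard ≤ c := by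
    by_contra! hcon
    obtain ⟨t, htb, ht⟩ := Set.exists_subset_encard_eq (Order.add_one_le_of_lt hcon)
    have htfin : t.Finite := Set.finite_of_encard_eq_coe (k := c + 1) (by rw [ht]; push_cast; rfl)
    have : Fintype t := htfin.fintype
    have h1 : ∀ s : t, ∃ m : Fin q → ℤ, s.1 ∈ w.Nwt 𝔥 (χ + Sum.elim (fun i => (m i : ℂ)) 0) :=
      fun s => by simpa [hS] using hbS (htb s.2)
    choose m hm using h1
    have h2 := w.card_le_of_linearIndependent hc (b := fun s : t => (⟨s.1, (hm s).1⟩ : w.N))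
      (LinearIndependent.of_comp w.N.subtype
        (hli.comp (Set.inclusion htb) (Set.inclusion_injective htb))) hm
    rw [Set.encard_eq_coe_toFinset_card, Set.toFinset_card] at ht
    have h3 : Fintype.card t = c + 1 := by exact_mod_cast ht
    omega
  have hbfin : b.Finite := Set.finite_of_encard_le_coe hcard
  have : Fintype b := hbfin.fintype
  rw [hU, ← hspan]
  refine ⟨FiniteDimensional.span_of_finite ℂ hbfin, (finrank_span_le_card b).trans ?_⟩
  rw [Set.encard_eq_coe_toFinset_card] at hcard
  exact_mod_cast hcard

theorem hat_mem_U {T : Module.End ℂ V} {d : ZMod 2} (hT : h.IsConst T d) (hn : ρ.IsNeutral 𝔥 T)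
    (χ : Fin q ⊕ 𝔥 → ℂ) : ∀ φ ∈ w.U 𝔥 χ, w.hat d T φ ∈ w.U 𝔥 χ := by
  have h1 : w.U 𝔥 χ ≤ (w.U 𝔥 χ).comap (w.hat d T) := by
    refine iSup_le fun m => fun φ hφ => ?_
    choose z hz using hn.E_mul
    refine Submodule.mem_iSup_of_mem (m + z) ⟨w.hat_const_mem hT hφ.1, mem_wtSpace.2 fun i => ?_⟩
    have h2 := mem_wtSpace.1 hφ.2 i
    rcases i with i | x
    · change w.hat 0 (ρ.E (.inl i)) φ = _ at h2
      change w.hat 0 (ρ.E (.inl i)) _ = _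
      rw [← Module.End.mul_apply, hat_mul_hat, hz, hat_add, hat_smul, zero_add,
        show w.hat d (T * ρ.E (.inl i)) = w.hat d T * w.hat 0 (ρ.E (.inl i)) by
          rw [hat_mul_hat, add_zero], LinearMap.add_apply, Module.End.mul_apply, h2,
        LinearMap.smul_apply, map_smul, ← add_smul]
      congr 1
      simp only [Pi.add_apply, Sum.elim_inl]
      push_cast
      ring
    · change w.hat 0 (ρ.actK x 1) φ = _ at h2
      change w.hat 0 (ρ.actK x 1) _ = _
      rw [← Module.End.mul_apply, hat_mul_hat, hn.actK_mul, zero_add,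
        show w.hat d (T * ρ.actK x 1) = w.hat d T * w.hat 0 (ρ.actK x 1) by
          rw [hat_mul_hat, add_zero], Module.End.mul_apply, h2, map_smul]
      simp
  exact h1

theorem hat_s_mem_U (χ : Fin q ⊕ 𝔥 → ℂ) : ∀ φ ∈ w.U 𝔥 χ, w.hat 1 (h.s 1) φ ∈ w.U 𝔥 χ := by
  have h1 : w.U 𝔥 χ ≤ (w.U 𝔥 χ).comap (w.hat 1 (h.s 1)) := by
    refine iSup_le fun m => fun φ hφ => ?_
    refine Submodule.mem_iSup_of_mem m ⟨w.hat_s_mem 1 hφ.1, mem_wtSpace.2 fun i => ?_⟩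
    have h2 := mem_wtSpace.1 hφ.2 i
    have h3 : ρ.EH 𝔥 i * h.s 1 = h.s 1 * ρ.EH 𝔥 i := by
      rw [(h.isConst_EH i).s_mul]; simp
    rw [← Module.End.mul_apply, hat_mul_hat, h3, zero_add,
      show w.hat 1 (h.s 1 * ρ.EH 𝔥 i) = w.hat 1 (h.s 1) * w.hat 0 (ρ.EH 𝔥 i) by
        rw [hat_mul_hat, add_zero], Module.End.mul_apply, h2, map_smul]
  exact h1

theorem exists_U_ne_bot (hs : ρ.IsSimple) (hb : ρ.IsBounded 𝔥) : ∃ χ, w.U 𝔥 χ ≠ ⊥ := by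
  by_contra! hcon
  refine w.N_ne_bot (eq_bot_iff.2 ((w.N_le_iSup_Nwt hs hb).trans (iSup_le fun χ => ?_)))
  rw [← hcon χ]
  exact w.Nwt_le_U χ

end Vac

/-- Both operators preserve every space `w.U 𝔥 χ`, of dimension at most `c`, and these spaces
exhaust `N`. Since the exponent does not depend on the operators, nilpotency holds on all of `V = P
⊗ N`. -/
theorem IsModule.exists_nilpotency_bound (h : ρ.IsModule) (hs : ρ.IsSimple)
    (hb : ρ.IsBounded 𝔥) :
    ∃ c : ℕ, ∀ (T : Module.End ℂ V) (d : ZMod 2) (F : Module.End ℂ V) (k : ℂ), h.IsConst T d →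
      ρ.IsNeutral 𝔥 T → h.IsConst F 0 → ρ.IsNeutral 𝔥 F → k ≠ 0 → F * T = k • T + T * F →
      T ^ c = 0 := by
  obtain ⟨c, hc⟩ := hb.2
  have := hs.1
  obtain ⟨w⟩ := h.nonempty_vac hb
  refine ⟨c, fun T d F k hT hTn hF hFn hk hFT => ?_⟩
  have hhat : ∀ χ, ∀ φ ∈ w.U 𝔥 χ, (w.hat d T ^ c) φ = 0 := by
    intro χ
    obtain ⟨hfin, hle⟩ := w.finrank_U_le hc χ
    refine pow_finrank_apply_eq_zero hle (w.hat_mem_U hT hTn χ) (w.hat_mem_U hF hFn χ) hk ?_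
    rw [w.hat_mul_hat, w.hat_mul_hat, hFT, w.hat_add, w.hat_smul, zero_add, add_zero]
  -- On `P ⊗ N` the operator `T` is the tensor product of a parity operator of `P` and `w.hat d T`.
  have hpow : ∀ (j : ℕ) (φ : w.P →ₗ[ℂ] V) (p : w.P),
      (T ^ j) (φ p) = (w.hat d T ^ j) φ ((w.tau d ^ j) p) := by
    intro j
    induction j with
    | zero => intro φ p; rfl
    | succ j ih =>
      intro φ p
      rw [pow_succ, Module.End.mul_apply, w.apply_apply d T, ih,
        ← Module.End.mul_apply (w.tau d ^ j),
        ← pow_succ, ← Module.End.mul_apply (w.hat d T ^ j), ← pow_succ]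
  have hN : w.N ≤ LinearMap.ker (w.hat d T ^ c) :=
    (w.N_le_iSup_Nwt hs hb).trans (iSup_le fun χ => (w.Nwt_le_U χ).trans fun φ hφ => hhat χ φ hφ)
  refine LinearMap.ext fun v => ?_
  obtain ⟨z, rfl⟩ := (w.ev_bijective hs).2 v
  induction z using TensorProduct.induction_on with
  | zero => simp
  | add x y hx hy => rw [map_add, map_add, hx, hy, map_add]
  | tmul p φ =>
    rw [w.ev_tmul, hpow, LinearMap.mem_ker.1 (hN φ.2)]
    rfl

/-- There is a nonzero vector that is killed by all operators raising the eigenvalues of the Euler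
operator. -/
theorem IsModule.exists_top_vector (h : ρ.IsModule) (hs : ρ.IsSimple) (hb : ρ.IsBounded 𝔥)
    {F : Module.End ℂ V} (hF : h.IsConst F 0) (hFn : ρ.IsNeutral 𝔥 F) :
    ∃ v : V, v ≠ 0 ∧ ∀ (T : Module.End ℂ V) (d : ZMod 2) (k : ℕ), h.IsConst T d →
      ρ.IsNeutral 𝔥 T → k ≠ 0 → F * T = (k : ℂ) • T + T * F → T v = 0 := by
  obtain ⟨c, hc⟩ := hb.2
  have := hs.1
  obtain ⟨w⟩ := h.nonempty_vac hb
  obtain ⟨χ, hχ⟩ := w.exists_U_ne_bot hs hb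
  obtain ⟨hfin, -⟩ := w.finrank_U_le hc χ
  have : Nontrivial (w.U 𝔥 χ) := Submodule.nontrivial_iff_ne_bot.2 hχ
  set f : Module.End ℂ (w.U 𝔥 χ) := (w.hat 0 F).restrict (w.hat_mem_U hF hFn χ)
  have hfin : Set.Finite {μ | f.HasEigenvalue μ} := Module.End.finite_hasEigenvalue f
  -- An operator raising the eigenvalue of `F` by a positive integer must kill an eigenvector whose
  -- eigenvalue has maximal real part.
  obtain ⟨μ, hμ, hmax⟩ := Set.exists_max_image _ Complex.re hfin (Module.End.exists_eigenvalue f)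
  obtain ⟨φ, hφ, hφ0⟩ := Module.End.HasEigenvalue.exists_hasEigenvector hμ
  obtain ⟨p, hp⟩ : ∃ p, φ.1 p ≠ 0 := by
    by_contra! hcon
    exact hφ0 (Subtype.ext (LinearMap.ext hcon))
  refine ⟨φ.1 p, hp, fun T d k hT hTn hk hFT => ?_⟩
  have h1 : w.hat 0 F φ.1 = μ • φ.1 := congrArg Subtype.val (Module.End.mem_eigenspace_iff.1 hφ)
  have h2 : w.hat d T φ.1 = 0 := by
    by_contra h0
    have h3 : f.HasEigenvalue (μ + k) := by
      refine Module.End.hasEigenvalue_of_hasEigenvector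
        (x := ⟨_, w.hat_mem_U hT hTn χ φ.1 φ.2⟩)
        ⟨Module.End.mem_eigenspace_iff.2 (Subtype.ext ?_), fun h' => h0 (congrArg Subtype.val h')⟩
      change w.hat 0 F (w.hat d T φ.1) = (μ + k) • w.hat d T φ.1
      rw [← Module.End.mul_apply, w.hat_mul_hat, hFT, w.hat_add, w.hat_smul, zero_add,
        show w.hat d (T * F) = w.hat d T * w.hat 0 F by rw [w.hat_mul_hat, add_zero],
        LinearMap.add_apply, Module.End.mul_apply, h1, LinearMap.smul_apply, map_smul, ← add_smul,
        add_comm]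
    have h4 := hmax _ h3
    simp only [Complex.add_re, Complex.natCast_re] at h4
    have h5 : (0 : ℝ) < k := by exact_mod_cast Nat.pos_of_ne_zero hk
    linarith
  rw [w.apply_apply d, h2, LinearMap.zero_apply]

end AkAction

end Weights

/-! ### Brackets of the constant operators coming from vector fields -/

section Brackets

variable {q n : ℕ} {𝔨 : Type*} [LieRing 𝔨] [LieAlgebra ℂ 𝔨] {V : Type*} [AddCommGroup V]
  [Module ℂ V]

namespace AkAction

namespace IsModule

variable {ρ : AkAction q n 𝔨 V} (h : ρ.IsModule)

include h

theorem deltas_actA_mul {l : List (Idx q n)} (hl : l ≠ []) (T : Module.End ℂ V) :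
    ρ.deltas l (LinearMap.mulRight ℂ T ∘ₗ ρ.actA) = 0 := by
  rcases List.eq_nil_or_concat l with rfl | ⟨l', j, rfl⟩
  · exact absurd rfl hl
  · rw [List.concat_eq_append, deltas_append, deltas_cons, deltas_nil, h.delta_actA_mul, map_zero]

/-- Bracketing with a linear vector field preserves the order of a vector field. -/
theorem delta_vf_mul_deltas_vf_sub_mem (i j k : Idx q n) {l : List (Idx q n)} (hl : l ≠ []) :
    ρ.delta j (ρ.vf k) 1 * ρ.deltas l (ρ.vf i) 1 -
      ksign (par j + par k) (par i + listPar l) •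
        (ρ.deltas l (ρ.vf i) 1 * ρ.delta j (ρ.vf k) 1) ∈
      Submodule.span ℂ {T | ∃ i' l', l'.length = l.length ∧ T = ρ.deltas l' (ρ.vf i') 1} := by
  have := ((h.hasAd_delta_vf_vf i j k).deltas (h := h)
    (by simpa [add_comm] using h.isConst_deltas_vf k (l := [j]) (by simp)) l).apply_one
  rw [← sub_eq_iff_eq_add] at this
  rw [this, LinearMap.smul_apply, map_sub, map_smul, map_smul, map_sub, h.deltas_actA_mul hl,
    sub_zero]
  refine Submodule.smul_mem _ _ (sub_mem (Submodule.smul_mem _ _ ?_) (Submodule.smul_mem _ _ ?_))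
  · refine Submodule.span_mono ?_ (ρ.deltas_comp_derR_one_mem k l (ρ.delta j (ρ.vf i)))
    rintro _ ⟨l', hl', rfl⟩
    exact ⟨i, l' ++ [j], by simp; omega, by rw [deltas_append, deltas_cons, deltas_nil]⟩
  · exact Submodule.subset_span ⟨k, l, rfl, rfl⟩

/-- The weight of `t^l ∂_i` under `t_k ∂_k`: each letter `k` contributes `1`, and `∂_k` contributes
`-1`. -/
theorem E_mul_deltas_vf (k i : Idx q n) {l : List (Idx q n)} (hl : l ≠ []) :
    ρ.E k * ρ.deltas l (ρ.vf i) 1 =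
      ((cnt k l : ℂ) - if i = k then 1 else 0) • ρ.deltas l (ρ.vf i) 1 +
        ρ.deltas l (ρ.vf i) 1 * ρ.E k := by
  have := ((h.hasAd_delta_vf_vf i k k).deltas (h := h)
    (by simpa [add_comm] using h.isConst_deltas_vf k (l := [k]) (by simp)) l).apply_one
  simp only [zmod_two_add_self, ksign_zero_left, one_smul, map_sub, map_smul, h.deltas_actA_mul hl,
    sub_zero, h.deltas_delta_comp_derR, LinearMap.sub_apply, LinearMap.add_apply,
    LinearMap.smul_apply, LinearMap.comp_apply, A.derR_one, map_zero, zero_add] at this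
  rw [E, this]
  split_ifs with hik
  · rw [hik, sub_smul, one_smul]
  · simp

theorem E_mul_E (i j : Idx q n) : ρ.E i * ρ.E j = ρ.E j * ρ.E i := by
  have := h.E_mul_deltas_vf i j (l := [j]) (by simp)
  rw [cnt_cons, cnt_nil] at this
  rcases eq_or_ne i j with rfl | hij
  · rfl
  · simpa [hij, hij.symm, E] using this

theorem actK_one_mul_deltas_vf (y : 𝔨) (i : Idx q n) {l : List (Idx q n)} (hl : l ≠ []) :
    ρ.actK y 1 * ρ.deltas l (ρ.vf i) 1 = ρ.deltas l (ρ.vf i) 1 * ρ.actK y 1 := by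
  have := h.deltas_vf_mul_deltas_actK_sub_mem i y hl []
  simp only [listPar_nil, ksign_zero_right, one_smul, ne_eq, not_true_eq_false, false_and,
    and_false, exists_false, Set.ofPred_false, Submodule.span_empty, Submodule.mem_bot,
    deltas_nil] at this
  exact (sub_eq_zero.1 this).symm

theorem actK_one_mul_deltas_actK (x y : 𝔨) (l : List (Idx q n)) :
    ρ.actK x 1 * ρ.deltas l (ρ.actK y) 1 =
      ρ.deltas l (ρ.actK ⁅x, y⁆) 1 + ρ.deltas l (ρ.actK y) 1 * ρ.actK x 1 := by
  simpa using h.deltas_actK_mul_deltas_actK x y [] l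

theorem isNeutral_E {𝔥 : LieSubalgebra ℂ 𝔨} (a : Idx q n) : ρ.IsNeutral 𝔥 (ρ.E a) where
  E_mul i := ⟨0, by simp [h.E_mul_E]⟩
  actK_mul x := by simpa [E] using h.actK_one_mul_deltas_vf x a (l := [a]) (by simp)

theorem isNeutral_deltas_vf {𝔥 : LieSubalgebra ℂ 𝔨} (i : Idx q n) {l : List (Idx q n)}
    (hl : l ≠ []) : ρ.IsNeutral 𝔥 (ρ.deltas l (ρ.vf i) 1) where
  E_mul j := ⟨(cnt (.inl j) l : ℤ) - if i = .inl j then 1 else 0, by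
    rw [h.E_mul_deltas_vf _ i hl]; push_cast; rfl⟩
  actK_mul x := h.actK_one_mul_deltas_vf x i hl

theorem isNeutral_deltas_actK {𝔥 : LieSubalgebra ℂ 𝔨} {y : 𝔨} (hy : ∀ x ∈ 𝔥, ⁅x, y⁆ = 0)
    (l : List (Idx q n)) : ρ.IsNeutral 𝔥 (ρ.deltas l (ρ.actK y) 1) where
  E_mul j := ⟨cnt (.inl j) l, by
    rw [E, h.delta_vf_mul_deltas_actK]; push_cast; rfl⟩
  actK_mul x := by
    rw [h.actK_one_mul_deltas_actK, hy x x.2, map_zero, map_zero, LinearMap.zero_apply, zero_add]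

/-! ### Vanishing of the operators coming from `𝔨` -/

theorem deltas_perm {l l' : List (Idx q n)} (hl : l.Perm l') :
    ∃ c : ℂ, ∀ φ : A q n →ₗ[ℂ] Module.End ℂ V, ρ.deltas l φ = c • ρ.deltas l' φ := by
  induction hl with
  | nil => exact ⟨1, fun φ => by simp⟩
  | cons a _ ih =>
    obtain ⟨c, hc⟩ := ih
    exact ⟨c, fun φ => by rw [deltas_cons, hc, map_smul, deltas_cons]⟩
  | swap a b l =>
    exact ⟨ksign (par b) (par a), fun φ => by
      simp only [deltas_cons]; rw [h.delta_delta]⟩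
  | trans _ _ ih ih' =>
    obtain ⟨c, hc⟩ := ih
    obtain ⟨c', hc'⟩ := ih'
    exact ⟨c * c', fun φ => by rw [hc, hc', smul_smul]⟩

omit h in
theorem cnt_append (a : Idx q n) (l l' : List (Idx q n)) :
    cnt a (l ++ l') = cnt a l + cnt a l' := by
  simp [cnt]

omit h in
theorem sum_cnt (l : List (Idx q n)) : ∑ a, cnt a l = l.length := by
  induction l with
  | nil => simp
  | cons b l ih => simp only [cnt_cons, Finset.sum_add_distrib, ih]; simp

omit h in
theorem exists_perm_of_le_cnt {a : Idx q n} {R : ℕ} {l : List (Idx q n)} (hl : R ≤ cnt a l) :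
    ∃ l', l.Perm (List.replicate R a ++ l') := by
  induction l generalizing R with
  | nil => obtain rfl : R = 0 := by simpa using hl
           exact ⟨[], by simp⟩
  | cons b l ih =>
    rw [cnt_cons] at hl
    rcases eq_or_ne a b with rfl | hab
    · cases R with
      | zero => exact ⟨a :: l, by simp⟩
      | succ R =>
        rw [if_pos rfl] at hl
        obtain ⟨l', hl'⟩ := ih (R := R) (by omega)
        exact ⟨l', by rw [List.replicate_succ, List.cons_append]; exact hl'.cons a⟩
    · rw [if_neg hab, add_zero] at hl
      obtain ⟨l', hl'⟩ := ih hl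
      exact ⟨b :: l', (hl'.cons b).trans List.perm_middle.symm⟩

theorem deltas_eq_zero_of_cnt {a : Idx q n} {R : ℕ} {φ : A q n →ₗ[ℂ] Module.End ℂ V}
    (hφ : ∀ l, ρ.deltas (List.replicate R a ++ l) φ 1 = 0) {l : List (Idx q n)}
    (hl : R ≤ cnt a l) : ρ.deltas l φ 1 = 0 := by
  obtain ⟨l', hl'⟩ := exists_perm_of_le_cnt hl
  obtain ⟨c, hc⟩ := h.deltas_perm hl'
  rw [hc, LinearMap.smul_apply, hφ, smul_zero]

/-- Bracketing with `t_i^2 ∂_i` appends a letter `i` to a word, with coefficient the number of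
letters `i` present. A nilpotent operator has nilpotent adjoint action, so words with too many
letters `i` give zero; for odd variables two equal letters suffice. -/
theorem exists_length_bound {x : 𝔨} (hc : ∀ i : Fin q,
      ∃ c, ρ.deltas [.inl i, .inl i] (ρ.vf (.inl i)) 1 ^ c = 0) :
    ∃ R : ℕ, ∀ l : List (Idx q n), R ≤ l.length → ρ.deltas l (ρ.actK x) 1 = 0 := by
  have heven : ∀ i : Fin q, ∃ R : ℕ, ∀ l : List (Idx q n), R ≤ cnt (.inl i) l →
      ρ.deltas l (ρ.actK x) 1 = 0 := by
    intro i
    obtain ⟨c, hc⟩ := hc i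
    set X := ρ.deltas [.inl i, .inl i] (ρ.vf (.inl i)) 1 with hX
    obtain ⟨r, hr⟩ := LieAlgebra.ad_nilpotent_of_nilpotent (R := ℂ) (a := X) ⟨c, hc⟩
    have had : ∀ l : List (Idx q n), LieAlgebra.ad ℂ (Module.End ℂ V) X (ρ.deltas l (ρ.actK x) 1) =
        (cnt (.inl i) l : ℂ) • ρ.deltas (.inl i :: l) (ρ.actK x) 1 := by
      intro l
      rw [LieAlgebra.ad_apply, LieRing.of_associative_ring_bracket, hX,
        h.deltas_vf_mul_deltas_actK_of_even]
      abel
    have hpow : ∀ (m : ℕ) (l : List (Idx q n)), 0 < cnt (.inl i) l → ∃ c : ℂ, c ≠ 0 ∧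
        (LieAlgebra.ad ℂ (Module.End ℂ V) X ^ m) (ρ.deltas l (ρ.actK x) 1) =
          c • ρ.deltas (List.replicate m (.inl i) ++ l) (ρ.actK x) 1 := by
      intro m l hl
      induction m with
      | zero => exact ⟨1, one_ne_zero, by simp⟩
      | succ m ih =>
        obtain ⟨c, hc, h1⟩ := ih
        refine ⟨c * (cnt (.inl i) (List.replicate m (.inl i) ++ l) : ℕ), mul_ne_zero hc ?_, ?_⟩
        · rw [cnt_append]
          exact_mod_cast (by omega)
        · rw [pow_succ', Module.End.mul_apply, h1, map_smul, had, smul_smul, List.replicate_succ,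
            List.cons_append]
    -- One letter `i` has to be present at the start for the coefficients to be nonzero, hence `r +
    -- 1`.
    refine ⟨r + 1, fun l hl => h.deltas_eq_zero_of_cnt (R := r + 1) (fun l => ?_) hl⟩
    obtain ⟨c, hc, h1⟩ := hpow r (.inl i :: l) (by rw [cnt_cons, if_pos rfl]; omega)
    rw [hr, LinearMap.zero_apply, eq_comm, smul_eq_zero] at h1
    rw [show List.replicate (r + 1) (Sum.inl i : Idx q n) ++ l =
      List.replicate r (.inl i) ++ (.inl i :: l) by
        rw [List.replicate_succ', List.append_assoc]; rfl]
    exact h1.resolve_left hc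
  have hall : ∀ a : Idx q n, ∃ R : ℕ, ∀ l : List (Idx q n), R ≤ cnt a l →
      ρ.deltas l (ρ.actK x) 1 = 0 := by
    rintro (i | j)
    · exact heven i
    · refine ⟨2, fun l hl => h.deltas_eq_zero_of_cnt (R := 2) (fun l => ?_) hl⟩
      have h1 := congrArg (fun φ => φ 1) (h.delta_delta (.inr j) (.inr j) (ρ.deltas l (ρ.actK x)))
      have h2 : ∀ T : Module.End ℂ V, T = (-1 : ℂ) • T → T = 0 := fun T hT => by
        have h2 : (2 : ℂ) • T = 0 := by
          rw [two_smul]; nth_rewrite 2 [hT]; rw [neg_smul, one_smul, add_neg_cancel]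
        exact (smul_eq_zero.1 h2).resolve_left two_ne_zero
      rw [show par (Sum.inr j : Idx q n) = 1 from rfl, ksign_one_one] at h1
      simpa [List.replicate] using h2 _ h1
  choose R hR using hall
  -- Pigeonhole: a word this long contains some letter more than `R a` times.
  refine ⟨∑ a, R a + 1, fun l hl => ?_⟩
  by_contra h0
  have h1 : ∀ a, cnt a l ≤ R a := fun a => by
    by_contra! hcon
    exact h0 (hR a l hcon.le)
  have h2 := sum_cnt l
  have h3 := Finset.sum_le_sum fun a (_ : a ∈ Finset.univ) => h1 a
  omega

variable {𝔥 : LieSubalgebra ℂ 𝔨}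

/-- Nilpotency first bounds the length of the words that act nontrivially. The longest remaining
words give finitely many nilpotent operators, on a spanning set, that commute up to sign; their
common kernel is nonzero and a submodule, so they vanish, and the length descends to one. -/
theorem deltas_actK_eq_zero (hs : ρ.IsSimple) (hb : ρ.IsBounded 𝔥)
    (habel : ∀ x ∈ 𝔥, ∀ y ∈ 𝔥, ⁅x, y⁆ = 0) {S : Set 𝔨} (hSfin : S.Finite)
    (hspan : Submodule.span ℂ S = ⊤) (hS : ∀ y ∈ S, y ∈ 𝔥 ∨ ∃ z ∈ 𝔥, ⁅y, z⁆ = y) (x : 𝔨)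
    {l : List (Idx q n)} (hl : l ≠ []) : ρ.deltas l (ρ.actK x) 1 = 0 := by
  obtain ⟨c, hc⟩ := h.exists_nilpotency_bound hs hb
  have hX : ∀ i : Fin q, ∃ c, ρ.deltas [.inl i, .inl i] (ρ.vf (.inl i)) 1 ^ c = 0 := by
    intro i
    refine ⟨c, hc _ _ _ 1 (h.isConst_deltas_vf (.inl i) (by simp))
      (h.isNeutral_deltas_vf (.inl i) (by simp)) (h.isConst_E (.inl i)) (h.isNeutral_E (.inl i))
      one_ne_zero ?_⟩
    rw [h.E_mul_deltas_vf _ _ (by simp)]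
    norm_num [cnt_cons]
  -- Elements of `𝔥` give operators preserving the spaces `U`, and the first letter of `l` supplies
  -- the operator `E_k` with nonzero eigenvalue.
  have hcartan : ∀ z ∈ 𝔥, ∀ l : List (Idx q n), l ≠ [] → ρ.deltas l (ρ.actK z) 1 ^ c = 0 := by
    intro z hz l hl
    obtain ⟨k, l', rfl⟩ := List.exists_cons_of_ne_nil hl
    refine hc _ _ _ (cnt k (k :: l')) (h.isConst_deltas_actK z _)
      (h.isNeutral_deltas_actK (fun x hx => habel x hx z hz) _) (h.isConst_E k) (h.isNeutral_E k)
      (Nat.cast_ne_zero.2 ?_) (h.delta_vf_mul_deltas_actK k z _)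
    rw [cnt_cons, if_pos rfl]
    omega
  -- Root vectors shift the weights of `𝔥`, so the bound does not apply directly. Instead `y ⊗ t^l =
  -- [y ⊗ 1, z ⊗ t^l]`, and `y ⊗ 1` commutes with `y ⊗ t^l`.
  have hnil : ∀ y ∈ S, ∀ l : List (Idx q n), l ≠ [] → ρ.deltas l (ρ.actK y) 1 ^ c = 0 := by
    intro y hy l hl
    rcases hS y hy with hy | ⟨z, hz, hyz⟩
    · exact hcartan y hy l hl
    · refine pow_eq_zero_of_commutator (a := ρ.actK y 1) (b := ρ.deltas l (ρ.actK z) 1) ?_ ?_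
        (hcartan z hz l hl)
      · rw [h.actK_one_mul_deltas_actK, hyz]
      · rw [h.actK_one_mul_deltas_actK, lie_self, map_zero, map_zero, LinearMap.zero_apply,
          zero_add]
  have hlin : ∀ (l : List (Idx q n)) (v : V), (∀ y ∈ S, ρ.deltas l (ρ.actK y) 1 v = 0) →
      ∀ x, ρ.deltas l (ρ.actK x) 1 v = 0 := by
    intro l v hv x
    have h1 : Submodule.span ℂ S ≤ LinearMap.ker
        (LinearMap.applyₗ v ∘ₗ LinearMap.applyₗ 1 ∘ₗ ρ.deltas l ∘ₗ ρ.actK) :=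
      Submodule.span_le.2 fun y hy => hv y hy
    rw [hspan] at h1
    exact h1 (Submodule.mem_top (x := x))
  have hbound : ∃ R : ℕ, ∀ l : List (Idx q n), R ≤ l.length → ∀ x, ρ.deltas l (ρ.actK x) 1 = 0 := by
    choose R hR using fun x => h.exists_length_bound (x := x) hX
    refine ⟨hSfin.toFinset.sup R, fun l hl x => LinearMap.ext fun v =>
      hlin l v (fun y hy => ?_) x⟩
    rw [hR y l ((Finset.le_sup (hSfin.mem_toFinset.2 hy)).trans hl), LinearMap.zero_apply]
  have hdesc : ∀ r : ℕ, 1 ≤ r →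
      (∀ l : List (Idx q n), r + 1 ≤ l.length → ∀ x, ρ.deltas l (ρ.actK x) 1 = 0) →
      ∀ l : List (Idx q n), r ≤ l.length → ∀ x, ρ.deltas l (ρ.actK x) 1 = 0 := by
    intro r hr hr1
    have hne : ∀ {l : List (Idx q n)}, r ≤ l.length → l ≠ [] := by
      rintro l h1 rfl
      simp at h1
      omega
    set B : Set (Module.End ℂ V) :=
      Set.image2 (fun y l => ρ.deltas l (ρ.actK y) 1) S {l : List (Idx q n) | l.length = r} with hB
    have hBfin : B.Finite := hSfin.image2 _ (List.finite_length_eq _ r)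
    have hBmem : ∀ {T}, T ∈ hBfin.toFinset.toList ↔ ∃ y ∈ S, ∃ l : List (Idx q n), l.length = r ∧
        ρ.deltas l (ρ.actK y) 1 = T := by
      intro T
      simp [hB, Set.mem_image2]
    obtain ⟨v, -, hv0, hv⟩ := exists_mem_forall_apply_eq_zero hBfin.toFinset.toList (by
        intro T hT T' hT'
        obtain ⟨y, hy, l, hl, rfl⟩ := hBmem.1 hT
        obtain ⟨y', hy', l', hl', rfl⟩ := hBmem.1 hT'
        -- The bracket has order `2 r ≥ r + 1`, hence vanishes; this uses `r ≥ 1`.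
        refine ⟨_, by
          rw [h.deltas_actK_mul_deltas_actK, ← deltas_append, hr1 _ (by simp; omega), smul_zero,
            zero_add]⟩) (by
        intro T hT
        obtain ⟨y, hy, l, hl, rfl⟩ := hBmem.1 hT
        exact ⟨c, hnil y hy l (hne hl.ge)⟩) ⊤
        (by have := hs.1; exact top_ne_bot) (fun _ _ _ _ => trivial)
    set Q : Submodule ℂ V := ⨅ x : 𝔨, ⨅ l : {l : List (Idx q n) // r ≤ l.length},
      LinearMap.ker (ρ.deltas l.1 (ρ.actK x) 1) with hQ
    have hmem : ∀ {v}, v ∈ Q ↔ ∀ x, ∀ l : List (Idx q n), r ≤ l.length →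
        ρ.deltas l (ρ.actK x) 1 v = 0 := by
      intro v
      simp [hQ]
    have hscomm : ∀ {T : Module.End ℂ V}, (∀ x, ∀ l : List (Idx q n), ∃ c : ℂ,
        ρ.deltas l (ρ.actK x) 1 * T = c • (T * ρ.deltas l (ρ.actK x) 1)) →
        ∀ v ∈ Q, T v ∈ Q := by
      intro T hT v hv
      rw [hmem] at hv ⊢
      intro x l hl
      obtain ⟨c, hc⟩ := hT x l
      rw [← Module.End.mul_apply, hc, LinearMap.smul_apply, Module.End.mul_apply, hv x l hl,
        map_zero,
        smul_zero]
    have hQtop : Q = ⊤ := by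
      refine (hs.eq_bot_or_eq_top h ?_ ?_ ?_ ?_ ?_).resolve_left ?_
      · exact hscomm fun x l => ⟨ksign 1 (listPar l), by
          rw [(h.isConst_deltas_actK x l).s_mul, smul_smul, ksign_mul_self, one_smul]⟩
      · exact fun a => hscomm fun x l => ⟨_, (h.isConst_deltas_actK x l).mul_t a⟩
      · exact fun a => hscomm fun x l => ⟨_, (h.isConst_deltas_actK x l).mul_D a⟩
      · intro y l' v hv
        rw [hmem] at hv ⊢
        intro x l hl
        rw [← Module.End.mul_apply, h.deltas_actK_mul_deltas_actK, ← deltas_append]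
        simp only [LinearMap.add_apply, LinearMap.smul_apply, Module.End.mul_apply]
        rw [hv _ (l' ++ l) (by simp; omega), hv x l hl, map_zero, smul_zero, add_zero]
      · intro i l' hl' v hv
        rw [hmem] at hv ⊢
        intro x l hl
        have h1 := h.deltas_vf_mul_deltas_actK_sub_mem i x hl' l
        have h2 : (ρ.deltas l' (ρ.vf i) 1 * ρ.deltas l (ρ.actK x) 1 -
          ksign (par i + listPar l') (listPar l) •
            (ρ.deltas l (ρ.actK x) 1 * ρ.deltas l' (ρ.vf i) 1)) v = 0 := by
          refine (Submodule.span_le (p := LinearMap.ker (LinearMap.applyₗ v))).2 ?_ h1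
          rintro _ ⟨l'', hl'', -, rfl⟩
          have := List.length_pos_iff.2 hl'
          exact hv x l'' (by omega)
        rw [LinearMap.sub_apply, LinearMap.smul_apply, Module.End.mul_apply, Module.End.mul_apply,
          hv x l hl, map_zero, zero_sub, neg_eq_zero, smul_eq_zero] at h2
        exact h2.resolve_left (ksign_ne_zero _ _)
      · refine (Submodule.ne_bot_iff _).2 ⟨v, hmem.2 fun x l hl => ?_, hv0⟩
        rcases hl.eq_or_lt with hl | hl
        · exact hlin l v (fun y hy => hv _ (hBmem.2 ⟨y, hy, l, hl.symm, rfl⟩)) x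
        · rw [hr1 l hl x, LinearMap.zero_apply]
    intro l hl x
    refine LinearMap.ext fun v => ?_
    have : v ∈ Q := hQtop ▸ Submodule.mem_top
    exact hmem.1 this x l hl
  obtain ⟨R, hR⟩ := hbound
  have hfinal : ∀ l : List (Idx q n), 1 ≤ l.length → ∀ x, ρ.deltas l (ρ.actK x) 1 = 0 := by
    rcases Nat.eq_zero_or_pos R with rfl | hpos
    · exact fun l _ => hR l (Nat.zero_le _)
    · refine Nat.decreasingInduction' (P := fun r => ∀ l : List (Idx q n), r ≤ l.length →
        ∀ x, ρ.deltas l (ρ.actK x) 1 = 0) (fun r _ hr ih => hdesc r hr ih) hpos hR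
  exact hfinal l (List.length_pos_iff.2 hl) x

/-! ### Vanishing of the higher operators coming from vector fields -/

/-- A field of order `|l|` has degree `|l| - 1` for the Euler operator, so fields of order at least
two kill a vector of top degree. The vectors killed by all of them form a submodule, since the
remaining operators have degree zero. -/
theorem deltas_vf_eq_zero (hs : ρ.IsSimple) (hb : ρ.IsBounded 𝔥)
    (hK : ∀ (x : 𝔨) (l : List (Idx q n)), l ≠ [] → ρ.deltas l (ρ.actK x) 1 = 0) (i : Idx q n)
    {l : List (Idx q n)} (hl : 2 ≤ l.length) : ρ.deltas l (ρ.vf i) 1 = 0 := by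
  have hne : ∀ {l : List (Idx q n)}, 2 ≤ l.length → l ≠ [] := by
    rintro l h1 rfl
    simp at h1
  set F : Module.End ℂ V := ∑ a, ρ.E a with hF
  have hFc : h.IsConst F 0 := by
    refine ⟨fun k => ?_, fun k => ?_, fun e => ?_⟩
    · rw [hF, Finset.sum_mul, Finset.mul_sum, Finset.smul_sum]
      exact Finset.sum_congr rfl fun a _ => (h.isConst_E a).mul_D k
    · rw [hF, Finset.sum_mul, Finset.mul_sum, Finset.smul_sum]
      exact Finset.sum_congr rfl fun a _ => (h.isConst_E a).mul_t k
    · rw [hF, Finset.sum_mul, Finset.mul_sum, Finset.smul_sum]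
      exact Finset.sum_congr rfl fun a _ => (h.isConst_E a).s_mul e
  have hFn : ρ.IsNeutral 𝔥 F := by
    refine ⟨fun k => ⟨0, ?_⟩, fun x => ?_⟩
    · rw [hF, Finset.sum_mul, Finset.mul_sum, Int.cast_zero, zero_smul, zero_add]
      exact Finset.sum_congr rfl fun a _ => h.E_mul_E _ _
    · rw [hF, Finset.sum_mul, Finset.mul_sum]
      exact Finset.sum_congr rfl fun a _ => (h.isNeutral_E (𝔥 := 𝔥) a).actK_mul x
  obtain ⟨v, hv0, hv⟩ := h.exists_top_vector hs hb hFc hFn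
  -- The letter counts add up to the length, and `∂_i` lowers the degree by one.
  have hFT : ∀ i, ∀ l : List (Idx q n), 2 ≤ l.length → F * ρ.deltas l (ρ.vf i) 1 =
      ((l.length - 1 : ℕ) : ℂ) • ρ.deltas l (ρ.vf i) 1 + ρ.deltas l (ρ.vf i) 1 * F := by
    intro i l hl
    rw [hF, Finset.sum_mul, Finset.mul_sum]
    simp only [h.E_mul_deltas_vf _ i (hne hl)]
    rw [Finset.sum_add_distrib, ← Finset.sum_smul, Finset.sum_sub_distrib, Finset.sum_ite_eq,
      if_pos (Finset.mem_univ _), Nat.cast_sub (by omega), ← sum_cnt l]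
    simp
  set Q : Submodule ℂ V := ⨅ i : Idx q n, ⨅ l : {l : List (Idx q n) // 2 ≤ l.length},
    LinearMap.ker (ρ.deltas l.1 (ρ.vf i) 1) with hQ
  have hmem : ∀ {v}, v ∈ Q ↔ ∀ i, ∀ l : List (Idx q n), 2 ≤ l.length →
      ρ.deltas l (ρ.vf i) 1 v = 0 := by
    intro v
    simp [hQ]
  have hscomm : ∀ {T : Module.End ℂ V}, (∀ i, ∀ l : List (Idx q n), 2 ≤ l.length → ∃ c : ℂ,
      ρ.deltas l (ρ.vf i) 1 * T = c • (T * ρ.deltas l (ρ.vf i) 1)) →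
      ∀ v ∈ Q, T v ∈ Q := by
    intro T hT v hv
    rw [hmem] at hv ⊢
    intro x l hl
    obtain ⟨c, hc⟩ := hT x l hl
    rw [← Module.End.mul_apply, hc, LinearMap.smul_apply, Module.End.mul_apply, hv x l hl, map_zero,
      smul_zero]
  have hQtop : Q = ⊤ := by
    refine (hs.eq_bot_or_eq_top h ?_ ?_ ?_ ?_ ?_).resolve_left ?_
    · exact hscomm fun i l hl => ⟨ksign 1 (par i + listPar l), by
        rw [(h.isConst_deltas_vf i (hne hl)).s_mul, smul_smul, ksign_mul_self, one_smul]⟩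
    · exact fun a => hscomm fun i l hl => ⟨_, (h.isConst_deltas_vf i (hne hl)).mul_t a⟩
    · exact fun a => hscomm fun i l hl => ⟨_, (h.isConst_deltas_vf i (hne hl)).mul_D a⟩
    · intro x l'
      rcases eq_or_ne l' [] with rfl | hl'
      · exact hscomm fun i l hl => ⟨1, by
          rw [one_smul]; exact (h.actK_one_mul_deltas_vf x i (hne hl)).symm⟩
      · intro v _
        rw [hK x l' hl', LinearMap.zero_apply]
        exact zero_mem _
    · intro k l' hl' v hv
      rw [hmem] at hv
      -- Fields of order at least two kill `v` outright, so their mutual brackets never enter;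
      -- linear fields preserve the order.
      match l' with
      | [] => exact absurd rfl hl'
      | a :: b :: l' =>
        rw [hv k _ (by simp)]
        exact zero_mem _
      | [j] =>
        rw [hmem]
        intro i l hl
        have h1 := h.delta_vf_mul_deltas_vf_sub_mem i j k (hne hl)
        have h2 : (ρ.delta j (ρ.vf k) 1 * ρ.deltas l (ρ.vf i) 1 -
            ksign (par j + par k) (par i + listPar l) •
              (ρ.deltas l (ρ.vf i) 1 * ρ.delta j (ρ.vf k) 1)) v = 0 := by
          refine (Submodule.span_le (p := LinearMap.ker (LinearMap.applyₗ v))).2 ?_ h1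
          rintro _ ⟨i', l'', hl'', rfl⟩
          exact hv i' l'' (by omega)
        rw [LinearMap.sub_apply, LinearMap.smul_apply, Module.End.mul_apply, Module.End.mul_apply,
          hv i l hl, map_zero, zero_sub, neg_eq_zero, smul_eq_zero] at h2
        exact h2.resolve_left (ksign_ne_zero _ _)
    · refine (Submodule.ne_bot_iff _).2 ⟨v, hmem.2 fun i l hl => ?_, hv0⟩
      exact hv _ _ (l.length - 1) (h.isConst_deltas_vf i (hne hl))
        (h.isNeutral_deltas_vf i (hne hl)) (by omega) (hFT i l hl)
  refine LinearMap.ext fun v => ?_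
  have : v ∈ Q := hQtop ▸ Submodule.mem_top
  exact hmem.1 this i l hl

end IsModule

end AkAction

end Brackets

/-! ### Simplicity of the space of intertwiners -/

section LinearAlgebra

theorem exists_proj_of_bijective {ι M N : Type*} [AddCommGroup M] [Module ℂ M] [AddCommGroup N]
    [Module ℂ N] {gM : ι → Module.End ℂ M} {gN : ι → Module.End ℂ N}
    (hbij : Function.Bijective (evalIntertwiners gM gN)) [Nontrivial M] :
    ∃ (f : M →ₗ[ℂ] ℂ) (m : M) (G : N →ₗ[ℂ] intertwiners gM gN), f m = 1 ∧
      ∀ (ψ : intertwiners gM gN) x, G (ψ.1 x) = f x • ψ := by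
  obtain ⟨m, hm⟩ := exists_ne (0 : M)
  obtain ⟨f, hf⟩ : ∃ f : Module.Dual ℂ M, f m ≠ 0 := by
    by_contra! hcon
    exact hm ((Module.forall_dual_apply_eq_zero_iff ℂ _).1 hcon)
  let e := LinearEquiv.ofBijective _ hbij
  refine ⟨f, (f m)⁻¹ • m, (TensorProduct.lid ℂ _).toLinearMap ∘ₗ f.rTensor _ ∘ₗ
    e.symm.toLinearMap, by simp [inv_mul_cancel₀ hf], fun ψ x => ?_⟩
  have : e.symm (ψ.1 x) = x ⊗ₜ ψ := by
    rw [LinearEquiv.symm_apply_eq]; rfl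
  simp [this]

/-- The images of a nonzero invariant space of intertwiners span an invariant subspace of `N`, hence
everything; contracting the factor `M` recovers every intertwiner. -/
theorem intertwiners_simple {ι κ M N : Type*} [AddCommGroup M] [Module ℂ M] [AddCommGroup N]
    [Module ℂ N] [Nontrivial M] {gM : ι → Module.End ℂ M} {g : ι → Module.End ℂ N}
    {t : κ → Module.End ℂ N} (hcomm : ∀ i k, g i * t k = t k * g i)
    (hsimple : ∀ Q : Submodule ℂ N, (∀ i, ∀ v ∈ Q, g i v ∈ Q) → (∀ k, ∀ v ∈ Q, t k v ∈ Q) →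
      Q = ⊥ ∨ Q = ⊤) (hbij : Function.Bijective (evalIntertwiners gM g))
    {Q : Submodule ℂ (intertwiners gM g)}
    (hQ : ∀ k, ∀ ψ ∈ Q, ∀ ψ' : intertwiners gM g, ψ'.1 = t k ∘ₗ ψ.1 → ψ' ∈ Q) :
    Q = ⊥ ∨ Q = ⊤ := by
  by_cases h0 : Q = ⊥
  · exact Or.inl h0
  right
  obtain ⟨f, m, G, hf, hG⟩ := exists_proj_of_bijective hbij
  set R : Submodule ℂ N := ⨆ ψ ∈ Q, LinearMap.range ψ.1 with hR
  have hmem : ∀ ψ ∈ Q, ∀ x, ψ.1 x ∈ R := fun ψ hψ x =>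
    (le_iSup₂ (f := fun ψ (_ : ψ ∈ Q) => LinearMap.range ψ.1) ψ hψ) ⟨x, rfl⟩
  have hstab : ∀ T : Module.End ℂ N, (∀ ψ ∈ Q, ∀ x, T (ψ.1 x) ∈ R) → ∀ v ∈ R, T v ∈ R := by
    intro T hT
    have : R ≤ R.comap T := iSup₂_le fun ψ hψ => by
      rintro _ ⟨x, rfl⟩
      exact hT ψ hψ x
    exact this
  have hRtop : R = ⊤ := by
    refine (hsimple R (fun i => hstab _ fun ψ hψ x => ?_) (fun k => hstab _ fun ψ hψ x => ?_)
      ).resolve_left ?_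
    · rw [← ψ.2]; exact hmem ψ hψ _
    · exact hmem ⟨t k ∘ₗ ψ.1, fun i x => by
        rw [LinearMap.comp_apply, ψ.2, ← Module.End.mul_apply, ← hcomm]; rfl⟩ (hQ k ψ hψ _ rfl) x
    · intro hbot
      obtain ⟨ψ, hψ, hψ0⟩ := (Submodule.ne_bot_iff Q).1 h0
      refine hψ0 (Subtype.ext (LinearMap.ext fun x => ?_))
      have := hmem ψ hψ x
      rwa [hbot, Submodule.mem_bot] at this
  rw [eq_top_iff]
  intro ψ _
  have h1 : R ≤ Q.comap G := iSup₂_le fun ψ hψ => by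
    rintro _ ⟨x, rfl⟩
    rw [Submodule.mem_comap, hG]
    exact Submodule.smul_mem _ _ hψ
  have h2 := h1 (hRtop ▸ Submodule.mem_top : ψ.1 m ∈ R)
  rwa [Submodule.mem_comap, hG, hf, one_smul] at h2

/-- The eigenspaces of an involution, as the parts of a grading. -/
def involutionPart {M : Type*} [AddCommGroup M] [Module ℂ M] (s : Module.End ℂ M) (d : ZMod 2) :
    Submodule ℂ M := Module.End.eigenspace s (ksign 1 d)

theorem mem_involutionPart {M : Type*} [AddCommGroup M] [Module ℂ M] {s : Module.End ℂ M}
    {d : ZMod 2} {m : M} : m ∈ involutionPart s d ↔ s m = ksign 1 d • m :=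
  Module.End.mem_eigenspace_iff

theorem isCompl_involutionPart {M : Type*} [AddCommGroup M] [Module ℂ M] {s : Module.End ℂ M}
    (hs : s * s = 1) : IsCompl (involutionPart s 0) (involutionPart s 1) := by
  have hs' : ∀ m, s (s m) = m := fun m => congrArg (fun f : Module.End ℂ M => f m) hs
  constructor
  · rw [Submodule.disjoint_def]
    intro m h0 h1
    rw [mem_involutionPart] at h0 h1
    rw [h0, ksign_one_one, ksign_zero_right, one_smul, neg_smul, one_smul] at h1
    have h2 : (2 : ℂ) • m = 0 := by rw [two_smul]; nth_rewrite 2 [h1]; exact add_neg_cancel m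
    exact (smul_eq_zero.1 h2).resolve_left two_ne_zero
  · rw [codisjoint_iff, eq_top_iff]
    intro m _
    refine Submodule.mem_sup.2 ⟨(2⁻¹ : ℂ) • (m + s m), ?_, (2⁻¹ : ℂ) • (m - s m), ?_, by module⟩
    · rw [mem_involutionPart, map_smul, map_add, hs', ksign_zero_right, one_smul, add_comm]
    · rw [mem_involutionPart, map_smul, map_sub, hs', ksign_one_one]
      module

theorem signOp_involutionPart {M : Type*} [AddCommGroup M] [Module ℂ M] {s : Module.End ℂ M}
    (hs : s * s = 1) : signOp (isCompl_involutionPart hs) 1 = s :=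
  end_ext_of_isCompl (isCompl_involutionPart hs) fun e m hm => by
    rw [signOp_of_mem _ _ hm, mem_involutionPart.1 hm]

end LinearAlgebra

/-! ### Levi subalgebras -/

/-- The conjugated matrix units lying in the blocks span. Diagonal ones are in the Cartan
subalgebra, and `[e_ij, e_jj] = e_ij` for `i ≠ j`. -/
theorem IsLevi.exists_spanning {p : ℕ} {𝔨 : LieSubalgebra ℂ (Matrix (Fin p) (Fin p) ℂ)}
    {𝔥 : LieSubalgebra ℂ 𝔨} (hl : IsLevi 𝔨 𝔥) :
    (∀ x ∈ 𝔥, ∀ y ∈ 𝔥, ⁅x, y⁆ = 0) ∧ ∃ S : Set 𝔨, S.Finite ∧ Submodule.span ℂ S = ⊤ ∧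
      ∀ y ∈ S, y ∈ 𝔥 ∨ ∃ z ∈ 𝔥, ⁅y, z⁆ = y := by
  obtain ⟨g, r, hk, hh⟩ := hl
  set G := g.val with hG
  set G' := g⁻¹.val with hG'
  have hGG' : G * G' = 1 := g.mul_inv
  have hG'G : G' * G = 1 := g.inv_mul
  have hconj : ∀ x y : Matrix (Fin p) (Fin p) ℂ,
      G * (x * y) * G' = (G * x * G') * (G * y * G') := by
    intro x y
    calc G * (x * y) * G' = G * x * 1 * y * G' := by simp only [mul_assoc, one_mul]
      _ = _ := by rw [← hG'G]; simp only [mul_assoc]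
  have hinv : ∀ x : Matrix (Fin p) (Fin p) ℂ, G' * (G * x * G') * G = x := by
    intro x
    calc G' * (G * x * G') * G = (G' * G) * x * (G' * G) := by simp only [mul_assoc]
      _ = x := by rw [hG'G, one_mul, mul_one]
  have hinv' : ∀ x : Matrix (Fin p) (Fin p) ℂ, G * (G' * x * G) * G' = x := by
    intro x
    calc G * (G' * x * G) * G' = (G * G') * x * (G * G') := by simp only [mul_assoc]
      _ = x := by rw [hGG', one_mul, mul_one]
  have hdiag : ∀ x ∈ 𝔥, ∃ v : Fin p → ℂ, G * x.val * G' = Matrix.diagonal v := by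
    intro x hx
    refine ⟨fun i => (G * x.val * G') i i, Matrix.ext fun i j => ?_⟩
    rcases eq_or_ne i j with rfl | hij
    · simp
    · rw [(hh x).1 hx i j hij, Matrix.diagonal_apply_ne _ hij]
  refine ⟨fun x hx y hy => Subtype.ext ?_, ?_⟩
  · obtain ⟨v, hv⟩ := hdiag x hx
    obtain ⟨v', hv'⟩ := hdiag y hy
    rw [LieSubalgebra.coe_bracket, LieRing.of_associative_ring_bracket]
    have h1 : G * (x.val * y.val) * G' = G * (y.val * x.val) * G' := by
      rw [hconj, hconj, hv, hv', Matrix.diagonal_mul_diagonal, Matrix.diagonal_mul_diagonal]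
      simp only [mul_comm]
    rw [← hinv (x.val * y.val), h1, hinv, sub_self]
    rfl
  · let e : Fin p → Fin p → Matrix (Fin p) (Fin p) ℂ := fun i j => G' * Matrix.single i j 1 * G
    have he : ∀ i j, r i j → e i j ∈ 𝔨 := by
      intro i j hij
      rw [hk]
      intro a b hab
      rw [hinv', Matrix.single_apply_of_ne]
      rintro ⟨rfl, rfl⟩
      exact hab hij
    have hmul : ∀ i j a b, e i j * e a b = if j = a then e i b else 0 := by
      intro i j a b
      calc e i j * e a b = G' * (Matrix.single i j 1 * (G * G') * Matrix.single a b 1) * G := by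
            simp only [e, mul_assoc]
        _ = _ := by
          rw [hGG', mul_one]
          split_ifs with hja
          · subst hja; rw [Matrix.single_mul_single_same, one_mul]
          · rw [Matrix.single_mul_single_of_ne _ _ _ _ hja]; simp
    let f : {a : Fin p × Fin p // r a.1 a.2} → 𝔨 := fun a => ⟨e a.1.1 a.1.2, he _ _ a.2⟩
    have hediag : ∀ j, (⟨e j j, he j j (r.refl j)⟩ : 𝔨) ∈ 𝔥 := by
      intro j
      rw [hh]
      intro a b hab
      rw [hinv', Matrix.single_apply_of_ne]
      rintro ⟨rfl, rfl⟩
      exact hab rfl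
    classical
    refine ⟨Set.range f, Set.finite_range f, ?_, ?_⟩
    · rw [eq_top_iff]
      rintro x -
      have hx : x = ∑ a : {a : Fin p × Fin p // r a.1 a.2}, (G * x.val * G') a.1.1 a.1.2 • f a := by
        refine Subtype.ext ?_
        rw [AddSubmonoidClass.coe_finsetSum]
        have h1 : x.val = ∑ a : Fin p × Fin p, (G * x.val * G') a.1 a.2 • e a.1 a.2 := by
          conv_lhs => rw [← hinv x.val, Matrix.matrix_eq_sum_single (G * x.val * G')]
          rw [Fintype.sum_prod_type]
          simp only [Finset.mul_sum, Finset.sum_mul, e]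
          refine Finset.sum_congr rfl fun i _ => Finset.sum_congr rfl fun j _ => ?_
          rw [← smul_mul_assoc, ← mul_smul_comm, Matrix.smul_single, smul_eq_mul, mul_one]
        conv_lhs => rw [h1]
        rw [← Finset.sum_filter_of_ne (p := fun a : Fin p × Fin p => r a.1 a.2) (fun a _ ha => by
          by_contra hr
          exact ha (by rw [(hk x.val).1 x.2 _ _ hr, zero_smul]))]
        exact Finset.sum_subtype _ (by simp) _
      rw [hx]
      exact Submodule.sum_mem _ fun a _ => Submodule.smul_mem _ _ (Submodule.subset_span ⟨a, rfl⟩)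
    · rintro _ ⟨⟨⟨i, j⟩, hij⟩, rfl⟩
      rcases eq_or_ne i j with rfl | hne
      · exact Or.inl (hediag i)
      · refine Or.inr ⟨_, hediag j, Subtype.ext ?_⟩
        rw [LieSubalgebra.coe_bracket, LieRing.of_associative_ring_bracket]
        change e i j * e j j - e j j * e i j = e i j
        rw [hmul, hmul, if_pos rfl, if_neg hne.symm, sub_zero]

/-! ### The action of the general linear Lie superalgebra -/

section GeneralLinear

variable {q n : ℕ} {𝔨 : Type*} [LieRing 𝔨] [LieAlgebra ℂ 𝔨] {V : Type*} [AddCommGroup V]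
  [Module ℂ V]

theorem scomm_mem_glPart {d e : ZMod 2} {X Y : Matrix (Idx q n) (Idx q n) ℂ}
    (hX : X ∈ glPart q n d) (hY : Y ∈ glPart q n e) : scomm d e X Y ∈ glPart q n (d + e) := by
  have key : ∀ {d e : ZMod 2} {X Y : Matrix (Idx q n) (Idx q n) ℂ}, X ∈ glPart q n d →
      Y ∈ glPart q n e → X * Y ∈ glPart q n (d + e) := by
    intro d e X Y hX hY i j hij
    rw [Matrix.mul_apply]
    refine Finset.sum_eq_zero fun k _ => ?_
    by_cases h1 : par i + par k = d
    · by_cases h2 : par k + par j = e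
      · exfalso
        refine hij ?_
        rw [← h1, ← h2, add_assoc, ← add_assoc (par k), zmod_two_add_self, zero_add]
      · rw [hY k j h2, mul_zero]
    · rw [hX i k h1, zero_mul]
  intro i j hij
  have h1 := key hX hY i j hij
  have h2 := key hY hX i j (by rwa [add_comm e])
  simp [scomm, h1, h2]

namespace AkAction

variable (ρ : AkAction q n 𝔨 V)

/-- The operator by which the matrix unit `E_{k,i}` acts. -/
def unit (k i : Idx q n) : Module.End ℂ V := ρ.delta k (ρ.vf i) 1

/-- The operator by which a matrix acts. -/
def glAct (X : Matrix (Idx q n) (Idx q n) ℂ) : Module.End ℂ V :=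
  ∑ k, ∑ i, X k i • ρ.unit k i

variable {ρ} (h : ρ.IsModule)

namespace IsModule

theorem isConst_unit (k i : Idx q n) : h.IsConst (ρ.unit k i) (par k + par i) := by
  simpa [unit, add_comm] using h.isConst_deltas_vf i (l := [k]) (by simp)

include h

/-- The linear fields `t_j ∂_k` satisfy the relations of the matrix units `E_{j,k}` of the general
linear Lie superalgebra. -/
theorem unit_mul_unit (j k l i : Idx q n) : ρ.unit j k * ρ.unit l i =
    (if k = l then ρ.unit j i else 0) -
      ksign (par j + par k) (par l + par i) • (if i = j then ρ.unit l k else 0) +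
      ksign (par j + par k) (par l + par i) • (ρ.unit l i * ρ.unit j k) := by
  have := ((h.hasAd_delta_vf_vf i j k).deltas (h := h) (h.isConst_unit j k) [l]).apply_one
  simp only [deltas_cons, deltas_nil, listPar_cons, listPar_nil, add_zero, map_sub, map_smul,
    h.delta_actA_mul, sub_zero, LinearMap.smul_apply, LinearMap.sub_apply, delta_comp_derR,
    LinearMap.add_apply, LinearMap.comp_apply, A.derR_one, map_zero, smul_zero, zero_add] at this
  rw [unit, unit, this, add_comm (par i), smul_sub]
  congr 2
  · split_ifs with hkl
    · subst hkl
      rw [smul_smul, ksign_mul_self, one_smul]; rfl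
    · simp
  · split_ifs with hij
    · rw [smul_smul, ksign_add_right]; rfl
    · simp

theorem glAct_scomm {d e : ZMod 2} {X Y : Matrix (Idx q n) (Idx q n) ℂ} (hX : X ∈ glPart q n d)
    (hY : Y ∈ glPart q n e) :
    ρ.glAct (scomm d e X Y) = scomm d e (ρ.glAct X) (ρ.glAct Y) := by
  have hmul : ∀ X Y : Matrix (Idx q n) (Idx q n) ℂ, ρ.glAct X * ρ.glAct Y =
      ∑ j, ∑ k, ∑ l, ∑ i, (X j k * Y l i) • (ρ.unit j k * ρ.unit l i) := by
    intro X Y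
    unfold glAct
    simp only [Finset.sum_mul]
    simp only [Finset.mul_sum, smul_mul_smul_comm]
  -- Nonzero entries of homogeneous matrices sit in positions of the right parity, so the sign is
  -- the same for all contributing terms.
  have hsign : ∀ j k l i, (X j k * Y l i) * ksign (par j + par k) (par l + par i) =
      ksign d e * (X j k * Y l i) := by
    intro j k l i
    by_cases h1 : par j + par k = d
    · by_cases h2 : par l + par i = e
      · rw [h1, h2, mul_comm]
      · rw [hY l i h2]; simp
    · rw [hX j k h1]; simp
  have h1 : ρ.glAct (X * Y) =
      ∑ j, ∑ k, ∑ l, ∑ i, (X j k * Y l i) • (if k = l then ρ.unit j i else 0) := by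
    simp only [glAct, Matrix.mul_apply, Finset.sum_smul, smul_ite, smul_zero]
    refine Finset.sum_congr rfl fun j _ => ?_
    rw [Finset.sum_comm]
    refine Finset.sum_congr rfl fun k _ => ?_
    rw [Finset.sum_comm]
    refine Finset.sum_congr rfl fun i _ => ?_
    rw [Finset.sum_ite_eq]
    simp
  have h2 : ρ.glAct (Y * X) =
      ∑ j, ∑ k, ∑ l, ∑ i, (X j k * Y l i) • (if i = j then ρ.unit l k else 0) := by
    simp only [glAct, Matrix.mul_apply, Finset.sum_smul, smul_ite, smul_zero, Finset.sum_ite_eq',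
      Finset.mem_univ, if_true, mul_comm (Y _ _)]
    rw [Finset.sum_comm]
    refine (Finset.sum_congr rfl fun k _ => Finset.sum_comm).trans ?_
    rw [Finset.sum_comm]
  have h3 : ρ.glAct X * ρ.glAct Y = ρ.glAct (X * Y) - ksign d e • ρ.glAct (Y * X) +
      ksign d e • (ρ.glAct Y * ρ.glAct X) := by
    have h4 : ρ.glAct Y * ρ.glAct X =
        ∑ j, ∑ k, ∑ l, ∑ i, (X j k * Y l i) • (ρ.unit l i * ρ.unit j k) := by
      rw [hmul]
      refine (Finset.sum_congr rfl fun l _ => Finset.sum_comm).trans ?_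
      rw [Finset.sum_comm]
      refine Finset.sum_congr rfl fun j _ => ?_
      refine (Finset.sum_congr rfl fun l _ => Finset.sum_comm).trans ?_
      rw [Finset.sum_comm]
      simp only [mul_comm]
    rw [hmul, h1, h2, h4]
    simp only [Finset.smul_sum, ← Finset.sum_sub_distrib, ← Finset.sum_add_distrib, smul_smul,
      ← hsign]
    refine Finset.sum_congr rfl fun j _ => Finset.sum_congr rfl fun k _ =>
      Finset.sum_congr rfl fun l _ => Finset.sum_congr rfl fun i _ => ?_
    rw [h.unit_mul_unit, smul_add, smul_sub, smul_smul, smul_smul]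
  have hadd : ∀ (c : ℂ) (X Y : Matrix (Idx q n) (Idx q n) ℂ),
      ρ.glAct (X - c • Y) = ρ.glAct X - c • ρ.glAct Y := by
    intro c X Y
    simp only [glAct, Matrix.sub_apply, Matrix.smul_apply, sub_smul, Finset.sum_sub_distrib,
      Finset.smul_sum, smul_assoc]
  rw [scomm, hadd, scomm, h3]
  abel

end IsModule

end AkAction

end GeneralLinear

/-! ### The modules over the Weyl superalgebra, over `𝔤𝔩_{q,n}` and over `𝔨` -/

section Factors

variable {q n : ℕ}

theorem map_scomm {R R' : Type*} [Ring R] [Algebra ℂ R] [Ring R'] [Algebra ℂ R'] (f : R →ₐ[ℂ] R')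
    (d e : ZMod 2) (x y : R) : f (scomm d e x y) = scomm d e (f x) (f y) := by
  simp [scomm]

/-- The universal property of the Weyl superalgebra. -/
def Weyl.lift {R : Type*} [Ring R] [Algebra ℂ R] (f : A q n →ₐ[ℂ] R) (D : Idx q n → R)
    (hl : ∀ i e, ∀ a ∈ A.part q n e, scomm (par i) e (D i) (f a) = f (A.der i a))
    (hc : ∀ i j, scomm (par i) (par j) (D i) (D j) = 0) : Weyl q n →ₐ[ℂ] R :=
  RingQuot.liftAlgHom ℂ ⟨FreeAlgebra.lift ℂ (Sum.elim f D), fun x y hxy => by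
    cases hxy with
    | one => simp
    | add a b => simp
    | smul c a => simp
    | mul a b => simp
    | leibniz i e a ha => simpa [map_scomm] using hl i e a ha
    | comm i j => simpa [map_scomm] using hc i j⟩

theorem Weyl.lift_ofA {R : Type*} [Ring R] [Algebra ℂ R] (f : A q n →ₐ[ℂ] R) (D : Idx q n → R)
    (hl : ∀ i e, ∀ a ∈ A.part q n e, scomm (par i) e (D i) (f a) = f (A.der i a))
    (hc : ∀ i j, scomm (par i) (par j) (D i) (D j) = 0) (a : A q n) :
    Weyl.lift f D hl hc (Weyl.ofA q n a) = f a := by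
  refine (RingQuot.liftAlgHom_mkAlgHom_apply ℂ _ _ _).trans ?_
  simp

theorem Weyl.lift_der {R : Type*} [Ring R] [Algebra ℂ R] (f : A q n →ₐ[ℂ] R) (D : Idx q n → R)
    (hl : ∀ i e, ∀ a ∈ A.part q n e, scomm (par i) e (D i) (f a) = f (A.der i a))
    (hc : ∀ i j, scomm (par i) (par j) (D i) (D j) = 0) (i : Idx q n) :
    Weyl.lift f D hl hc (Weyl.der i) = D i := by
  refine (RingQuot.liftAlgHom_mkAlgHom_apply ℂ _ _ _).trans ?_
  simp

variable {𝔨 : Type*} [LieRing 𝔨] [LieAlgebra ℂ 𝔨] {V : Type*} [AddCommGroup V] [Module ℂ V]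

/-- Composition of intertwiners with an operator commuting with the target family. -/
def intertwiners.postcomp {ι M N : Type*} [AddCommGroup M] [Module ℂ M] [AddCommGroup N]
    [Module ℂ N] {gM : ι → Module.End ℂ M} {gN : ι → Module.End ℂ N} (t : Module.End ℂ N)
    (ht : ∀ i, gN i * t = t * gN i) : Module.End ℂ (intertwiners gM gN) where
  toFun ψ := ⟨t ∘ₗ ψ.1, fun i m => by
    rw [LinearMap.comp_apply, ψ.2, ← Module.End.mul_apply, ← ht]; rfl⟩
  map_add' ψ ψ' := by ext; simp
  map_smul' c ψ := by ext; simp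

/-- The action of `𝔨` on the space of intertwiners into a `𝔨`-module. -/
def intertwinersModule {ι M N : Type*} [AddCommGroup M] [Module ℂ M] [AddCommGroup N] [Module ℂ N]
    {gM : ι → Module.End ℂ M} {gN : ι → Module.End ℂ N} (κ : 𝔨 →ₗ⁅ℂ⁆ Module.End ℂ N)
    (hcomm : ∀ i x, gN i * κ x = κ x * gN i) : EvenLieModule 𝔨 (intertwiners gM gN) where
  -- Purely even: in the application the parity operator is one of the intertwined operators, so
  -- every intertwiner preserves parity.
  part d := if d = 0 then ⊤ else ⊥
  isCompl := isCompl_top_bot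
  act :=
    { toFun := fun x => intertwiners.postcomp (κ x) fun i => hcomm i x
      map_add' := fun x y => by
        refine LinearMap.ext fun ψ => Subtype.ext (LinearMap.ext fun m => ?_)
        exact congrArg (fun T : Module.End ℂ N => T (ψ.1 m)) (map_add κ x y)
      map_smul' := fun c x => by
        refine LinearMap.ext fun ψ => Subtype.ext (LinearMap.ext fun m => ?_)
        exact congrArg (fun T : Module.End ℂ N => T (ψ.1 m)) (map_smul κ c x)
      map_lie' := fun {x y} => by
        refine LinearMap.ext fun ψ => Subtype.ext (LinearMap.ext fun m => ?_)
        exact congrArg (fun T : Module.End ℂ N => T (ψ.1 m)) (LieHom.map_lie κ x y) }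
  act_homogeneous x e ψ hψ := by
    rw [zero_add]
    beta_reduce at hψ ⊢
    split_ifs at hψ ⊢ with he
    · trivial
    · rw [Submodule.mem_bot] at hψ ⊢
      rw [hψ, map_zero]

/-! ### The actions on the Weyl factor and on its multiplicity space. -/

namespace AkAction.Vac

variable {ρ : AkAction q n 𝔨 V} {h : ρ.IsModule} (w : Vac h)

theorem actA_mem (a : A q n) : ∀ p ∈ w.P, ρ.actA a p ∈ w.P := by
  induction a using A.induction_mul_gen with
  | one => rw [h.actA_one]; exact fun p hp => hp
  | add x y hx hy => intro p hp; rw [map_add]; exact add_mem (hx p hp) (hy p hp)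
  | smul c x hx => intro p hp; rw [map_smul]; exact Submodule.smul_mem _ _ (hx p hp)
  | mul_gen x j hx => intro p hp; rw [h.actA_mul]; exact hx _ (w.t_mem j p hp)

/-- The action of `A` on `w.P`. -/
def actP : A q n →ₐ[ℂ] Module.End ℂ w.P :=
  AlgHom.ofLinearMap
    { toFun := fun a => (ρ.actA a).restrict (w.actA_mem a)
      map_add' := fun a b => by ext p; simp
      map_smul' := fun c a => by ext p; simp }
    (by ext p; simp [h.actA_one])
    (fun a b => by ext p; simp [h.actA_mul])

/-- The action of the derivatives on `w.P`. -/
def actD (i : Idx q n) : Module.End ℂ w.P := (ρ.D i).restrict (w.D_mem i)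

theorem coe_actP (a : A q n) (p : w.P) : (w.actP a p : V) = ρ.actA a p := rfl

theorem coe_actD (i : Idx q n) (p : w.P) : (w.actD i p : V) = ρ.D i p := rfl

theorem actD_scomm_actP (i : Idx q n) (e : ZMod 2) (a : A q n) (ha : a ∈ A.part q n e) :
    scomm (par i) e (w.actD i) (w.actP a) = w.actP (A.der i a) := by
  refine LinearMap.ext fun p => Subtype.ext ?_
  have h1 := congrArg (fun T : Module.End ℂ V => T p) (h.D_mul_actA i a)
  simp only [Module.End.mul_apply, LinearMap.add_apply] at h1
  change ρ.D i (ρ.actA a p) - ksign (par i) e • ρ.actA a (ρ.D i p) = ρ.actA (A.der i a) p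
  rw [h1, A.sgn_of_mem _ ha, map_smul, LinearMap.smul_apply, add_sub_cancel_right]

theorem actD_scomm_actD (i j : Idx q n) :
    scomm (par i) (par j) (w.actD i) (w.actD j) = 0 := by
  refine LinearMap.ext fun p => Subtype.ext ?_
  have h1 := congrArg (fun T : Module.End ℂ V => T p) (h.D_mul_D i j)
  change ρ.D i (ρ.D j p) - ksign (par i) (par j) • ρ.D j (ρ.D i p) = 0
  exact sub_eq_zero.2 h1

/-- The factor of `V` which is a module over the Weyl superalgebra. -/
def weylModule : WeylModule q n w.P where
  part := w.part
  isCompl := w.isCompl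
  act := Weyl.lift w.actP w.actD w.actD_scomm_actP w.actD_scomm_actD
  ofA_homogeneous d a ha e p hp := by
    rw [Weyl.lift_ofA, w.mem_part, coe_actP, add_assoc]
    exact h.actA_homogeneous d a ha _ _ hp
  der_homogeneous i e p hp := by
    rw [Weyl.lift_der, w.mem_part, coe_actD, add_assoc]
    have := h.vf_homogeneous i A.one_mem (e + w.deg) p hp
    rwa [zero_add] at this

theorem weylModule_act_ofA (a : A q n) : w.weylModule.act (Weyl.ofA q n a) = w.actP a :=
  Weyl.lift_ofA _ _ w.actD_scomm_actP w.actD_scomm_actD a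

theorem weylModule_act_der (i : Idx q n) : w.weylModule.act (Weyl.der i) = w.actD i :=
  Weyl.lift_der _ _ w.actD_scomm_actP w.actD_scomm_actD i

theorem weylModule_twist (d : ZMod 2) : w.weylModule.twist d = w.tau d := rfl

theorem gP_inl (a : Idx q n) : w.gP (.inl a) = w.weylModule.act (Weyl.ofA q n (A.gen a)) := by
  rw [weylModule_act_ofA]; rfl

theorem gP_inr (a : Idx q n) : w.gP (.inr a) = w.weylModule.act (Weyl.der a) := by
  rw [weylModule_act_der]; rfl

theorem weylModule_isSimple : w.weylModule.IsSimple := by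
  refine ⟨⟨w.vP, 0, fun h0 => w.ne_zero (congrArg Subtype.val h0)⟩, fun Q _ hQ => ?_⟩
  refine w.P_simple Q ?_
  rintro (a | a)
  · rw [gP_inl]; exact hQ _ ⟨_, rfl⟩
  · rw [gP_inr]; exact hQ _ ⟨_, rfl⟩

theorem weylModule_isWeight : w.weylModule.IsWeight := by
  rw [WeylModule.IsWeight, IsWeight, eq_top_iff]
  rintro ⟨p, hp⟩ -
  have h1 : w.P ≤ (⨆ wt : Idx q n → ℂ, wtSpace (fun i : Idx q n =>
      w.weylModule.act (Weyl.ofA q n (A.gen i) * Weyl.der i)) wt).map w.P.subtype := by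
    refine Submodule.span_le.2 ?_
    rintro _ ⟨m, rfl⟩
    refine ⟨⟨_, ρ.monomial_mem_vacModule w.v m⟩, ?_, rfl⟩
    refine Submodule.mem_iSup_of_mem (fun a => w.lam a + m a) (mem_wtSpace.2 fun a => ?_)
    refine Subtype.ext ?_
    rw [map_mul, weylModule_act_ofA, weylModule_act_der]
    exact mem_wtSpace.1 (h.monomial_mem_wtSpace w.isVac m) a
  obtain ⟨p', hp', h2⟩ := h1 hp
  rwa [← show p' = ⟨p, hp⟩ from Subtype.ext h2]

theorem apply_actP {φ : w.P →ₗ[ℂ] V} (hφ : φ ∈ w.N) (a : A q n) (p : w.P) :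
    φ (w.actP a p) = ρ.actA a (φ p) := by
  induction a using A.induction_mul_gen generalizing p with
  | one => rw [map_one, h.actA_one]; rfl
  | add x y hx hy => rw [map_add, LinearMap.add_apply, map_add, hx, hy, map_add]; rfl
  | smul c x hx => rw [map_smul, LinearMap.smul_apply, map_smul, hx, map_smul]; rfl
  | mul_gen x j hx =>
    rw [map_mul, Module.End.mul_apply, hx, h.actA_mul, Module.End.mul_apply]
    congr 1
    exact hφ (.inl j) p

theorem apply_actD {φ : w.P →ₗ[ℂ] V} (hφ : φ ∈ w.N) (i : Idx q n) (p : w.P) :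
    φ (w.actD i p) = ρ.D i (φ p) := hφ (.inr i) p

/-- The space `w.N`, as a vector space in its own right. -/
def Mult : Type _ := w.N

instance : AddCommGroup w.Mult := inferInstanceAs (AddCommGroup w.N)

instance : Module ℂ w.Mult := inferInstanceAs (Module ℂ w.N)

/-- The elements of `w.Mult` as linear maps. -/
def val : w.Mult →ₗ[ℂ] (w.P →ₗ[ℂ] V) := w.N.subtype

theorem val_mem (φ : w.Mult) : w.val φ ∈ w.N := Subtype.property (p := (· ∈ w.N)) φ

theorem val_injective : Function.Injective w.val := w.N.injective_subtype

theorem exists_val {φ : w.P →ₗ[ℂ] V} (hφ : φ ∈ w.N) : ∃ φ', w.val φ' = φ := ⟨⟨φ, hφ⟩, rfl⟩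

theorem map_val_top : (⊤ : Submodule ℂ w.Mult).map w.val = w.N := Submodule.map_subtype_top w.N

/-- The parity operator and the operators of the matrix units on `w.N`. -/
def g : Option (Idx q n × Idx q n) → Module.End ℂ w.Mult
  | none => (w.hat 1 (h.s 1)).restrict fun _ hφ => w.hat_s_mem 1 hφ
  | some a => (w.hat (par a.1 + par a.2) (ρ.unit a.1 a.2)).restrict
      fun _ hφ => w.hat_const_mem (h.isConst_unit a.1 a.2) hφ

/-- The operators of `𝔨` on `w.N`. -/
def k (x : 𝔨) : Module.End ℂ w.Mult :=
  (w.hat 0 (ρ.actK x 1)).restrict fun _ hφ => w.hat_const_mem (h.isConst_actK_one x) hφ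

theorem val_g_none (φ : w.Mult) : w.val (w.g none φ) = w.hat 1 (h.s 1) (w.val φ) := rfl

theorem val_g_some (a : Idx q n × Idx q n) (φ : w.Mult) : w.val (w.g (some a) φ) =
    w.hat (par a.1 + par a.2) (ρ.unit a.1 a.2) (w.val φ) := rfl

theorem val_k (x : 𝔨) (φ : w.Mult) : w.val (w.k x φ) = w.hat 0 (ρ.actK x 1) (w.val φ) := rfl

theorem g_mul_k (i : Option (Idx q n × Idx q n)) (x : 𝔨) : w.g i * w.k x = w.k x * w.g i := by
  refine LinearMap.ext fun φ => w.val_injective ?_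
  cases i with
  | none =>
    change (w.hat 1 (h.s 1) * w.hat 0 (ρ.actK x 1)) (w.val φ) =
      (w.hat 0 (ρ.actK x 1) * w.hat 1 (h.s 1)) (w.val φ)
    rw [hat_mul_hat, hat_mul_hat, (h.isConst_actK_one x).s_mul, add_comm, ksign_zero_right,
      one_smul]
  | some a =>
    change (w.hat _ (ρ.unit a.1 a.2) * w.hat 0 (ρ.actK x 1)) (w.val φ) =
      (w.hat 0 (ρ.actK x 1) * w.hat _ (ρ.unit a.1 a.2)) (w.val φ)
    rw [hat_mul_hat, hat_mul_hat, add_comm 0]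
    congr 2
    simpa [unit] using (h.actK_one_mul_deltas_vf x a.2 (l := [a.1]) (by simp)).symm

theorem g_none_mul_self : w.g none * w.g none = 1 := by
  refine LinearMap.ext fun φ => w.val_injective ?_
  change (w.hat 1 (h.s 1) * w.hat 1 (h.s 1)) (w.val φ) = w.val φ
  rw [hat_mul_hat, signOp_mul_signOp, zmod_two_add_self, signOp_zero, hat_zero_one]
  rfl

theorem g_none_mul_some (a : Idx q n × Idx q n) : w.g none * w.g (some a) =
    ksign 1 (par a.1 + par a.2) • (w.g (some a) * w.g none) := by
  refine LinearMap.ext fun φ => w.val_injective ?_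
  change (w.hat 1 (h.s 1) * w.hat _ (ρ.unit a.1 a.2)) (w.val φ) =
    ksign 1 (par a.1 + par a.2) • (w.hat _ (ρ.unit a.1 a.2) * w.hat 1 (h.s 1)) (w.val φ)
  rw [hat_mul_hat, hat_mul_hat, (h.isConst_unit a.1 a.2).s_mul, add_comm 1, hat_smul]
  rfl

theorem k_lie (x y : 𝔨) : w.k ⁅x, y⁆ = ⁅w.k x, w.k y⁆ := by
  refine LinearMap.ext fun φ => w.val_injective ?_
  change w.hat 0 (ρ.actK ⁅x, y⁆ 1) (w.val φ) =
    (w.hat 0 (ρ.actK x 1) * w.hat 0 (ρ.actK y 1)) (w.val φ) -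
      (w.hat 0 (ρ.actK y 1) * w.hat 0 (ρ.actK x 1)) (w.val φ)
  have h1 := h.actK_one_mul_deltas_actK x y []
  rw [deltas_nil, deltas_nil] at h1
  rw [hat_mul_hat, hat_mul_hat, h1, add_zero, hat_add, LinearMap.add_apply, add_sub_cancel_right]

/-- The action of `𝔨` on `w.Mult`. -/
def kHom : 𝔨 →ₗ⁅ℂ⁆ Module.End ℂ w.Mult where
  toFun := w.k
  map_add' x y := by
    refine LinearMap.ext fun φ => w.val_injective ?_
    rw [LinearMap.add_apply, map_add, val_k, val_k, val_k, map_add, LinearMap.add_apply, hat_add,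
      LinearMap.add_apply]
  map_smul' c x := by
    refine LinearMap.ext fun φ => w.val_injective ?_
    rw [LinearMap.smul_apply, map_smul, val_k, val_k, map_smul, LinearMap.smul_apply, hat_smul,
      LinearMap.smul_apply]
    rfl
  map_lie' := w.k_lie _ _

section Simple

variable (hK : ∀ (x : 𝔨) (l : List (Idx q n)), l ≠ [] → ρ.deltas l (ρ.actK x) 1 = 0)
  (hW : ∀ (i : Idx q n) (l : List (Idx q n)), 2 ≤ l.length → ρ.deltas l (ρ.vf i) 1 = 0)

include hK hW

/-- After the vanishing results, the only operators left on the multiplicity space are parity, the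
matrix units and `𝔨`. -/
theorem N_simple_of_vanishing (hs : ρ.IsSimple) (Q : Submodule ℂ w.Mult)
    (hg : ∀ i, ∀ φ ∈ Q, w.g i φ ∈ Q) (hk : ∀ x, ∀ φ ∈ Q, w.k x φ ∈ Q) : Q = ⊥ ∨ Q = ⊤ := by
  have hinj := Submodule.map_injective_of_injective w.val_injective
  by_cases h0 : Q = ⊥
  · exact Or.inl h0
  right
  refine hinj ((w.N_simple hs (Submodule.map_le_iff_le_comap.2
    fun φ _ => w.val_mem φ) (fun h1 => h0 (hinj (by
    rw [h1, Submodule.map_bot]))) ?_ ?_ ?_).trans (w.map_val_top).symm)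
  · rintro _ ⟨φ, hφ, rfl⟩
    exact ⟨_, hg none φ hφ, rfl⟩
  · rintro x l _ ⟨φ, hφ, rfl⟩
    rcases eq_or_ne l [] with rfl | hl
    · exact ⟨_, hk x φ hφ, rfl⟩
    · rw [hK x l hl]
      rw [show w.hat _ 0 (w.val φ) = 0 from LinearMap.ext fun p => rfl]
      exact zero_mem _
  · rintro i l hl _ ⟨φ, hφ, rfl⟩
    match l with
    | [] => exact absurd rfl hl
    | a :: b :: l =>
      rw [hW i _ (by simp)]
      rw [show w.hat _ 0 (w.val φ) = 0 from LinearMap.ext fun p => rfl]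
      exact zero_mem _
    | [j] =>
      refine ⟨_, hg (some (j, i)) φ hφ, ?_⟩
      rw [val_g_some, add_comm (par i)]
      simp [unit]

end Simple

/-! ### The factors over the general linear Lie superalgebra and over `𝔨`. -/

section Multiplicity

variable {M : Submodule ℂ w.Mult} (hM : ∀ i, ∀ φ ∈ M, w.g i φ ∈ M)

/-- The operators `w.g` restricted to an invariant subspace. -/
def gM (i : Option (Idx q n × Idx q n)) : Module.End ℂ M := (w.g i).restrict (hM i)

theorem gM_none_mul_self : w.gM hM none * w.gM hM none = 1 :=
  LinearMap.ext fun m => Subtype.ext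
    (congrArg (fun T : Module.End ℂ w.Mult => T m) w.g_none_mul_self)

theorem gM_none_mul_some (a : Idx q n × Idx q n) : w.gM hM none * w.gM hM (some a) =
    ksign 1 (par a.1 + par a.2) • (w.gM hM (some a) * w.gM hM none) :=
  LinearMap.ext fun m => Subtype.ext
    (congrArg (fun T : Module.End ℂ w.Mult => T m) (w.g_none_mul_some a))

/-- The action of matrices on an invariant subspace of `w.N`. -/
def actM : Matrix (Idx q n) (Idx q n) ℂ →ₗ[ℂ] Module.End ℂ M where
  toFun X := ∑ k, ∑ i, X k i • w.gM hM (some (k, i))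
  map_add' X Y := by simp only [Matrix.add_apply, add_smul, Finset.sum_add_distrib]
  map_smul' c X := by
    simp only [Matrix.smul_apply, smul_assoc, Finset.smul_sum, RingHom.id_apply]

theorem actM_single (k i : Idx q n) : w.actM hM (Matrix.single k i 1) = w.gM hM (some (k, i)) := by
  change ∑ k', ∑ i', Matrix.single k i (1 : ℂ) k' i' • w.gM hM (some (k', i')) = _
  rw [Finset.sum_eq_single k, Finset.sum_eq_single i]
  · simp
  · intro i' _ hi'
    rw [Matrix.single_apply_of_ne _ _ _ _ _ (by tauto), zero_smul]
  · simp
  · intro k' _ hk'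
    refine Finset.sum_eq_zero fun i' _ => ?_
    rw [Matrix.single_apply_of_ne _ _ _ _ _ (by tauto), zero_smul]
  · simp

/-- Homogeneity of `X` is needed because each matrix unit is twisted by its own parity. -/
theorem val_actM {d : ZMod 2} {X : Matrix (Idx q n) (Idx q n) ℂ} (hX : X ∈ glPart q n d) (m : M) :
    w.val (w.actM hM X m) = w.hat d (ρ.glAct X) (w.val m) := by
  have h1 : w.hat d (ρ.glAct X) = ∑ k, ∑ i, X k i • w.hat (par k + par i) (ρ.unit k i) := by
    refine LinearMap.ext fun φ => LinearMap.ext fun p => ?_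
    rw [hat_apply, glAct]
    simp only [LinearMap.sum_apply, LinearMap.smul_apply, hat_apply]
    refine Finset.sum_congr rfl fun k _ => Finset.sum_congr rfl fun i _ => ?_
    by_cases hki : par k + par i = d
    · rw [hki]
    · rw [hX k i hki, zero_smul, zero_smul]
  rw [h1]
  change w.val ((∑ k, ∑ i, X k i • w.gM hM (some (k, i))) m : M) = _
  simp only [LinearMap.sum_apply, LinearMap.smul_apply, Submodule.coe_sum, Submodule.coe_smul,
    map_sum, map_smul]
  rfl

/-- The factor of `V` which is a module over `𝔤𝔩_{q,n}`. -/
def glModule : GLModule q n M where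
  part := involutionPart (w.gM hM none)
  isCompl := isCompl_involutionPart (w.gM_none_mul_self hM)
  act := w.actM hM
  act_homogeneous d X hX := by
    refine isHomogeneous_of_signOp (isCompl_involutionPart (w.gM_none_mul_self hM)) ?_
    rw [signOp_involutionPart (w.gM_none_mul_self hM)]
    change w.gM hM none * (∑ k, ∑ i, X k i • w.gM hM (some (k, i))) =
      ksign 1 d • ((∑ k, ∑ i, X k i • w.gM hM (some (k, i))) * w.gM hM none)
    simp only [Finset.mul_sum, Finset.sum_mul, Finset.smul_sum]
    refine Finset.sum_congr rfl fun k _ => Finset.sum_congr rfl fun i _ => ?_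
    by_cases hki : par k + par i = d
    · rw [mul_smul_comm, gM_none_mul_some, ← hki, smul_mul_assoc, smul_comm]
    · rw [hX k i hki]; simp
  act_scomm d e X hX Y hY := by
    refine LinearMap.ext fun m => Subtype.ext (w.val_injective ?_)
    rw [w.val_actM hM (scomm_mem_glPart hX hY), h.glAct_scomm hX hY]
    have h1 : ∀ {d e : ZMod 2} {X Y : Matrix (Idx q n) (Idx q n) ℂ}, X ∈ glPart q n d →
        Y ∈ glPart q n e → w.val ((w.actM hM X * w.actM hM Y) m : M) =
          w.hat (d + e) (ρ.glAct X * ρ.glAct Y) (w.val m) := by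
      intro d e X Y hX hY
      rw [Module.End.mul_apply, w.val_actM hM hX, w.val_actM hM hY, ← hat_mul_hat]
      rfl
    change _ = w.val ((w.actM hM X * w.actM hM Y) m : M) -
      ksign d e • w.val ((w.actM hM Y * w.actM hM X) m : M)
    rw [h1 hX hY, h1 hY hX, add_comm e]
    rfl

theorem glModule_isSimple [Nontrivial M]
    (hMs : ∀ Q : Submodule ℂ M, (∀ i, ∀ v ∈ Q, w.gM hM i v ∈ Q) → Q = ⊥ ∨ Q = ⊤) :
    (w.glModule hM).IsSimple := by
  refine ⟨inferInstance, fun Q hgr hQ => hMs Q ?_⟩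
  rintro (_ | ⟨k, i⟩)
  · have := (isGraded_iff_signOp (isCompl_involutionPart (w.gM_none_mul_self hM))).1 hgr
    rwa [signOp_involutionPart (w.gM_none_mul_self hM)] at this
  · rw [← actM_single]
    exact hQ _ ⟨_, rfl⟩

/-- The space of homomorphisms of `𝔤𝔩_{q,n}`-modules from `M` to `w.N`. -/
abbrev S : Submodule ℂ (M →ₗ[ℂ] w.Mult) := intertwiners (w.gM hM) w.g

/-- The factor of `V` which is a module over `𝔨`. -/
def lieModule : EvenLieModule 𝔨 (w.S hM) := intertwinersModule w.kHom w.g_mul_k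

end Multiplicity

end AkAction.Vac

end Factors

/-! ### The decomposition of a simple bounded module -/

section Decomposition

theorem intertwiner_eq_zero_of_apply_eq_zero {ι M N : Type*} [AddCommGroup M] [Module ℂ M]
    [AddCommGroup N] [Module ℂ N] {gM : ι → Module.End ℂ M} {gN : ι → Module.End ℂ N}
    (hM : ∀ Q : Submodule ℂ M, (∀ i, ∀ v ∈ Q, gM i v ∈ Q) → Q = ⊥ ∨ Q = ⊤)
    {ψ : intertwiners gM gN} {m : M} (hm : m ≠ 0) (hψ : ψ.1 m = 0) : ψ = 0 := by
  refine Subtype.ext (LinearMap.ker_eq_top.1 ((hM (LinearMap.ker ψ.1) fun i v hv => ?_).resolve_left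
    fun h0 => hm ?_))
  · rw [LinearMap.mem_ker] at hv ⊢
    rw [ψ.2, hv, map_zero]
  · rw [← Submodule.mem_bot ℂ, ← h0]
    exact hψ

/-- By the modular law, two complementary decompositions that are comparable part by part coincide.
Hence only one inclusion of the parities has to be checked for the final isomorphism. -/
theorem eq_of_le_of_codisjoint {α : Type*} [Lattice α] [BoundedOrder α] [IsModularLattice α]
    {B C : ZMod 2 → α} (hle : ∀ d, B d ≤ C d) (hB : Codisjoint (B 0) (B 1))
    (hC : Disjoint (C 0) (C 1)) (d : ZMod 2) : C d = B d := by
  have key : ∀ {a b c d : α}, a ≤ c → b ≤ d → Codisjoint a b → Disjoint c d → c = a := by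
    intro a b c d hac hbd hab hcd
    refine le_antisymm ?_ hac
    have h1 : c = a ⊔ b ⊓ c := by
      rw [← sup_inf_assoc_of_le b hac, hab.eq_top, top_inf_eq]
    rw [h1]
    exact sup_le le_rfl (le_trans (le_inf inf_le_right (inf_le_left.trans hbd)
      |>.trans hcd.le_bot) bot_le)
  rcases zmod_two_cases d with rfl | rfl
  · exact key (hle 0) (hle 1) hB hC
  · exact key (hle 1) (hle 0) hB.symm hC.symm

/-- Reconciles the sign of the right derivative with the sign `|t_k|(|f| - 1)` in the action on the
tensor module. -/
theorem ksign_add_self (d e : ZMod 2) : ksign d (d + e) = ksign d (e - 1) := by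
  rcases zmod_two_cases d with rfl | rfl
  · simp
  · rw [add_comm, show e + 1 = e - 1 by revert e; decide]

variable {q n : ℕ} {𝔨 : Type*} [LieRing 𝔨] [LieAlgebra ℂ 𝔨]

theorem codisjoint_tensorModule_part {P M S : Type*} [AddCommGroup P] [Module ℂ P]
    [AddCommGroup M] [Module ℂ M] [AddCommGroup S] [Module ℂ S] (π : WeylModule q n P)
    (μ : GLModule q n M) (σ : EvenLieModule 𝔨 S) :
    Codisjoint ((tensorModule π μ σ).part 0) ((tensorModule π μ σ).part 1) := by
  set T := (tensorModule π μ σ).part 0 ⊔ (tensorModule π μ σ).part 1 with hT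
  have hle : ∀ d, (tensorModule π μ σ).part d ≤ T := fun d => by
    rcases zmod_two_cases d with rfl | rfl
    · exact le_sup_left
    · exact le_sup_right
  have hmem : ∀ {a b c : ZMod 2} {u : P} {v : M} {s : S}, u ∈ π.part a → v ∈ μ.part b →
      s ∈ σ.part c → (u ⊗ₜ[ℂ] v) ⊗ₜ[ℂ] s ∈ T := fun {a b c u v s} hu hv hs =>
    hle (a + b + c) (Submodule.subset_span ⟨a, b, c, rfl, u, hu, v, hv, s, hs, rfl⟩)
  rw [codisjoint_iff, ← hT, eq_top_iff]
  rintro z -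
  induction z using TensorProduct.induction_on with
  | zero => exact zero_mem _
  | add x y hx hy => exact add_mem hx hy
  | tmul y s =>
    induction y using TensorProduct.induction_on with
    | zero => rw [TensorProduct.zero_tmul]; exact zero_mem _
    | add x y hx hy => rw [TensorProduct.add_tmul]; exact add_mem hx hy
    | tmul u v =>
      obtain ⟨u₀, hu₀, u₁, hu₁, rfl⟩ := Submodule.mem_sup.1
        (π.isCompl.sup_eq_top ▸ Submodule.mem_top : u ∈ π.part 0 ⊔ π.part 1)
      obtain ⟨v₀, hv₀, v₁, hv₁, rfl⟩ := Submodule.mem_sup.1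
        (μ.isCompl.sup_eq_top ▸ Submodule.mem_top : v ∈ μ.part 0 ⊔ μ.part 1)
      obtain ⟨s₀, hs₀, s₁, hs₁, rfl⟩ := Submodule.mem_sup.1
        (σ.isCompl.sup_eq_top ▸ Submodule.mem_top : s ∈ σ.part 0 ⊔ σ.part 1)
      simp only [TensorProduct.add_tmul, TensorProduct.tmul_add]
      refine add_mem (add_mem (add_mem ?_ ?_) (add_mem ?_ ?_))
        (add_mem (add_mem ?_ ?_) (add_mem ?_ ?_)) <;> exact hmem ‹_› ‹_› ‹_›

variable {V : Type*} [AddCommGroup V] [Module ℂ V]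

namespace AkAction.Vac

variable {ρ : AkAction q n 𝔨 V} {h : ρ.IsModule} (w : Vac h) {𝔥 : LieSubalgebra ℂ 𝔨}
  {M : Submodule ℂ w.Mult} (hM : ∀ i, ∀ φ ∈ M, w.g i φ ∈ M)

theorem g_mem_comap_U (χ : Fin q ⊕ 𝔥 → ℂ) (i : Option (Idx q n × Idx q n)) :
    ∀ φ ∈ (w.U 𝔥 χ).comap w.val, w.g i φ ∈ (w.U 𝔥 χ).comap w.val := by
  intro φ hφ
  cases i with
  | none => exact w.hat_s_mem_U χ _ hφ
  | some a =>
    exact w.hat_mem_U (h.isConst_unit a.1 a.2)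
      (by simpa [unit] using h.isNeutral_deltas_vf a.2 (l := [a.1]) (by simp)) χ _ hφ

theorem lieModule_isSimple [Nontrivial M]
    (hK : ∀ (x : 𝔨) (l : List (Idx q n)), l ≠ [] → ρ.deltas l (ρ.actK x) 1 = 0)
    (hW : ∀ (i : Idx q n) (l : List (Idx q n)), 2 ≤ l.length → ρ.deltas l (ρ.vf i) 1 = 0)
    (hs : ρ.IsSimple) (hbij : Function.Bijective (evalIntertwiners (w.gM hM) w.g)) :
    (w.lieModule hM).IsSimple := by
  refine ⟨?_, fun Q _ hQ => intertwiners_simple w.g_mul_k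
    (w.N_simple_of_vanishing hK hW hs) hbij fun x ψ hψ ψ' h' => ?_⟩
  · obtain ⟨m, hm⟩ := exists_ne (0 : M)
    exact ⟨⟨M.subtype, fun i m => rfl⟩, 0, fun h0 => hm (Subtype.ext
      (congrArg (fun ψ : w.S hM => ψ.1 m) h0))⟩
  · rw [show ψ' = (w.lieModule hM).act x ψ from Subtype.ext h']
    exact hQ _ ⟨x, rfl⟩ ψ hψ

/-- Contraction of the factor `M` commutes with `𝔨`, so it carries the weight decomposition of the
multiplicity space to `S`. -/
theorem lieModule_isWeight [Nontrivial M] (hs : ρ.IsSimple) (hb : ρ.IsBounded 𝔥)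
    (hbij : Function.Bijective (evalIntertwiners (w.gM hM) w.g)) :
    IsWeight fun x : 𝔥 => (w.lieModule hM).act x := by
  obtain ⟨f, m, G, hf, hG⟩ := exists_proj_of_bijective hbij
  have hGk : ∀ (x : 𝔨) (φ : w.Mult), G (w.k x φ) = (w.lieModule hM).act x (G φ) := by
    intro x φ
    obtain ⟨z, rfl⟩ := hbij.2 φ
    induction z using TensorProduct.induction_on with
    | zero => simp only [map_zero]
    | add y z hy hz => simp only [map_add, hy, hz]
    | tmul m' ψ =>
      rw [evalIntertwiners_tmul, hG, map_smul]
      exact hG ((w.lieModule hM).act x ψ) m'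
  set T := ⨆ ζ : 𝔥 → ℂ, wtSpace (fun x : 𝔥 => (w.lieModule hM).act x) ζ with hT
  have h1 : w.N ≤ (T.comap G).map w.val := by
    refine (w.N_le_iSup_Nwt hs hb).trans (iSup_le fun χ => fun φ hφ => ?_)
    obtain ⟨φ, rfl⟩ := w.exists_val hφ.1
    refine ⟨φ, Submodule.mem_iSup_of_mem (fun x => χ (.inr x)) (mem_wtSpace.2 fun x => ?_), rfl⟩
    have h2 : w.k x φ = χ (.inr x) • φ :=
      w.val_injective ((mem_wtSpace.1 hφ.2 (.inr x)).trans (map_smul w.val _ _).symm)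
    rw [← hGk, h2, map_smul]
  rw [IsWeight, eq_top_iff]
  rintro ψ -
  obtain ⟨φ, hφ, h3⟩ := h1 (w.val_mem (ψ.1 m))
  rw [w.val_injective h3] at hφ
  have h4 : G (ψ.1 m) ∈ T := hφ
  rwa [hG, hf, one_smul] at h4

/-- Evaluation at a common eigenvector in `M` of the even diagonal matrix units is injective by
simplicity of `M`, and it embeds a weight space of `S` into one of the spaces `U`, of dimension at
most `c`. -/
theorem rank_wtSpace_lieModule_le [Nontrivial M] [FiniteDimensional ℂ M]
    (hMs : ∀ Q : Submodule ℂ M, (∀ i, ∀ v ∈ Q, w.gM hM i v ∈ Q) → Q = ⊥ ∨ Q = ⊤) {c : ℕ}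
    (hc : ∀ χ, Module.rank ℂ (wtSpace (ρ.H 𝔥) χ) ≤ c) (ζ : 𝔥 → ℂ) :
    Module.rank ℂ (wtSpace (fun x : 𝔥 => (w.lieModule hM).act x) ζ) ≤ c := by
  obtain ⟨m, -, hm0, hm⟩ := exists_mem_forall_apply_eq_smul
    ((Finset.univ : Finset (Fin q)).toList.map fun i => w.gM hM (some (.inl i, .inl i))) (by
      intro B hB B' hB'
      obtain ⟨i, -, rfl⟩ := List.mem_map.1 hB
      obtain ⟨j, -, rfl⟩ := List.mem_map.1 hB'
      refine LinearMap.ext fun m => Subtype.ext (w.val_injective ?_)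
      change (w.hat (par (.inl i : Idx q n) + par (.inl i : Idx q n)) (ρ.E (.inl i)) *
          w.hat (par (.inl j : Idx q n) + par (.inl j : Idx q n)) (ρ.E (.inl j))) (w.val m) =
        (w.hat (par (.inl j : Idx q n) + par (.inl j : Idx q n)) (ρ.E (.inl j)) *
          w.hat (par (.inl i : Idx q n) + par (.inl i : Idx q n)) (ρ.E (.inl i))) (w.val m)
      rw [hat_mul_hat, hat_mul_hat, h.E_mul_E, add_comm]) ⊤ top_ne_bot (fun _ _ _ _ => trivial)
  choose! α hα using hm
  have hα' : ∀ i : Fin q, ∃ a : ℂ, w.gM hM (some (.inl i, .inl i)) m = a • m := fun i =>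
    ⟨_, hα _ (List.mem_map.2 ⟨i, by simp, rfl⟩)⟩
  choose a ha using hα'
  obtain ⟨hfin, hle⟩ := w.finrank_U_le hc (Sum.elim a ζ)
  let e : (w.S hM) →ₗ[ℂ] (w.P →ₗ[ℂ] V) :=
    w.val ∘ₗ LinearMap.applyₗ m ∘ₗ (w.S hM).subtype
  have hinj : Function.Injective e := by
    rw [injective_iff_map_eq_zero]
    intro ψ hψ
    exact intertwiner_eq_zero_of_apply_eq_zero hMs hm0
      (w.val_injective (hψ.trans (map_zero w.val).symm))
  have hmem : ∀ ψ ∈ wtSpace (fun x : 𝔥 => (w.lieModule hM).act x) ζ,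
      e ψ ∈ w.U 𝔥 (Sum.elim a ζ) := by
    intro ψ hψ
    refine w.Nwt_le_U _ ⟨w.val_mem _, mem_wtSpace.2 ?_⟩
    rintro (i | x)
    · have h1 : w.g (some (.inl i, .inl i)) (ψ.1 m) = a i • ψ.1 m := by
        rw [← ψ.2, ha, map_smul]
      have h2 := congrArg w.val h1
      rwa [map_smul] at h2
    · have h1 := congrArg (fun ψ : w.S hM => w.val (ψ.1 m)) (mem_wtSpace.1 hψ x)
      exact h1.trans (map_smul w.val (ζ x) (ψ.1 m))
  have h1 := LinearMap.rank_le_of_injective (e.restrict hmem) fun x y hxy =>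
    Subtype.ext (hinj (congrArg (fun z : w.U 𝔥 (Sum.elim a ζ) => z.1) hxy))
  refine h1.trans ?_
  rw [← Module.finrank_eq_rank]
  exact_mod_cast hle

/-- The evaluation map from `w.P ⊗ w.Mult`. -/
def evMult : w.P ⊗[ℂ] w.Mult →ₗ[ℂ] V := w.ev

/-- The decomposition of `V` as a tensor product. -/
def tensorEquiv (hs : ρ.IsSimple) (hbij : Function.Bijective (evalIntertwiners (w.gM hM) w.g)) :
    (w.P ⊗[ℂ] M) ⊗[ℂ] w.S hM ≃ₗ[ℂ] V :=
  TensorProduct.assoc ℂ w.P M (w.S hM) ≪≫ₗ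
    LinearEquiv.lTensor w.P (LinearEquiv.ofBijective _ hbij) ≪≫ₗ
      LinearEquiv.ofBijective w.evMult (w.ev_bijective hs)

section

variable (hs : ρ.IsSimple) (hbij : Function.Bijective (evalIntertwiners (w.gM hM) w.g))

theorem tensorEquiv_tmul (p : w.P) (m : M) (ψ : w.S hM) :
    w.tensorEquiv hM hs hbij ((p ⊗ₜ m) ⊗ₜ ψ) = w.val (ψ.1 m) p := rfl

theorem tensorEquiv_symm_apply {T : Module.End ℂ V}
    {T' : Module.End ℂ ((w.P ⊗[ℂ] M) ⊗[ℂ] w.S hM)}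
    (hT : ∀ p m ψ, T (w.val (ψ.1 m) p) = w.tensorEquiv hM hs hbij (T' ((p ⊗ₜ m) ⊗ₜ ψ))) (v : V) :
    (w.tensorEquiv hM hs hbij).symm (T v) = T' ((w.tensorEquiv hM hs hbij).symm v) := by
  have h1 : T ∘ₗ (w.tensorEquiv hM hs hbij).toLinearMap =
      (w.tensorEquiv hM hs hbij).toLinearMap ∘ₗ T' :=
    TensorProduct.ext_threefold hT
  rw [LinearEquiv.symm_apply_eq]
  have h2 := congrArg (fun L => L ((w.tensorEquiv hM hs hbij).symm v)) h1
  simpa using h2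

theorem map_part_tensorEquiv_symm (d : ZMod 2) :
    (ρ.part d).map (w.tensorEquiv hM hs hbij).symm.toLinearMap =
      (tensorModule w.weylModule (w.glModule hM) (w.lieModule hM)).part d := by
  set T := tensorModule w.weylModule (w.glModule hM) (w.lieModule hM)
  have h1 : ρ.part d = (T.part d).map (w.tensorEquiv hM hs hbij).toLinearMap := by
    refine eq_of_le_of_codisjoint (C := ρ.part)
      (B := fun d => (T.part d).map (w.tensorEquiv hM hs hbij).toLinearMap) (fun d => ?_) ?_
      h.isCompl.disjoint d
    · rw [Submodule.map_le_iff_le_comap]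
      refine Submodule.span_le.2 ?_
      rintro _ ⟨a, b, c, rfl, p, hp, m, hm, ψ, hψ, rfl⟩
      change w.val (ψ.1 m) p ∈ ρ.part (a + b + c)
      rcases zmod_two_cases c with rfl | rfl
      · have h1 : w.hat 1 (h.s 1) (w.val (ψ.1 m)) = ksign 1 b • w.val (ψ.1 m) := by
          rw [← val_g_none, ← ψ.2, mem_involutionPart.1 hm, map_smul, map_smul]
        rw [mem_part_iff_signOp h.isCompl, w.apply_apply 1, h1, LinearMap.smul_apply,
          signOp_of_mem w.isCompl 1 hp, map_smul, smul_smul, add_zero, ksign_add_right, mul_comm]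
      · have h1 : ψ = 0 := hψ
        rw [h1]
        exact zero_mem _
    · rw [codisjoint_iff, ← Submodule.map_sup,
        codisjoint_iff.1 (codisjoint_tensorModule_part _ _ _), Submodule.map_top,
        LinearEquiv.range]
  rw [h1, ← Submodule.map_comp, LinearEquiv.symm_comp, Submodule.map_id]

theorem actA_tensorEquiv_symm (f : A q n) (v : V) :
    (w.tensorEquiv hM hs hbij).symm (ρ.actA f v) =
      (tensorModule w.weylModule (w.glModule hM) (w.lieModule hM)).actA f
        ((w.tensorEquiv hM hs hbij).symm v) := by
  refine w.tensorEquiv_symm_apply hM hs hbij (fun p m ψ => ?_) v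
  rw [← w.apply_actP (w.val_mem _), ← weylModule_act_ofA]
  rfl

theorem actK_tensorEquiv_symm
    (hK : ∀ (x : 𝔨) (l : List (Idx q n)), l ≠ [] → ρ.deltas l (ρ.actK x) 1 = 0)
    (x : 𝔨) (f : A q n) (v : V) : (w.tensorEquiv hM hs hbij).symm (ρ.actK x f v) =
      (tensorModule w.weylModule (w.glModule hM) (w.lieModule hM)).actK x f
        ((w.tensorEquiv hM hs hbij).symm v) := by
  refine w.tensorEquiv_symm_apply hM hs hbij (fun p m ψ => ?_) v
  have h1 : ρ.actK x f = ρ.actA f * ρ.actK x 1 := by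
    refine h.eq_actA_mul_of_delta (fun j => ρ.eq_zero_of_deltas fun l => ?_) f
    have := hK x (l ++ [j]) (by simp)
    rwa [deltas_append] at this
  have h2 : ρ.actK x 1 (w.val (ψ.1 m) p) = w.val (w.k x (ψ.1 m)) p := by
    rw [val_k, hat_zero_apply]
  rw [h1, Module.End.mul_apply, h2, ← w.apply_actP (w.val_mem _), ← weylModule_act_ofA]
  rfl

/-- Second differences vanish, so the first-order Taylor formula applies; moving a matrix unit past
`p` produces the twist on the Weyl factor. -/
theorem actW_tensorEquiv_symm
    (hW : ∀ (i : Idx q n) (l : List (Idx q n)), 2 ≤ l.length → ρ.deltas l (ρ.vf i) 1 = 0)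
    (d : ZMod 2) (X : W q n d) (v : V) : (w.tensorEquiv hM hs hbij).symm (ρ.actW d X v) =
      (tensorModule w.weylModule (w.glModule hM) (w.lieModule hM)).actW d X
        ((w.tensorEquiv hM hs hbij).symm v) := by
  refine w.tensorEquiv_symm_apply hM hs hbij (fun p m ψ => ?_) v
  have hT : (tensorModule w.weylModule (w.glModule hM) (w.lieModule hM)).actW d X
      ((p ⊗ₜ m) ⊗ₜ ψ) = ∑ i, (w.weylModule.act (Weyl.ofA q n (X.1 (A.gen i)) * Weyl.der i) p ⊗ₜ m)
        ⊗ₜ ψ + ∑ i, ∑ k, ksign (par k) (d + par i - 1) •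
          ((w.weylModule.act (Weyl.ofA q n (A.der k (X.1 (A.gen i))))
            (w.weylModule.twist (par k + par i) p) ⊗ₜ
              w.actM hM (Matrix.single k i 1) m) ⊗ₜ ψ) := by
    change (∑ i, _ + ∑ i, ∑ k, _ : Module.End ℂ _) _ = _
    simp only [LinearMap.add_apply, LinearMap.sum_apply, LinearMap.smul_apply,
      TensorProduct.map_tmul, Module.End.mul_apply, Module.End.one_apply]
    rfl
  rw [hT, map_add, map_sum, map_sum, ρ.actW_eq_sum_vf, LinearMap.sum_apply,
    ← Finset.sum_add_distrib]
  refine Finset.sum_congr rfl fun i _ => ?_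
  rw [h.vf_eq_of_delta_delta (fun j k => ρ.eq_zero_of_deltas fun l => by
    have := hW i (l ++ [k, j]) (by simp)
    rwa [deltas_append] at this), LinearMap.add_apply, LinearMap.sum_apply, map_sum,
    tensorEquiv_tmul, map_mul, Module.End.mul_apply, Module.End.mul_apply, weylModule_act_ofA,
    weylModule_act_der, w.apply_actP (w.val_mem _), w.apply_actD (w.val_mem _)]
  congr 1
  refine Finset.sum_congr rfl fun k _ => ?_
  have h1 : ρ.delta k (ρ.vf i) 1 (w.val (ψ.1 m) p) =
      w.val (ψ.1 (w.gM hM (some (k, i)) m)) (w.tau (par k + par i) p) := by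
    rw [ψ.2, val_g_some]
    exact w.apply_apply _ _ _ _
  have h2 : A.derR k (X.1 (A.gen i)) =
      ksign (par k) (d + par i - 1) • A.der k (X.1 (A.gen i)) := by
    rw [A.derR_apply, A.sgn_of_mem _ (A.der_mem k (W.apply_gen_mem X.2 i)), ksign_add_self]
  rw [map_smul, tensorEquiv_tmul, weylModule_act_ofA, weylModule_twist, actM_single,
    w.apply_actP (w.val_mem _), Module.End.mul_apply, h1, h2, map_smul, LinearMap.smul_apply]

end

end AkAction.Vac

end Decomposition

end SuperVF

end

/-! ### Assembly of the three factors. -/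

theorem mainTheorem5 {q n p : ℕ} (hqn : (q, n) ≠ (0, 0))
    (𝔨 : LieSubalgebra ℂ (Matrix (Fin p) (Fin p) ℂ)) (𝔥 : LieSubalgebra ℂ 𝔨)
    (hlevi : SuperVF.IsLevi 𝔨 𝔥)
    {V : Type u} [AddCommGroup V] [Module ℂ V] (ρ : SuperVF.AkAction q n 𝔨 V)
    (hmod : ρ.IsModule) (hsimple : ρ.IsSimple) (hbdd : ρ.IsBounded 𝔥) :
    ∃ (P M S : Type u) (_ : AddCommGroup P) (_ : Module ℂ P) (_ : AddCommGroup M)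
      (_ : Module ℂ M) (_ : AddCommGroup S) (_ : Module ℂ S)
      (π : SuperVF.WeylModule q n P) (μ : SuperVF.GLModule q n M)
      (σ : SuperVF.EvenLieModule 𝔨 S),
      (π.IsSimple ∧ π.IsWeight) ∧ (μ.IsSimple ∧ FiniteDimensional ℂ M) ∧
      (σ.IsSimple ∧ σ.IsBounded 𝔥) ∧
      Nonempty (ρ.Iso (SuperVF.tensorModule π μ σ)) := by
  obtain ⟨habel, Y, hYfin, hspan, hY⟩ := hlevi.exists_spanning
  have hK : ∀ (x : 𝔨) (l : List (SuperVF.Idx q n)), l ≠ [] → ρ.deltas l (ρ.actK x) 1 = 0 :=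
    fun x l hl => hmod.deltas_actK_eq_zero hsimple hbdd habel hYfin hspan hY x hl
  have hW : ∀ (i : SuperVF.Idx q n) (l : List (SuperVF.Idx q n)), 2 ≤ l.length →
      ρ.deltas l (ρ.vf i) 1 = 0 :=
    fun i l hl => hmod.deltas_vf_eq_zero hsimple hbdd hK i hl
  have := hsimple.1
  obtain ⟨w⟩ := hmod.nonempty_vac hbdd
  obtain ⟨c, hc⟩ := hbdd.2
  obtain ⟨χ, hχ⟩ := w.exists_U_ne_bot hsimple hbdd
  obtain ⟨hfin, -⟩ := w.finrank_U_le hc χ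
  have hfin' : FiniteDimensional ℂ ((w.U 𝔥 χ).comap w.val) :=
    FiniteDimensional.of_injective
      (w.val.restrict (p := (w.U 𝔥 χ).comap w.val) (q := w.U 𝔥 χ) fun _ hφ => hφ)
      fun x y hxy => Subtype.ext (w.val_injective
        (congrArg (fun z : w.U 𝔥 χ => z.1) hxy))
  have hne : (w.U 𝔥 χ).comap w.val ≠ ⊥ := by
    obtain ⟨φ, hφ, hφ0⟩ := (Submodule.ne_bot_iff _).1 hχ
    obtain ⟨φ, rfl⟩ := w.exists_val (w.U_le_N χ hφ)
    exact (Submodule.ne_bot_iff _).2 ⟨φ, hφ, fun h0 => hφ0 (by rw [h0, map_zero])⟩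
  -- A nonzero space `U` is finite-dimensional and invariant under the matrix units and parity, so a
  -- simple `M` can be found inside it.
  obtain ⟨M, hMU, hM0, hM, hMs, hbij⟩ := SuperVF.exists_tensor_decomposition w.g_mul_k
    (w.N_simple_of_vanishing hK hW hsimple) _ hne (w.g_mem_comap_U χ)
  have : Nontrivial M := Submodule.nontrivial_iff_ne_bot.2 hM0
  have hMfin : FiniteDimensional ℂ M := Submodule.finiteDimensional_of_le hMU
  exact ⟨w.P, M, w.S hM, inferInstance, inferInstance, inferInstance, inferInstance, inferInstance,
    inferInstance, w.weylModule, w.glModule hM, w.lieModule hM,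
    ⟨w.weylModule_isSimple, w.weylModule_isWeight⟩, ⟨w.glModule_isSimple hM hMs, hMfin⟩,
    ⟨w.lieModule_isSimple hM hK hW hsimple hbij,
      w.lieModule_isWeight hM hsimple hbdd hbij, c, w.rank_wtSpace_lieModule_le hM hMs hc⟩,
    ⟨⟨(w.tensorEquiv hM hsimple hbij).symm, w.map_part_tensorEquiv_symm hM hsimple hbij,
      w.actA_tensorEquiv_symm hM hsimple hbij, w.actW_tensorEquiv_symm hM hsimple hbij hW,
      w.actK_tensorEquiv_symm hM hsimple hbij hK⟩⟩⟩
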